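/- Consider a finite $n$-player extensive-form game with perfect recall and a player $i\in[n]$ who has at least one information set. Let $\mathcal J$ be the set of information sets of player $i$, let $A(j)$ be the set of actions at $j\in\mathcal J$, let $\Sigma_*=\{(j,a):j\in\mathcal J,\ a\in A(j)\}$, and let $\Sigma=\Sigma_*\cup\{\varnothing\}$ be the set of sequences of the player, where $\varnothing$ is the empty sequence. Let $\sigma(j)\in\Sigma$ be the last sequence of the player on the path to $j$. Write $\preceq$ for the precedence order of sequences and of information sets, and write $\sigma\succeq j$ if $\sigma=(j',a')$ with $j'\succeq j$. Let $\Sigma_j=\{\sigma:\sigma\succeq j\}$. Let $$Q=\Big\{q\in\mathbb R_{\ge0}^{\Sigma}: q[\varnothing]=1,\ q[\sigma(j)]=\sum_{a\in A(j)}q[(j,a)]\ \ \forall j\in\mathcal J\Big\}$$ be the polytope of mixed sequence-form strategies. Let $Q_j$ be the set of all $y\in\mathbb R_{\ge0}^{\Sigma_j}$ with $\sum_{a\in A(j)}y[(j,a)]=1$ and $y[\sigma(j')]=\sum_{a\in A(j')}y[(j',a)]$ for all $j'\succ j$, and let $\Pi_j=Q_j\cap\{0,1\}^{\Sigma_j}$.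 For $\hat\sigma=(j,a)\in\Sigma_*$ and $y\in\mathbb R^{\Sigma_j}$ let $\phi_{\hat\sigma\to y}:\mathbb R^\Sigma\to\mathbb R^\Sigma$ be the linear map whose matrix has the entry $1$ at $(\sigma_r,\sigma_c)$ if $\sigma_c\not\succeq\hat\sigma$ and $\sigma_r=\sigma_c$, the entry $y[\sigma_r]$ if $\sigma_c=\hat\sigma$ and $\sigma_r\succeq j$, and the entry $0$ otherwise. Let $\Phi=\{\phi_{\hat\sigma\to y}:\hat\sigma=(j,a)\in\Sigma_*,\ y\in\Pi_j\}$. The algorithm. For each $\hat\sigma=(j,a)\in\Sigma_*$ run a copy of the CFR algorithm (regret matching at every information set $j'\succeq j$) for $Q_j$, and run regret matching for the simplex of probability vectors on $\Sigma_*$. All regret matchers play uniformly when no regret is positive. At time $t$: * NextElement obtains the next outputs $\lambda^t$ of the regret matching algorithm on the simplex and $q^t_{\hat\sigma}$ of the copies of CFR, which represent $\phi^t=\sum_{\hat\sigma}\lambda^t[\hat\sigma]\,\phi_{\hat\sigma\to q^t_{\hat\sigma}}$. It computes a fixed point $q^t$ of $\phi^t$ and returns it. To do so, it starts from $x[\varnothing]=1$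 and visits the information sets $j^*$ in a top-down order. At $j^*$, with $\sigma_p=\sigma(j^*)$, it forms the matrix $$W[a_r,a_c]=\sum_{(j',a'):\,j'\preceq\sigma_p}\lambda^t[(j',a')]\,q^t_{(j',a')}[(j^*,a_r)]\,x[(j',a')]+\Big(\lambda^t[(j^*,a_c)]\,q^t_{(j^*,a_c)}[(j^*,a_r)]+\Big(1-\sum_{\hat\sigma\preceq(j^*,a_c)}\lambda^t[\hat\sigma]\Big)\mathbf 1[a_r=a_c]\Big)x[\sigma_p],$$ and it sets $x[(j^*,\cdot)]=0$ if $x[\sigma_p]=0$, and $x[(j^*,\cdot)]=x[\sigma_p]\,b$ otherwise, where $b$ is the fixed point of the stochastic matrix $W/x[\sigma_p]$ that an oracle returns. At the end, $q^t=x$. * ObserveUtility$(\ell^t)$, for a linear function $\ell^t:\mathbb R^\Sigma\to\mathbb R$ given by its coefficient vector, forms the matrix of the functional $L^t:\phi\mapsto\ell^t(\phi(q^t))$. It passes the linear utility $y\mapsto L^t(\phi_{\hat\sigma\to y})-L^t(\phi_{\hat\sigma\to0})$ to the copy of CFR for $\hat\sigma$, and the linear utility $\lambda\mapsto\sum_{\hat\sigma}\lambda[\hat\sigma]\,L^t(\phi_{\hat\sigma\to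 q^t_{\hat\sigma}})$ to the regret matching algorithm on the simplex. The model of computation is a real random access machine with unit cost per operation, where the pointer structure of the tree of sequences is laid out in advance. The oracle returns, for every $m\times m$ column-stochastic matrix ($m\ge1$), a fixed point in the simplex in $O(\mathrm{FP}(m))$ time. **Theorem.** The algorithm is a $\operatorname{co}\Phi$-regret minimizer for $Q$: every $\phi\in\operatorname{co}\Phi$ maps $Q$ to $Q$; the output $q^t$ lies in $Q$ and depends only on $\ell^1,\dots,\ell^{t-1}$; and the regret $$R^T=\max_{\phi\in\operatorname{co}\Phi}\sum_{t=1}^T\big(\ell^t(\phi(q^t))-\ell^t(q^t)\big)$$ (the maximum is attained) grows sublinearly in $T$ if the ranges of the $\ell^t$ on $Q$ are uniformly bounded. It is an instance of the construction of Gordon et al., that is, $\phi^t\in\operatorname{co}\Phi$ and $\phi^t(q^t)=q^t$ at all times $t$. For all linear utility functions $\ell^1,\dots,\ell^T$, $$R^T\le 2D\,|\Sigma|\,\sqrt T,$$ where $D$ is any constant such that $\ell^t(q)-\ell^t(q')\le D$ for all $q,q'\in Q$ and all $t=1,\dots,T$. Furthermore, at all $t$, ObserveUtility takes $O(|\Sigma|^2)$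 time and NextElement takes $O\big(|\Sigma|^2+\sum_{j\in\mathcal J}\mathrm{FP}(|A(j)|)\big)$ time, where the implied constants depend only on the implied constant of the oracle. -/

import Mathlib

open Filter Topology
open scoped NNReal

noncomputable section

/-! ## Extensive-form games

A node of the game tree is the list of actions leading to it from the root, MOST RECENT ACTION
FIRST: the root is `[]`, and the child of `h` under action `a` is `a :: h`. Hence the path from the
root to `h` passes through `g` iff `g` is a suffix of `h`. -/

/-- A finite `n`-player extensive-form game (`player h = none` means that chance moves at `h`).
The fields `player` and `info` are only meaningful at decision nodes, `payoff` at leaves. -/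
structure ExtensiveGame (n : ℕ) where
  Act : Type
  Info : Type
  nodes : Finset (List Act)
  /-- The set of actions available at a node. -/
  acts : List Act → Finset Act
  player : List Act → Option (Fin n)
  /-- The label of the information set of the acting player that contains the node. -/
  info : List Act → Info
  chance : List Act → Act → ℝ
  payoff : Fin n → List Act → ℝ
  root_mem : [] ∈ nodes
  closed : ∀ a h, a :: h ∈ nodes → h ∈ nodes
  mem_acts : ∀ h ∈ nodes, ∀ a, a ∈ acts h ↔ a :: h ∈ nodes
  chance_pos : ∀ h ∈ nodes, player h = none → ∀ a ∈ acts h, 0 < chance h a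
  chance_sum : ∀ h ∈ nodes, player h = none → (acts h).Nonempty → ∑ a ∈ acts h, chance h a = 1
  /-- Nodes in the same information set have the same actions. -/
  acts_eq : ∀ h ∈ nodes, ∀ h' ∈ nodes, (acts h).Nonempty → (acts h').Nonempty →
    player h ≠ none → player h = player h' → info h = info h' → acts h = acts h'

namespace ExtensiveGame

variable {n : ℕ} (G : ExtensiveGame n)

/-- `h` is a decision node of player `i`. -/
def IsNodeOf (i : Fin n) (h : List G.Act) : Prop :=
  h ∈ G.nodes ∧ (G.acts h).Nonempty ∧ G.player h = some i

open Classical in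
/-- The information sets visited and actions taken by player `i` on the path from the root to a
node, most recent first. -/
def ownHistory (i : Fin n) : List G.Act → List (G.Info × G.Act)
  | [] => []
  | a :: h => if G.player h = some i then (G.info h, a) :: ownHistory i h else ownHistory i h

/-- Perfect recall: at any two nodes of the same information set, a player has the same own
history. -/
def PerfectRecall : Prop :=
  ∀ (i : Fin n) (h h' : List G.Act), G.IsNodeOf i h → G.IsNodeOf i h' → G.info h = G.info h' →
    G.ownHistory i h = G.ownHistory i h'

/-- The information sets of player `i`. -/
def InfoSet (i : Fin n) : Type := {I : G.Info // ∃ h, G.IsNodeOf i h ∧ G.info h = I}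

/-- The actions available at an information set. -/
def ActionAt {i : Fin n} (j : G.InfoSet i) : Type :=
  {a : G.Act // ∃ h, G.IsNodeOf i h ∧ G.info h = j.1 ∧ a ∈ G.acts h}

instance (i : Fin n) : Finite (G.InfoSet i) := by
  have : Set.Finite {I : G.Info | ∃ h, G.IsNodeOf i h ∧ G.info h = I} := by
    refine (G.nodes.finite_toSet.image G.info).subset ?_
    rintro I ⟨h, hh, rfl⟩
    exact ⟨h, hh.1, rfl⟩
  exact this.to_subtype

instance {i : Fin n} (j : G.InfoSet i) : Finite (G.ActionAt j) := by
  have : Set.Finite {a : G.Act | ∃ h, G.IsNodeOf i h ∧ G.info h = j.1 ∧ a ∈ G.acts h} := by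
    refine (G.nodes.finite_toSet.biUnion (fun h _ => (G.acts h).finite_toSet)).subset ?_
    rintro a ⟨h, hh, _, ha⟩
    exact Set.mem_biUnion (Finset.mem_coe.2 hh.1) ha
  exact this.to_subtype

instance {i : Fin n} (j : G.InfoSet i) : Nonempty (G.ActionAt j) := by
  obtain ⟨I, h, hh, hI⟩ := j
  obtain ⟨a, ha⟩ := hh.2.1
  exact ⟨⟨a, h, hh, hI, ha⟩⟩

open Classical in
/-- The last sequence (information set and action) of player `i` on the path to a node; `none` is
the empty sequence. -/
def lastSeq (i : Fin n) :
    (h : List G.Act) → h ∈ G.nodes → Option (Σ j : G.InfoSet i, G.ActionAt j)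
  | [], _ => none
  | a :: h, hm =>
    if hp : G.player h = some i then
      have ha : a ∈ G.acts h := (G.mem_acts h (G.closed a h hm) a).2 hm
      have hn : G.IsNodeOf i h := ⟨G.closed a h hm, ⟨a, ha⟩, hp⟩
      some ⟨⟨G.info h, h, hn, rfl⟩, ⟨a, h, hn, rfl, ha⟩⟩
    else lastSeq i h (G.closed a h hm)

/-- Some node of the information set. -/
def rep {i : Fin n} (j : G.InfoSet i) : List G.Act := Classical.choose j.2

theorem rep_spec {i : Fin n} (j : G.InfoSet i) :
    G.IsNodeOf i (G.rep j) ∧ G.info (G.rep j) = j.1 := Classical.choose_spec j.2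

/-- The sequence `σ(j)`: the last sequence of the player on the path to (any node of) `j`. -/
def parentSeq {i : Fin n} (j : G.InfoSet i) : Option (Σ j : G.InfoSet i, G.ActionAt j) :=
  G.lastSeq i (G.rep j) (G.rep_spec j).1.1

theorem lastSeq_some {i : Fin n} {j : G.InfoSet i} {a : G.ActionAt j} :
    ∀ (h : List G.Act) (hm : h ∈ G.nodes), G.lastSeq i h hm = some ⟨j, a⟩ →
      ∃ g, G.IsNodeOf i g ∧ G.info g = j.1 ∧ (a.1 :: g) <:+ h ∧
        G.ownHistory i h = (j.1, a.1) :: G.ownHistory i g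
  | [], _, hs => by simp [lastSeq] at hs
  | b :: h, hm, hs => by
    by_cases hp : G.player h = some i
    · have ha : b ∈ G.acts h := (G.mem_acts h (G.closed b h hm) b).2 hm
      simp only [lastSeq, hp, dif_pos, Option.some.injEq] at hs
      obtain ⟨rfl, hs⟩ := Sigma.mk.inj_iff.1 hs
      obtain rfl := eq_of_heq hs
      exact ⟨h, ⟨G.closed b h hm, ⟨b, ha⟩, hp⟩, rfl, List.suffix_refl _, by simp [ownHistory, hp]⟩
    · simp only [lastSeq, hp, dif_neg, not_false_eq_true] at hs
      obtain ⟨g, h1, h2, h3, h4⟩ := lastSeq_some h _ hs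
      exact ⟨g, h1, h2, h3.trans (List.suffix_cons _ _), by simpa [ownHistory, hp] using h4⟩

theorem parentSeq_wf (hG : G.PerfectRecall) (i : Fin n) :
    WellFounded (fun j j' : G.InfoSet i => ∃ a, G.parentSeq j' = some ⟨j, a⟩) := by
  refine Subrelation.wf (r := InvImage (· < ·) fun j => (G.ownHistory i (G.rep j)).length) ?_
    (InvImage.wf _ wellFounded_lt)
  rintro j j' ⟨a, ha⟩
  obtain ⟨g, h1, h2, -, h4⟩ := G.lastSeq_some _ _ ha
  have := hG i (G.rep j) g (G.rep_spec j).1 h1 ((G.rep_spec j).2.trans h2.symm)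
  simp [InvImage, h4, this]

end ExtensiveGame

/-! ## The forest of information sets of a player -/

/-- The forest of the information sets of one player, with the actions `A j` available at `j`, and
the last sequence `par j` of the player before `j` (`none` is the empty sequence). -/
structure InfoForest where
  J : Type
  A : J → Type
  [fintypeJ : Fintype J]
  [decEqJ : DecidableEq J]
  [fintypeA : ∀ j, Fintype (A j)]
  [decEqA : ∀ j, DecidableEq (A j)]
  [nonemptyA : ∀ j, Nonempty (A j)]
  par : J → Option (Σ j, A j)
  wf : WellFounded (fun j j' => ∃ a, par j' = some ⟨j, a⟩)

attribute [instance] InfoForest.fintypeJ InfoForest.decEqJ InfoForest.fintypeA InfoForest.decEqA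
  InfoForest.nonemptyA

open Classical in
/-- The forest of information sets of player `i` in a game with perfect recall. -/
def ExtensiveGame.forest {n : ℕ} (G : ExtensiveGame n) (hG : G.PerfectRecall) (i : Fin n) :
    InfoForest where
  J := G.InfoSet i
  A := fun j => G.ActionAt j
  fintypeJ := Fintype.ofFinite _
  fintypeA := fun _ => Fintype.ofFinite _
  decEqJ := Classical.decEq _
  decEqA := fun _ => Classical.decEq _
  par := G.parentSeq
  wf := G.parentSeq_wf hG i

namespace InfoForest

variable (F : InfoForest)

/-- Sequences other than the empty one. -/
abbrev SeqStar : Type := Σ j, F.A j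

/-- All sequences; `none` is the empty sequence. -/
abbrev Seq : Type := Option F.SeqStar

/-- `σ ⪯ σ'`: the sequence `σ` is an initial piece of `σ'`. -/
def SeqLE (s t : F.Seq) : Prop :=
  Relation.ReflTransGen (fun u v => ∃ j a, v = some ⟨j, a⟩ ∧ u = F.par j) s t

/-- `j ≺ j'`: the player acts at `j` before reaching `j'`. -/
def InfoLT (j j' : F.J) : Prop := ∃ a, F.SeqLE (some ⟨j, a⟩) (F.par j')

/-- `j ⪯ j'`. -/
def InfoLE (j j' : F.J) : Prop := j = j' ∨ F.InfoLT j j'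

/-- `σ ⪰ j`: the sequence `σ = (j', a')` satisfies `j ⪯ j'`. -/
def SeqGE (s : F.Seq) (j : F.J) : Prop := ∃ j' a', s = some ⟨j', a'⟩ ∧ F.InfoLE j j'

/-- The sequences that terminate at `j` or at one of its descendants. -/
abbrev SeqAt (j : F.J) : Type := {s : F.Seq // F.SeqGE s j}

variable {F}

theorem SeqGE.of_le {j j' : F.J} (h : F.InfoLE j j') (a : F.A j') :
    F.SeqGE (some ⟨j', a⟩) j := ⟨j', a, rfl, h⟩

theorem SeqGE.of_lt {j j' : F.J} (h : F.InfoLT j j') : F.SeqGE (F.par j') j := by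
  obtain ⟨a, h⟩ := h
  rcases Relation.ReflTransGen.cases_tail h with h | ⟨b, hb, k, c, hk, rfl⟩
  · exact ⟨j, a, h, Or.inl rfl⟩
  · exact ⟨k, c, hk, Or.inr ⟨a, hb⟩⟩

variable (F)

/-- The polytope `Q` of (mixed) sequence-form strategies. -/
def polytope : Set (F.Seq → ℝ) :=
  {q | (∀ s, 0 ≤ q s) ∧ q none = 1 ∧ ∀ j, q (F.par j) = ∑ a, q (some ⟨j, a⟩)}

/-- The sequence-form strategies `Q_j` for the subtree rooted at `j`. -/
def subPolytope (j : F.J) : Set (F.SeqAt j → ℝ) :=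
  {q | (∀ s, 0 ≤ q s) ∧ ∑ a, q ⟨some ⟨j, a⟩, SeqGE.of_le (Or.inl rfl) a⟩ = 1 ∧
    ∀ (j' : F.J) (h : F.InfoLT j j'),
      q ⟨F.par j', SeqGE.of_lt h⟩ = ∑ a, q ⟨some ⟨j', a⟩, SeqGE.of_le (Or.inr h) a⟩}

/-- The deterministic sequence-form strategies `Π_j` for the subtree rooted at `j`. -/
def subPure (j : F.J) : Set (F.SeqAt j → ℝ) := {q ∈ F.subPolytope j | ∀ s, q s = 0 ∨ q s = 1}

open Classical in
/-- The matrix of the canonical trigger deviation function with trigger `s` and continuation `y`. -/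
def devMatrix (s : F.SeqStar) (y : F.SeqAt s.1 → ℝ) : Matrix F.Seq F.Seq ℝ := fun r c =>
  if ¬ F.SeqLE (some s) c ∧ r = c then 1
  else if h : c = some s ∧ F.SeqGE r s.1 then y ⟨r, h.2⟩
  else 0

/-- The linear map `x ↦ M x` of the deviation matrix. -/
def devMap (s : F.SeqStar) (y : F.SeqAt s.1 → ℝ) : (F.Seq → ℝ) →ₗ[ℝ] (F.Seq → ℝ) :=
  (F.devMatrix s y).mulVecLin

/-- The set `Φ` of all canonical trigger deviation functions. -/
def triggerDeviations : Set ((F.Seq → ℝ) →ₗ[ℝ] (F.Seq → ℝ)) :=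
  {f | ∃ s : F.SeqStar, ∃ y ∈ F.subPure s.1, f = F.devMap s y}

/-- An enumeration of the information sets in which ancestors come first. -/
structure TopDownOrder where
  list : List F.J
  nodup : list.Nodup
  complete : ∀ j, j ∈ list
  topDown : list.Pairwise (fun j j' => ¬ F.InfoLT j' j)

end InfoForest

/-! The next two facts check that the orders of the forest are those given by paths in the game
tree. -/

namespace ExtensiveGame

variable {n : ℕ} (G : ExtensiveGame n)

theorem suffix_cons_mem_nodes {g : List G.Act} : ∀ {h : List G.Act}, h ∈ G.nodes → g <:+ h →
    g ∈ G.nodes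
  | [], hm, hs => by simpa [List.suffix_nil.1 hs] using hm
  | b :: h, hm, hs => by
    rcases List.suffix_cons_iff.1 hs with rfl | hs
    · exact hm
    · exact suffix_cons_mem_nodes (G.closed _ _ hm) hs

theorem lastSeq_congr {i : Fin n} : ∀ (h : List G.Act) (hm : h ∈ G.nodes),
    (G.lastSeq i h hm).map (fun s => (s.1.1, s.2.1)) = (G.ownHistory i h).head?
  | [], _ => by simp [lastSeq, ownHistory]
  | b :: h, hm => by
    by_cases hp : G.player h = some i
    · simp [lastSeq, ownHistory, hp]
    · simpa [lastSeq, ownHistory, hp] using lastSeq_congr h (G.closed b h hm)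

theorem lastSeq_eq_of_ownHistory_eq {i : Fin n} {h h' : List G.Act} (hm : h ∈ G.nodes)
    (hm' : h' ∈ G.nodes) (he : G.ownHistory i h = G.ownHistory i h') :
    G.lastSeq i h hm = G.lastSeq i h' hm' := by
  have hinj : Function.Injective
      (fun s : (Σ j : G.InfoSet i, G.ActionAt j) => (s.1.1, s.2.1)) := by
    rintro ⟨⟨I, hI⟩, ⟨a, ha⟩⟩ ⟨⟨I', hI'⟩, ⟨a', ha'⟩⟩ hs
    obtain ⟨rfl, rfl⟩ := (Prod.mk.injEq _ _ _ _).mp hs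
    rfl
  refine Option.map_injective hinj ?_
  rw [lastSeq_congr, lastSeq_congr, he]

theorem forest_seqLE_lastSeq_iff (hG : G.PerfectRecall) (i : Fin n)
    (s : (G.forest hG i).SeqStar) : ∀ (h : List G.Act) (hm : h ∈ G.nodes),
    ((G.forest hG i).SeqLE (some s) (G.lastSeq i h hm) ↔ (s.1.1, s.2.1) ∈ G.ownHistory i h)
  | [], hm => by
    simp only [lastSeq, ownHistory, List.not_mem_nil, iff_false]
    intro hs
    rcases Relation.ReflTransGen.cases_tail hs with hs | ⟨b, hb, k, c, hk, -⟩
    · cases hs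
    · cases hk
  | b :: h, hm => by
    by_cases hp : G.player h = some i
    · have ih := forest_seqLE_lastSeq_iff hG i s h (G.closed b h hm)
      have ha : b ∈ G.acts h := (G.mem_acts h (G.closed b h hm) b).2 hm
      have hn : G.IsNodeOf i h := ⟨G.closed b h hm, ⟨b, ha⟩, hp⟩
      let j : G.InfoSet i := ⟨G.info h, h, hn, rfl⟩
      let c : G.ActionAt j := ⟨b, h, hn, rfl, ha⟩
      have hl : G.lastSeq i (b :: h) hm = some ⟨j, c⟩ := by simp [lastSeq, hp, j, c]
      have hpar : G.lastSeq i h (G.closed b h hm) = (G.forest hG i).par j :=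
        G.lastSeq_eq_of_ownHistory_eq _ _
          (hG i h (G.rep j) hn (G.rep_spec j).1 (G.rep_spec j).2.symm)
      rw [hpar] at ih
      rw [hl]
      simp only [ownHistory, hp, if_true, List.mem_cons, ← ih]
      constructor
      · intro hs
        rcases Relation.ReflTransGen.cases_tail hs with hs | ⟨u, hu, k, d, hk, rfl⟩
        · cases hs
          exact Or.inl rfl
        · cases hk
          exact Or.inr hu
      · rintro (hs | hs)
        · obtain ⟨⟨I, hI⟩, ⟨a, ha'⟩⟩ := s
          obtain ⟨h1, h2⟩ := (Prod.mk.injEq _ _ _ _).mp hs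
          simp only at h1 h2
          subst h1 h2
          exact Relation.ReflTransGen.refl
        · exact Relation.ReflTransGen.tail hs ⟨j, c, rfl, rfl⟩
    · simpa [lastSeq, ownHistory, hp] using forest_seqLE_lastSeq_iff hG i s h (G.closed b h hm)

theorem mem_ownHistory_iff (i : Fin n) (p : G.Info × G.Act) : ∀ (h : List G.Act),
    p ∈ G.ownHistory i h ↔ ∃ g, G.player g = some i ∧ G.info g = p.1 ∧ (p.2 :: g) <:+ h
  | [] => by simp [ownHistory]
  | b :: h => by
    have ih := mem_ownHistory_iff i p h
    simp only [List.suffix_cons_iff, List.cons.injEq]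
    by_cases hp : G.player h = some i
    · simp only [ownHistory, hp, if_true, List.mem_cons, ih]
      constructor
      · rintro (rfl | ⟨g, h1, h2, h3⟩)
        · exact ⟨h, hp, rfl, Or.inl ⟨rfl, rfl⟩⟩
        · exact ⟨g, h1, h2, Or.inr h3⟩
      · rintro ⟨g, h1, h2, ⟨h3, rfl⟩ | h3⟩
        · exact Or.inl (Prod.ext h2.symm h3)
        · exact Or.inr ⟨g, h1, h2, h3⟩
    · simp only [ownHistory, hp, if_false, ih]
      constructor
      · rintro ⟨g, h1, h2, h3⟩
        exact ⟨g, h1, h2, Or.inr h3⟩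
      · rintro ⟨g, h1, h2, ⟨h3, rfl⟩ | h3⟩
        · exact absurd h1 hp
        · exact ⟨g, h1, h2, h3⟩

/-- `j ≺ j'` in the forest iff the path to some node of `j'` passes through an earlier node of
`j`. -/
theorem forest_infoLT_iff (hG : G.PerfectRecall) (i : Fin n) (j j' : G.InfoSet i) :
    (G.forest hG i).InfoLT j j' ↔ ∃ h h', G.IsNodeOf i h ∧ G.info h = j.1 ∧
      G.IsNodeOf i h' ∧ G.info h' = j'.1 ∧ h <:+ h' ∧ h ≠ h' := by
  constructor
  · rintro ⟨a, ha⟩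
    obtain ⟨g, h1, h2, h3⟩ := (G.mem_ownHistory_iff i _ _).1
      ((G.forest_seqLE_lastSeq_iff hG i ⟨j, a⟩ _ (G.rep_spec j').1.1).1 ha)
    have hm := G.suffix_cons_mem_nodes (G.rep_spec j').1.1 h3
    refine ⟨g, G.rep j', ⟨G.closed _ _ hm, ⟨_, (G.mem_acts g (G.closed _ _ hm) _).2 hm⟩, h1⟩, h2,
      (G.rep_spec j').1, (G.rep_spec j').2, (List.suffix_cons _ _).trans h3, ?_⟩
    rintro rfl
    simpa using h3.length_le
  · rintro ⟨h, h', h1, h2, h3, h4, ⟨l, rfl⟩, h6⟩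
    have hl : l ≠ [] := by
      rintro rfl
      exact h6 rfl
    obtain ⟨l, a, rfl⟩ := (List.eq_nil_or_concat l).resolve_left hl
    have hs : (a :: h) <:+ (l.concat a ++ h) := ⟨l, by simp⟩
    have hm := G.suffix_cons_mem_nodes h3.1 hs
    have ha : a ∈ G.acts h := (G.mem_acts h h1.1 a).2 hm
    refine ⟨⟨a, h, h1, h2, ha⟩,
      (G.forest_seqLE_lastSeq_iff hG i ⟨j, ⟨a, h, h1, h2, ha⟩⟩ _ (G.rep_spec j').1.1).2 ?_⟩
    rw [hG i (G.rep j') _ (G.rep_spec j').1 h3 ((G.rep_spec j').2.trans h4.symm)]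
    exact (G.mem_ownHistory_iff i _ _).2 ⟨h, h1.2.2, h2, hs⟩

end ExtensiveGame

/-! ## Online algorithms and phi-regret -/

/-- The cumulative phi-regret `max_{φ ∈ Φ} ∑_{t < T} (ℓ t (φ (x t)) - ℓ t (x t))`, as a supremum. -/
def phiRegret {E : Type*} [AddCommGroup E] [Module ℝ E] (Φ : Set (E →ₗ[ℝ] E))
    (ℓ : ℕ → E →ₗ[ℝ] ℝ) (x : ℕ → E) (T : ℕ) : ℝ :=
  sSup ((fun φ => ∑ t ∈ Finset.range T, (ℓ t (φ (x t)) - ℓ t (x t))) '' Φ)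

/-- The decision maker that plays `x ℓ t` at time `t` against the utilities `ℓ 0, ℓ 1, …` is a
phi-regret minimizer relative to `Φ` for the set `X`: the functions in `Φ` map `X` to itself, it is
online, it outputs elements of `X`, and its phi-regret is sublinear (with the maximum attained)
against utilities of bounded range. -/
structure IsPhiRegretMinimizer {E : Type*} [AddCommGroup E] [Module ℝ E] (X : Set E)
    (Φ : Set (E →ₗ[ℝ] E)) (x : (ℕ → E →ₗ[ℝ] ℝ) → ℕ → E) : Prop where
  mapsTo : ∀ φ ∈ Φ, Set.MapsTo φ X X
  online : ∀ ℓ ℓ' t, (∀ s < t, ℓ s = ℓ' s) → x ℓ t = x ℓ' t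
  mem : ∀ ℓ t, x ℓ t ∈ X
  attained : ∀ ℓ T, IsGreatest
    ((fun φ => ∑ t ∈ Finset.range T, (ℓ t (φ (x ℓ t)) - ℓ t (x ℓ t))) '' Φ) (phiRegret Φ ℓ (x ℓ) T)
  sublinear : ∀ ℓ, (∃ D : ℝ, ∀ t, ∀ q ∈ X, ∀ q' ∈ X, ℓ t q - ℓ t q' ≤ D) →
    ∀ ε > 0, ∀ᶠ T : ℕ in atTop, phiRegret Φ ℓ (x ℓ) T ≤ ε * T

/-! ## The machine model

A real random access machine with unit cost. `Tick α` is a computation of a result of type `α`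
together with the number of steps that it takes. Programs below handle real numbers only through
words and arrays, whose contents they access only through the charged primitives `Word.…`, `Arr.…`;
control flow that depends on data goes through charged tests, each loop iteration is charged, and
the index lists over which loops run depend only on the game (they are the pointer structure of its
tree of sequences, laid out in advance). No program uses the old contents of an array after a write
to it, so that a write is an update in place. -/

structure Tick (α : Type) where
  val : α
  cost : ℕ

instance : Monad Tick where
  pure a := ⟨a, 0⟩
  bind x f := ⟨(f x.val).val, x.cost + (f x.val).cost⟩

/-- A memory word, holding a real number. -/
structure Word where
  val : ℝ

namespace Word

def ofNat (k : ℕ) : Tick Word := ⟨⟨k⟩, 1⟩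

def add (x y : Word) : Tick Word := ⟨⟨x.val + y.val⟩, 1⟩

def sub (x y : Word) : Tick Word := ⟨⟨x.val - y.val⟩, 1⟩

def mul (x y : Word) : Tick Word := ⟨⟨x.val * y.val⟩, 1⟩

def div (x y : Word) : Tick Word := ⟨⟨x.val / y.val⟩, 1⟩

/-- The positive part `max x 0`. -/
def pos (x : Word) : Tick Word := ⟨⟨max x.val 0⟩, 1⟩

open Classical in
/-- The test `0 < x`. -/
def isPos (x : Word) : Tick Bool := ⟨decide (0 < x.val), 1⟩

open Classical in
/-- The test `x = 0`. -/
def isZero (x : Word) : Tick Bool := ⟨decide (x.val = 0), 1⟩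

end Word

/-- A charged comparison of two static indices. -/
def sameIndex {ι : Type} [DecidableEq ι] (i j : ι) : Tick Bool := ⟨decide (i = j), 1⟩

/-- An array whose cell `i` holds an object of type `β i` (a word, or a pointer to an object). -/
structure Arr {ι : Type} (β : ι → Type) where
  get : ∀ i, β i

/-- A vector of words. -/
abbrev Vec (ι : Type) : Type := Arr (fun _ : ι => Word)

/-- The vector of words with the given entries (not an operation of the machine). -/
def Vec.ofFn {ι : Type} (x : ι → ℝ) : Vec ι := ⟨fun i => ⟨x i⟩⟩

/-- The real entries of a vector of words (not an operation of the machine). -/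
def Vec.toFn {ι : Type} (x : Vec ι) : ι → ℝ := fun i => (x.get i).val

namespace Arr

variable {ι : Type} {β : ι → Type}

def read (x : Arr β) (i : ι) : Tick (β i) := ⟨x.get i, 1⟩

def write [DecidableEq ι] (x : Arr β) (i : ι) (v : β i) : Tick (Arr β) :=
  ⟨⟨Function.update x.get i v⟩, 1⟩

end Arr

/-- Allocation of a vector of zeros. -/
def Vec.zeros (ι : Type) [Fintype ι] : Tick (Vec ι) := ⟨Vec.ofFn fun _ => 0, Fintype.card ι + 1⟩

/-- The loop `for i in l do acc := f i acc`. -/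
def forEach {ι β : Type} : List ι → β → (ι → β → Tick β) → Tick β
  | [], acc, _ => ⟨acc, 1⟩
  | i :: l, acc, f => do
    let acc' ← (⟨acc, 1⟩ : Tick β)
    let acc'' ← f i acc'
    forEach l acc'' f

/-- The sum of the values `f i` for `i` in a list. -/
def sumOver {ι : Type} (l : List ι) (f : ι → Tick Word) : Tick Word := do
  let z ← Word.ofNat 0
  forEach l z fun i acc => do
    let v ← f i
    Word.add acc v

/-- A new vector with the value `f i` at each `i` in a list, and zeros elsewhere. -/
def tabulate {ι : Type} [Fintype ι] [DecidableEq ι] (l : List ι) (f : ι → Tick Word) :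
    Tick (Vec ι) := do
  let z ← Vec.zeros ι
  forEach l z fun i acc => do
    let v ← f i
    acc.write i v

/-- The list of all the elements of a finite type. -/
def elems (ι : Type) [Fintype ι] : List ι := Finset.univ.toList

open Classical in
/-- The list of the elements of a finite type with a given property. -/
def elemsWith {ι : Type} [Fintype ι] (p : ι → Prop) : List ι := (Finset.univ.filter p).toList

/-- A square matrix is (column) stochastic: its entries are nonnegative and its columns sum to 1. -/
def IsColStochastic {ι : Type} [Fintype ι] (M : Matrix ι ι ℝ) : Prop :=
  (∀ r c, 0 ≤ M r c) ∧ ∀ c, ∑ r, M r c = 1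

/-- An oracle that computes a fixed point in the simplex of any (nonempty) stochastic matrix,
together with the number of steps that it takes. -/
structure FixedPointOracle where
  solve : ∀ (ι : Type) [Fintype ι], Matrix ι ι ℝ → ι → ℝ
  time : ∀ (ι : Type) [Fintype ι], Matrix ι ι ℝ → ℕ
  mem_simplex : ∀ (ι : Type) [Fintype ι] [Nonempty ι] (M : Matrix ι ι ℝ), IsColStochastic M →
    solve ι M ∈ stdSimplex ℝ ι
  fixed : ∀ (ι : Type) [Fintype ι] [Nonempty ι] (M : Matrix ι ι ℝ), IsColStochastic M →
    M.mulVec (solve ι M) = solve ι M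

/-- On stochastic matrices of order `m ≥ 1` the oracle takes at most `K * FP m` steps. -/
def FixedPointOracle.RunsIn (O : FixedPointOracle) (K : ℝ≥0) (FP : ℕ → ℝ≥0) : Prop :=
  ∀ (ι : Type) [Fintype ι] [Nonempty ι] (M : Matrix ι ι ℝ), IsColStochastic M →
    (O.time ι M : ℝ≥0) ≤ K * FP (Fintype.card ι)

/-- A call of the oracle by a program. -/
def FixedPointOracle.call (O : FixedPointOracle) (ι : Type) [Fintype ι] (M : Vec (ι × ι)) :
    Tick (Vec ι) :=
  ⟨Vec.ofFn (O.solve ι fun r c => M.toFn (r, c)), O.time ι (fun r c => M.toFn (r, c)) + 1⟩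

/-- A decision maker with the operations `next` (NextElement) and `observe` (ObserveUtility), both
acting on an internal state. -/
structure OnlineAlg (In Out : Type) where
  State : Type
  start : State
  next : State → Tick (Out × State)
  observe : State → In → Tick State

namespace OnlineAlg

variable {In Out : Type} (R : OnlineAlg In Out)

/-- The state before the call of `next` at time `t = 0, 1, …`, when the inputs are `u 0, u 1, …`. -/
def stateAt (u : ℕ → In) : ℕ → R.State
  | 0 => R.start
  | t + 1 => (R.observe (R.next (stateAt u t)).val.2 (u t)).val

/-- The output of `next` at time `t`. -/
def output (u : ℕ → In) (t : ℕ) : Out := (R.next (R.stateAt u t)).val.1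

/-- The number of steps of `next` at time `t`. -/
def nextTime (u : ℕ → In) (t : ℕ) : ℕ := (R.next (R.stateAt u t)).cost

/-- The number of steps of `observe` at time `t`. -/
def observeTime (u : ℕ → In) (t : ℕ) : ℕ :=
  (R.observe (R.next (R.stateAt u t)).val.2 (u t)).cost

end OnlineAlg

/-! ## The algorithms -/

/-- Regret matching on the simplex. The state consists of the cumulative regrets of the elements
and of the last output. The next output is proportional to the positive parts of the regrets (it is
uniform if they all vanish). -/
def regretMatching (ι : Type) [Fintype ι] [DecidableEq ι] : OnlineAlg (Vec ι) (Vec ι) where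
  State := Vec ι × Vec ι
  start := (Vec.ofFn fun _ => 0, Vec.ofFn fun _ => 0)
  next s := do
    let total ← sumOver (elems ι) fun a => do
      let r ← s.1.read a
      r.pos
    let positive ← total.isPos
    let x ← if positive then
        tabulate (elems ι) fun a => do
          let r ← s.1.read a
          let p ← r.pos
          p.div total
      else do
        let one ← Word.ofNat 1
        let m ← Word.ofNat (Fintype.card ι)
        let u ← one.div m
        tabulate (elems ι) fun _ => pure u
    pure (x, (s.1, x))
  observe s u := do
    let v ← sumOver (elems ι) fun a => do
      let ua ← u.read a
      let xa ← s.2.read a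
      ua.mul xa
    let reg ← tabulate (elems ι) fun a => do
      let r ← s.1.read a
      let ua ← u.read a
      let d ← ua.sub v
      r.add d
    pure (reg, s.2)

namespace InfoForest

variable (F : InfoForest)

open Classical in
/-- The information sets `j' ⪰ j` in top-down order. -/
def TopDownOrder.subtree {F : InfoForest} (ord : F.TopDownOrder) (j : F.J) : List F.J :=
  ord.list.filter fun j' => F.InfoLE j j'

/-- The sequences that terminate at `j` or at one of its descendants, as a list. -/
def seqsFrom (j : F.J) : List F.SeqStar := elemsWith fun s => F.InfoLE j s.1

/-- The mass that flows into `k ⪰ j` under a partially computed strategy for the subtree of `j`. -/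
def inflow (j k : F.J) (q : Vec F.SeqStar) : Tick Word := do
  let top ← sameIndex j k
  if top then Word.ofNat 1
  else match F.par k with
    | none => Word.ofNat 1
    | some s => q.read s

variable {F}

/-- The counterfactual regret minimization algorithm (CFR) for the strategies of the subtree rooted
at `j`. It runs regret matching at each `k ⪰ j`. The state consists of the states of these local
algorithms and of their last outputs. The strategy is stored in a vector indexed by all nonempty
sequences, of which only the entries for the sequences `⪰ j` matter. -/
def cfr (ord : F.TopDownOrder) (j : F.J) : OnlineAlg (Vec F.SeqStar) (Vec F.SeqStar) where
  State := Arr (fun k : F.J => (regretMatching (F.A k)).State) × Arr (fun k : F.J => Vec (F.A k))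
  start := (⟨fun k => (regretMatching (F.A k)).start⟩, ⟨fun _ => Vec.ofFn fun _ => 0⟩)
  next s := do
    let q0 ← Vec.zeros F.SeqStar
    let res ← forEach (ord.subtree j) (s, q0) fun k acc => do
      let st ← acc.1.1.read k
      let o ← (regretMatching (F.A k)).next st
      let sts ← acc.1.1.write k o.2
      let bs ← acc.1.2.write k o.1
      let mass ← F.inflow j k acc.2
      let q ← forEach (elems (F.A k)) acc.2 fun a q => do
        let b ← o.1.read a
        let m ← mass.mul b
        q.write ⟨k, a⟩ m
      pure ((sts, bs), q)
    pure (res.2, res.1)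
  observe s g := do
    let v0 ← Vec.zeros F.J
    let res ← forEach (ord.subtree j).reverse (s.1, v0) fun k acc => do
      let b ← s.2.read k
      let u ← tabulate (elems (F.A k)) fun a => do
        let w ← g.read ⟨k, a⟩
        let c ← sumOver (elemsWith fun k' => F.par k' = some ⟨k, a⟩) fun k' => acc.2.read k'
        w.add c
      let value ← sumOver (elems (F.A k)) fun a => do
        let ba ← b.read a
        let ua ← u.read a
        ba.mul ua
      let v ← acc.2.write k value
      let st ← acc.1.read k
      let st' ← (regretMatching (F.A k)).observe st u
      let sts ← acc.1.write k st'
      pure (sts, v)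
    pure (res.1, s.2)

/-- The regret minimizer for the deviations with trigger `s`, obtained from a regret minimizer `R`
for the strategies of the subtree. A deviation is stored as its continuation strategy, a linear
functional `L` of deviations as its canonical matrix `Λ`; the utility passed to `R` is
`x ↦ L (φ_{s → x}) - L (φ_{s → 0})`. -/
def triggerAlg (s : F.SeqStar) (R : OnlineAlg (Vec F.SeqStar) (Vec F.SeqStar)) :
    OnlineAlg (Vec (F.Seq × F.Seq)) (Vec F.SeqStar) where
  State := R.State
  start := R.start
  next := R.next
  observe st Λ := do
    let g ← tabulate (F.seqsFrom s.1) fun r => Λ.read (some r, some s)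
    R.observe st g

/-- The value `L (φ_{s → q})` of a linear functional with canonical matrix `Λ`. -/
def evalDeviation (Λ : Vec (F.Seq × F.Seq)) (s : F.SeqStar) (q : Vec F.SeqStar) : Tick Word := do
  let d ← sumOver (elemsWith fun c : F.Seq => ¬ F.SeqLE (some s) c) fun c => Λ.read (c, c)
  let e ← sumOver (F.seqsFrom s.1) fun r => do
    let l ← Λ.read (some r, some s)
    let y ← q.read r
    l.mul y
  d.add e

variable (F)

/-- The implicit representation `{(λ_s, q_s)}` of the deviation `∑ s, λ_s φ_{s → q_s}`. -/
abbrev MixedDeviation : Type := Vec F.SeqStar × Arr (fun _ : F.SeqStar => Vec F.SeqStar)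

variable {F}

/-- The linear map represented by `{(λ_s, q_s)}`. -/
def MixedDeviation.toMap (φ : F.MixedDeviation) : (F.Seq → ℝ) →ₗ[ℝ] (F.Seq → ℝ) :=
  ∑ s : F.SeqStar, φ.1.toFn s • F.devMap s fun r =>
    match r.1 with
    | none => 0
    | some r' => (φ.2.get s).toFn r'

/-- The regret minimizer for the convex hull of all trigger deviation functions, obtained from a
regret minimizer `RΔ` for the simplex and one, `R s`, for each trigger `s`. The state consists of
the states of these, and of the last output. -/
def hullAlg (RΔ : OnlineAlg (Vec F.SeqStar) (Vec F.SeqStar))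
    (R : F.SeqStar → OnlineAlg (Vec (F.Seq × F.Seq)) (Vec F.SeqStar)) :
    OnlineAlg (Vec (F.Seq × F.Seq)) F.MixedDeviation where
  State := (RΔ.State × Arr (fun s : F.SeqStar => (R s).State)) ×
    Arr (fun _ : F.SeqStar => Vec F.SeqStar)
  start := ((RΔ.start, ⟨fun s => (R s).start⟩), ⟨fun _ => Vec.ofFn fun _ => 0⟩)
  next st := do
    let o ← RΔ.next st.1.1
    let res ← forEach (elems F.SeqStar) (st.1.2, st.2) fun s acc => do
      let sub ← acc.1.read s
      let p ← (R s).next sub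
      let subs ← acc.1.write s p.2
      let qs ← acc.2.write s p.1
      pure (subs, qs)
    pure ((o.1, res.2), ((o.2, res.1), res.2))
  observe st Λ := do
    let subs ← forEach (elems F.SeqStar) st.1.2 fun s acc => do
      let sub ← acc.read s
      let sub' ← (R s).observe sub Λ
      acc.write s sub'
    let u ← tabulate (elems F.SeqStar) fun s => do
      let q ← st.2.read s
      evalDeviation Λ s q
    let top ← RΔ.observe st.1.1 u
    pure ((top, subs), st.2)

/-- Promotes a partial fixed point `x` of the deviation `φ = {(λ_s, q_s)}` on a trunk of
information sets to one that is also defined at `k`. -/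
def extend (O : FixedPointOracle) (φ : F.MixedDeviation) (k : F.J) (x : Vec F.Seq) :
    Tick (Vec F.Seq) := do
  let xp ← x.read (F.par k)
  let r ← tabulate (elems (F.A k)) fun a =>
    sumOver (elemsWith fun s : F.SeqStar => F.SeqGE (F.par k) s.1) fun s => do
      let l ← φ.1.read s
      let q ← φ.2.read s
      let y ← q.read ⟨k, a⟩
      let z ← x.read (some s)
      let ly ← l.mul y
      ly.mul z
  let d ← tabulate (elems (F.A k)) fun a => do
    let one ← Word.ofNat 1
    let m ← sumOver (elemsWith fun s : F.SeqStar => F.SeqLE (some s) (some ⟨k, a⟩)) fun s =>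
      φ.1.read s
    one.sub m
  let W ← tabulate (elems (F.A k × F.A k)) fun p => do
    let l ← φ.1.read ⟨k, p.2⟩
    let q ← φ.2.read ⟨k, p.2⟩
    let y ← q.read ⟨k, p.1⟩
    let ly ← l.mul y
    let diagonal ← sameIndex p.1 p.2
    let e ← if diagonal then do
        let da ← d.read p.2
        ly.add da
      else pure ly
    let ex ← e.mul xp
    let ra ← r.read p.1
    ra.add ex
  let unreached ← xp.isZero
  let w ← if unreached then Vec.zeros (F.A k)
    else do
      let P ← tabulate (elems (F.A k × F.A k)) fun p => do
        let c ← W.read p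
        c.div xp
      let b ← O.call (F.A k) P
      tabulate (elems (F.A k)) fun a => do
        let ba ← b.read a
        xp.mul ba
  forEach (elems (F.A k)) x fun a x' => do
    let wa ← w.read a
    x'.write (some ⟨k, a⟩) wa

/-- A fixed point of a deviation, computed from the top down. -/
def fixedPoint (O : FixedPointOracle) (ord : F.TopDownOrder) (φ : F.MixedDeviation) :
    Tick (Vec F.Seq) := do
  let z ← Vec.zeros F.Seq
  let one ← Word.ofNat 1
  let x0 ← z.write none one
  forEach ord.list x0 fun k x => extend O φ k x

/-- The construction of Gordon et al.: a phi-regret minimizer from a regret minimizer `R` for the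
convex hull of the trigger deviation functions. The state consists of the state of `R` and of the
last output. Utilities `ℓ` are stored as their canonical vectors, and `R` is passed the canonical
matrix of the functional `φ ↦ ℓ (φ q)`, where `q` is the last output. -/
def gordonAlg (O : FixedPointOracle) (ord : F.TopDownOrder)
    (R : OnlineAlg (Vec (F.Seq × F.Seq)) F.MixedDeviation) :
    OnlineAlg (Vec F.Seq) (Vec F.Seq) where
  State := R.State × Vec F.Seq
  start := (R.start, Vec.ofFn fun _ => 0)
  next st := do
    let o ← R.next st.1
    let q ← fixedPoint O ord o.1
    pure (q, (o.2, q))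
  observe st l := do
    let Λ ← tabulate (elems (F.Seq × F.Seq)) fun p => do
      let a ← l.read p.1
      let b ← st.2.read p.2
      a.mul b
    let st' ← R.observe st.1 Λ
    pure (st', st.2)

/-- The regret minimizer for the convex hull of the trigger deviation functions that uses regret
matching for the simplex and CFR for the continuation strategies. -/
def deviationAlg (ord : F.TopDownOrder) : OnlineAlg (Vec (F.Seq × F.Seq)) F.MixedDeviation :=
  hullAlg (regretMatching F.SeqStar) fun s => triggerAlg s (cfr ord s.1)

/-- The complete algorithm for the set of mixed sequence-form strategies. -/
def mixedAlg (O : FixedPointOracle) (ord : F.TopDownOrder) : OnlineAlg (Vec F.Seq) (Vec F.Seq) :=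
  gordonAlg O ord (deviationAlg ord)

/-- The canonical representation of a sequence of linear utility functions. -/
def canonical (ℓ : ℕ → (F.Seq → ℝ) →ₗ[ℝ] ℝ) (t : ℕ) : Vec F.Seq :=
  Vec.ofFn fun s => ℓ t (Pi.single s 1)

/-- The strategy `q^t` output at time `t` by the complete algorithm. -/
def strategyAt (O : FixedPointOracle) (ord : F.TopDownOrder) (ℓ : ℕ → (F.Seq → ℝ) →ₗ[ℝ] ℝ)
    (t : ℕ) : F.Seq → ℝ :=
  ((mixedAlg O ord).output (canonical ℓ) t).toFn

/-- The deviation `φ^t` of which the complete algorithm computes a fixed point at time `t`. -/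
def deviationAt (O : FixedPointOracle) (ord : F.TopDownOrder) (ℓ : ℕ → (F.Seq → ℝ) →ₗ[ℝ] ℝ)
    (t : ℕ) : (F.Seq → ℝ) →ₗ[ℝ] (F.Seq → ℝ) :=
  MixedDeviation.toMap
    ((deviationAlg ord).next ((mixedAlg O ord).stateAt (canonical ℓ) t).1).val.1

end InfoForest

end

/-! Since `φ^t (q^t) = q^t`, the phi-regret against `φ` is the sum of `L^t(φ) - L^t(φ^t)` with
`L^t(φ) = ℓ^t(φ(q^t))`. This is the ordinary regret of the decision maker that plays `φ^t` in `co Φ`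
against linear utilities. It is affine in `φ`, so only the finitely many trigger deviations have to
be bounded. For the trigger `s` and continuation `z` it splits into two parts. One is the regret of
the CFR copy of `s` (`sum_subValue_sub_le`), because `L(φ_{s → z})` is a constant plus a linear
function of `z` (`sum_mul_devMap`). The other is the regret of the simplex player against `s`. All
deviations involved map `Q` to `Q` (`devMap_mem_polytope`), so both players face utilities of range
at most `D`, and with `N = |Σ_*|` the sum is at most `D N √T + D √N √T`.

Regret matching is controlled by the sum of the squared positive regrets. Its cross term vanishes
(`sum_pos_mul_sub_regretMatchingStrategy`), so it grows by at most `|A| D²` per round. CFR reduces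
to this by the decomposition of a difference of values into counterfactual regrets
(`sum_mul_cfUtility_sub`). The local utilities inherit the range `D` because two counterfactual
utilities at `k` differ by the values of two strategies that steer to `k` (`cfUtility_sub_le`).

CFR outputs sequence forms of behavioral strategies, which are mixtures of pure ones by Kuhn's
theorem (`realization_eq_sum`); hence `φ^t` lies in `co Φ`. Its fixed point can be computed from the
top down, because `φ^t(x)` at an information set `k` depends only on `x` at `k` and above
(`MixedDeviation.toMap_congr`). The equation at `k` is a fixed point equation for `W`, whose columns
have the sum `x[σ_p]` precisely because the equation already holds at the parent
(`MixedDeviation.isColStochastic_extensionMatrix`).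

For the running time, each of the `N` copies of CFR is linear in `N`. The extension at `k` costs
`O(|A(k)| |Σ|)` and one oracle call, and the `|A(k)|` add up to `N`. Numerical constants are
generous throughout. -/

noncomputable section

/-! ## Values and costs of programs -/

namespace Tick

variable {α β : Type}

@[simp] theorem val_pure (a : α) : (pure a : Tick α).val = a := rfl
@[simp] theorem cost_pure (a : α) : (pure a : Tick α).cost = 0 := rfl
@[simp] theorem val_bind (x : Tick α) (f : α → Tick β) : (x >>= f).val = (f x.val).val := rfl
@[simp] theorem cost_bind (x : Tick α) (f : α → Tick β) :
    (x >>= f).cost = x.cost + (f x.val).cost := rfl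

end Tick

namespace Word

@[simp] theorem val_ofNat (k : ℕ) : (ofNat k).val.val = k := rfl
@[simp] theorem cost_ofNat (k : ℕ) : (ofNat k).cost = 1 := rfl
@[simp] theorem val_add (x y : Word) : (x.add y).val.val = x.val + y.val := rfl
@[simp] theorem cost_add (x y : Word) : (x.add y).cost = 1 := rfl
@[simp] theorem val_sub (x y : Word) : (x.sub y).val.val = x.val - y.val := rfl
@[simp] theorem cost_sub (x y : Word) : (x.sub y).cost = 1 := rfl
@[simp] theorem val_mul (x y : Word) : (x.mul y).val.val = x.val * y.val := rfl
@[simp] theorem cost_mul (x y : Word) : (x.mul y).cost = 1 := rfl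
@[simp] theorem val_div (x y : Word) : (x.div y).val.val = x.val / y.val := rfl
@[simp] theorem cost_div (x y : Word) : (x.div y).cost = 1 := rfl
@[simp] theorem val_pos (x : Word) : x.pos.val.val = max x.val 0 := rfl
@[simp] theorem cost_pos (x : Word) : x.pos.cost = 1 := rfl
@[simp] theorem val_isPos (x : Word) : x.isPos.val = true ↔ 0 < x.val := by simp [isPos]
@[simp] theorem cost_isPos (x : Word) : x.isPos.cost = 1 := rfl
@[simp] theorem val_isZero (x : Word) : x.isZero.val = true ↔ x.val = 0 := by simp [isZero]
@[simp] theorem cost_isZero (x : Word) : x.isZero.cost = 1 := rfl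

end Word

@[simp] theorem val_sameIndex {ι : Type} [DecidableEq ι] (i j : ι) :
    (sameIndex i j).val = true ↔ i = j := by simp [sameIndex]
@[simp] theorem cost_sameIndex {ι : Type} [DecidableEq ι] (i j : ι) :
    (sameIndex i j).cost = 1 := rfl

namespace Arr

variable {ι : Type} {β : ι → Type}

@[simp] theorem val_read (x : Arr β) (i : ι) : (x.read i).val = x.get i := rfl
@[simp] theorem cost_read (x : Arr β) (i : ι) : (x.read i).cost = 1 := rfl
@[simp] theorem get_write [DecidableEq ι] (x : Arr β) (i : ι) (v : β i) :
    (x.write i v).val.get = Function.update x.get i v := rfl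
@[simp] theorem cost_write [DecidableEq ι] (x : Arr β) (i : ι) (v : β i) :
    (x.write i v).cost = 1 := rfl

end Arr

namespace Vec

variable {ι : Type}

@[simp] theorem toFn_ofFn (x : ι → ℝ) : (Vec.ofFn x).toFn = x := rfl

theorem val_get (x : Vec ι) (i : ι) : (x.get i).val = x.toFn i := rfl

@[simp] theorem toFn_write [DecidableEq ι] (x : Vec ι) (i : ι) (v : Word) :
    Vec.toFn (Arr.write x i v).val = Function.update x.toFn i v.val := by
  ext k
  by_cases h : k = i
  · subst h; simp [Vec.toFn]
  · simp [Vec.toFn, h]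

@[simp] theorem toFn_zeros [Fintype ι] : (Vec.zeros ι).val.toFn = 0 := rfl
@[simp] theorem cost_zeros [Fintype ι] : (Vec.zeros ι).cost = Fintype.card ι + 1 := rfl

end Vec

/-- Partial correctness and running time of a loop: an invariant `P` that refers to the list of the
indices already visited, and bounds `c` for the time of each iteration. -/
theorem forEach_spec {ι β : Type} (P : List ι → β → Prop) {f : ι → β → Tick β} (c : ι → ℕ)
    {l : List ι} {x : β} (h0 : P [] x)
    (hstep : ∀ l₁ k l₂ y, l = l₁ ++ k :: l₂ → P l₁ y →
      P (l₁ ++ [k]) (f k y).val ∧ (f k y).cost ≤ c k) :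
    P l (forEach l x f).val ∧ (forEach l x f).cost ≤ (l.map fun k => c k + 1).sum + 1 := by
  -- The induction runs over the remaining suffix for every visited prefix, since the invariant
  -- speaks of the prefix.
  have key : ∀ (l' l₀ : List ι) (x : β), l = l₀ ++ l' → P l₀ x →
      P l (forEach l' x f).val ∧ (forEach l' x f).cost ≤ (l'.map fun k => c k + 1).sum + 1 := by
    intro l'
    induction l' with
    | nil =>
      intro l₀ x hl hx
      rw [List.append_nil] at hl
      subst hl
      exact ⟨hx, le_rfl⟩
    | cons k l' ih =>
      intro l₀ x hl hx
      obtain ⟨h1, h2⟩ := hstep l₀ k l' x hl hx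
      obtain ⟨h3, h4⟩ := ih (l₀ ++ [k]) (f k x).val (by simpa using hl) h1
      refine ⟨h3, ?_⟩
      change 1 + ((f k x).cost + (forEach l' (f k x).val f).cost) ≤ _
      simp only [List.map_cons, List.sum_cons]
      omega
  exact key l [] x rfl h0

/-- For loops whose running time is bounded separately or not needed. -/
theorem forEach_val {ι β : Type} (P : List ι → β → Prop) {f : ι → β → Tick β}
    {l : List ι} {x : β} (h0 : P [] x)
    (hstep : ∀ l₁ k l₂ y, l = l₁ ++ k :: l₂ → P l₁ y → P (l₁ ++ [k]) (f k y).val) :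
    P l (forEach l x f).val := by
  have key : ∀ (l' l₀ : List ι) (x : β), l = l₀ ++ l' → P l₀ x → P l (forEach l' x f).val := by
    intro l'
    induction l' with
    | nil =>
      intro l₀ x hl hx
      rw [List.append_nil] at hl
      exact hl ▸ hx
    | cons k l' ih =>
      intro l₀ x hl hx
      exact ih (l₀ ++ [k]) (f k x).val (by simpa using hl) (hstep l₀ k l' x hl hx)
  exact key l [] x rfl h0

theorem forEach_cost {ι β : Type} {f : ι → β → Tick β} (c : ι → ℕ) {l : List ι} (x : β)
    (h : ∀ k y, (f k y).cost ≤ c k) :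
    (forEach l x f).cost ≤ (l.map fun k => c k + 1).sum + 1 :=
  (forEach_spec (fun _ _ => True) c trivial fun _ k _ y _ _ => ⟨trivial, h k y⟩).2

theorem sumOver_val {ι : Type} (l : List ι) (f : ι → Tick Word) :
    (sumOver l f).val.val = (l.map fun i => (f i).val.val).sum := by
  refine forEach_val (fun l' (y : Word) => y.val = (l'.map fun i => (f i).val.val).sum) ?_ ?_
  · simp
  · intro l₁ k l₂ y _ hy
    simp [hy]

/-- Each iteration pays for its summand, one addition and the loop charge; the final `2` is the
initial zero and the exit of the loop. -/
theorem sumOver_cost {ι : Type} {f : ι → Tick Word} (c : ℕ) (l : List ι)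
    (h : ∀ i, (f i).cost ≤ c) : (sumOver l f).cost ≤ (c + 2) * l.length + 2 := by
  have := forEach_cost (f := fun i (acc : Word) => (do let v ← f i; Word.add acc v : Tick Word))
    (fun _ => c + 1) (l := l) (Word.ofNat 0).val fun k y => by simpa using h k
  change 1 + (forEach _ _ _).cost ≤ _
  simp only [List.map_const', List.sum_replicate, smul_eq_mul] at this
  refine (Nat.add_le_add_left this 1).trans (le_of_eq ?_)
  ring

theorem tabulate_val {ι : Type} [Fintype ι] [DecidableEq ι] (l : List ι) (f : ι → Tick Word)
    (i : ι) : (tabulate l f).val.toFn i = if i ∈ l then (f i).val.val else 0 := by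
  refine forEach_val (fun l' (y : Vec ι) => y.toFn i = if i ∈ l' then (f i).val.val else 0) ?_ ?_
  · simp
  · intro l₁ k l₂ y _ hy
    by_cases hk : i = k
    · subst hk; simp
    · simp [hy, hk]

/-- Allocation takes `card ι + 1` steps and the loop exit one; each entry pays for its value, a
write and the loop charge. The bound by a sum keeps track of entries of very different cost, as in
the backward pass of CFR. -/
theorem tabulate_cost_le_sum {ι : Type} [Fintype ι] [DecidableEq ι] {f : ι → Tick Word} (c : ι → ℕ)
    (l : List ι) (h : ∀ i, (f i).cost ≤ c i) :
    (tabulate l f).cost ≤ Fintype.card ι + (l.map fun i => c i + 2).sum + 2 := by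
  have := forEach_cost (f := fun i (acc : Vec ι) => (do let v ← f i; acc.write i v : Tick (Vec ι)))
    (fun i => c i + 1) (l := l) (Vec.zeros ι).val fun k y => by simpa using h k
  change (Fintype.card ι + 1) + (forEach _ _ _).cost ≤ _
  simp only [add_assoc, one_add_one_eq_two] at this ⊢
  omega

theorem tabulate_cost {ι : Type} [Fintype ι] [DecidableEq ι] {f : ι → Tick Word} (c : ℕ)
    (l : List ι) (h : ∀ i, (f i).cost ≤ c) :
    (tabulate l f).cost ≤ Fintype.card ι + (c + 2) * l.length + 2 := by
  have := tabulate_cost_le_sum (fun _ => c) l h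
  simp only [List.map_const', List.sum_replicate, smul_eq_mul] at this
  rwa [mul_comm] at this

/-! ### Enumerations of finite types -/

section elems

variable {ι : Type} [Fintype ι]

@[simp] theorem mem_elems (i : ι) : i ∈ elems ι := by simp [elems]

@[simp] theorem length_elems : (elems ι).length = Fintype.card ι := by simp [elems]

theorem nodup_elems : (elems ι).Nodup := Finset.nodup_toList _

theorem sum_map_elems {M : Type*} [AddCommMonoid M] (f : ι → M) :
    ((elems ι).map f).sum = ∑ i, f i := Finset.sum_map_toList _ _

@[simp] theorem mem_elemsWith (p : ι → Prop) (i : ι) : i ∈ elemsWith p ↔ p i := by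
  simp [elemsWith]

theorem length_elemsWith (p : ι → Prop) [DecidablePred p] :
    (elemsWith p).length = (Finset.univ.filter p).card := by
  rw [elemsWith, Finset.length_toList]
  congr!

theorem length_elemsWith_le (p : ι → Prop) : (elemsWith p).length ≤ Fintype.card ι := by
  classical
  rw [length_elemsWith]
  exact Finset.card_le_univ _

theorem sum_map_elemsWith {M : Type*} [AddCommMonoid M] (p : ι → Prop) [DecidablePred p]
    (f : ι → M) : ((elemsWith p).map f).sum = ∑ i, if p i then f i else 0 := by
  rw [← Finset.sum_filter, elemsWith, Finset.sum_map_toList]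
  congr!

/-- Bounds the cost of traversing a subtree by a sum over all information sets. -/
theorem sum_map_le_of_nodup {l : List ι} (hl : l.Nodup) (f : ι → ℕ) :
    (l.map f).sum ≤ ∑ i, f i := by
  classical
  rw [← List.sum_toFinset f hl]
  exact Finset.sum_le_sum_of_subset (Finset.subset_univ _)

end elems

/-! ## Regret matching -/

/-- The mixed strategy that regret matching derives from the vector `r` of regrets. -/
def regretMatchingStrategy {ι : Type} [Fintype ι] (r : ι → ℝ) (a : ι) : ℝ :=
  if 0 < ∑ b, max (r b) 0 then max (r a) 0 / ∑ b, max (r b) 0 else 1 / (Fintype.card ι : ℝ)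

section regretMatching

variable {ι : Type} [Fintype ι]

theorem regretMatchingStrategy_nonneg (r : ι → ℝ) (a : ι) : 0 ≤ regretMatchingStrategy r a := by
  unfold regretMatchingStrategy
  split_ifs with h
  · positivity
  · positivity

theorem sum_regretMatchingStrategy [Nonempty ι] (r : ι → ℝ) :
    ∑ a, regretMatchingStrategy r a = 1 := by
  unfold regretMatchingStrategy
  split_ifs with h
  · rw [← Finset.sum_div, div_self h.ne']
  · simp

/-- Blackwell's condition: the strategy is proportional to the positive regrets, so the
instantaneous regret vector is orthogonal to them. If no regret is positive, all weights are zero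
and the choice of strategy is irrelevant. -/
theorem sum_pos_mul_sub_regretMatchingStrategy (r u : ι → ℝ) :
    ∑ a, max (r a) 0 * (u a - ∑ b, u b * regretMatchingStrategy r b) = 0 := by
  by_cases h : 0 < ∑ b, max (r b) 0
  · have : ∑ b, u b * regretMatchingStrategy r b
        = (∑ b, max (r b) 0 * u b) / ∑ b, max (r b) 0 := by
      rw [Finset.sum_div]
      refine Finset.sum_congr rfl fun b _ => ?_
      rw [regretMatchingStrategy, if_pos h]
      ring
    simp_rw [mul_sub, Finset.sum_sub_distrib, ← Finset.sum_mul]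
    rw [this, mul_div_cancel₀ _ h.ne', sub_self]
  · have h0 : ∑ b, max (r b) 0 = 0 := le_antisymm (not_lt.1 h) (by positivity)
    rw [Finset.sum_eq_zero_iff_of_nonneg (fun _ _ => le_max_right _ _)] at h0
    exact Finset.sum_eq_zero fun a ha => by rw [h0 a ha, zero_mul]

/-- The regret bound of regret matching. -/
theorem regretMatching_regret_le [Nonempty ι] {ρ u : ℕ → ι → ℝ} (h0 : ∀ a, ρ 0 a = 0)
    (hs : ∀ t a, ρ (t + 1) a
      = ρ t a + (u t a - ∑ b, u t b * regretMatchingStrategy (ρ t) b)) {T : ℕ} {D : ℝ}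
    (hD : ∀ t < T, ∀ a b, u t a - u t b ≤ D) (a : ι) :
    ρ T a ≤ D * √(Fintype.card ι) * √T := by
  -- For `T = 0` the hypothesis says nothing about `D`; otherwise comparing an action with itself in
  -- round `0` gives `0 ≤ D`.
  rcases Nat.eq_zero_or_pos T with rfl | hT
  · simp [h0]
  have hD0 : 0 ≤ D := by simpa using hD 0 hT a a
  -- The potential: expanding the square of `ρ⁺ + d`, the cross terms sum to zero by orthogonality,
  -- and each `d²` is at most `D²`.
  have key : ∀ t ≤ T, ∑ a, max (ρ t a) 0 ^ 2 ≤ t * (Fintype.card ι * D ^ 2) := by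
    intro t
    induction t with
    | zero => intro _; simp [h0]
    | succ t ih =>
      intro ht
      have hd : ∀ a, |u t a - ∑ b, u t b * regretMatchingStrategy (ρ t) b| ≤ D := by
        intro a
        have : u t a - ∑ b, u t b * regretMatchingStrategy (ρ t) b
            = ∑ b, (u t a - u t b) * regretMatchingStrategy (ρ t) b := by
          simp_rw [sub_mul, Finset.sum_sub_distrib, ← Finset.mul_sum,
            sum_regretMatchingStrategy, mul_one]
        rw [this]
        refine (Finset.abs_sum_le_sum_abs _ _).trans ?_
        calc _ ≤ ∑ b, D * regretMatchingStrategy (ρ t) b := by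
              refine Finset.sum_le_sum fun b _ => ?_
              rw [abs_mul, abs_of_nonneg (regretMatchingStrategy_nonneg _ b)]
              exact mul_le_mul_of_nonneg_right
                (abs_le.2 ⟨by linarith [hD t ht b a], hD t ht a b⟩)
                (regretMatchingStrategy_nonneg _ b)
          _ = D := by rw [← Finset.mul_sum, sum_regretMatchingStrategy, mul_one]
      calc ∑ a, max (ρ (t + 1) a) 0 ^ 2
          ≤ ∑ a, (max (ρ t a) 0 ^ 2
              + 2 * (max (ρ t a) 0 * (u t a - ∑ b, u t b * regretMatchingStrategy (ρ t) b))
              + D ^ 2) := by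
            refine Finset.sum_le_sum fun a _ => ?_
            have h1 := sq_le_sq' (abs_le.1 (hd a)).1 (abs_le.1 (hd a)).2
            rw [hs]
            set d := u t a - ∑ b, u t b * regretMatchingStrategy (ρ t) b
            have h2 : max (ρ t a + d) 0 ^ 2 ≤ (max (ρ t a) 0 + d) ^ 2 := by
              rcases le_total (ρ t a + d) 0 with h | h
              · rw [max_eq_right h]; nlinarith [sq_nonneg (max (ρ t a) 0 + d)]
              · rw [max_eq_left h]
                have := le_max_left (ρ t a) 0
                exact pow_le_pow_left₀ h (by linarith) 2
            nlinarith
        _ = ∑ a, max (ρ t a) 0 ^ 2 + Fintype.card ι * D ^ 2 := by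
            rw [Finset.sum_add_distrib, Finset.sum_add_distrib, ← Finset.mul_sum,
              sum_pos_mul_sub_regretMatchingStrategy]
            simp
        _ ≤ _ := by
            push_cast
            linarith [ih (Nat.le_of_succ_le ht)]
  -- A single squared positive regret is at most the whole potential.
  have h1 : max (ρ T a) 0 ^ 2 ≤ T * (Fintype.card ι * D ^ 2) :=
    (Finset.single_le_sum (f := fun a => max (ρ T a) 0 ^ 2) (fun _ _ => sq_nonneg _)
      (Finset.mem_univ a)).trans (key T le_rfl)
  refine (le_max_left _ 0).trans (abs_le_of_sq_le_sq' ?_ (by positivity)).2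
  rw [mul_pow, mul_pow, Real.sq_sqrt (by positivity), Real.sq_sqrt (by positivity)]
  linarith

variable [DecidableEq ι]

theorem regretMatching_next_strategy (s : (regretMatching ι).State) :
    Vec.toFn ((regretMatching ι).next s).val.1 = regretMatchingStrategy (Vec.toFn s.1) := by
  ext a
  simp only [regretMatching, Tick.val_bind]
  unfold regretMatchingStrategy
  split_ifs with h1 h2 h2
  · simp [tabulate_val, sumOver_val, sum_map_elems, Vec.val_get]
  · simp [sumOver_val, sum_map_elems, Vec.val_get] at h1
    exact absurd h1 (by simpa using h2)
  · simp [sumOver_val, sum_map_elems, Vec.val_get] at h1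
    exact absurd h2 (by simpa using h1)
  · simp [tabulate_val]

@[simp] theorem regretMatching_next_regret (s : (regretMatching ι).State) :
    ((regretMatching ι).next s).val.2.1 = s.1 := by
  simp only [regretMatching, Tick.val_bind]
  split_ifs <;> rfl

@[simp] theorem regretMatching_next_last (s : (regretMatching ι).State) :
    ((regretMatching ι).next s).val.2.2 = ((regretMatching ι).next s).val.1 := by
  simp only [regretMatching, Tick.val_bind]
  split_ifs <;> rfl

theorem regretMatching_observe (s : (regretMatching ι).State) (u : Vec ι) (a : ι) :
    Vec.toFn ((regretMatching ι).observe s u).val.1 a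
      = Vec.toFn s.1 a + (u.toFn a - ∑ b, u.toFn b * Vec.toFn s.2 b) := by
  simp [regretMatching, tabulate_val, sumOver_val, sum_map_elems, Vec.val_get]

theorem regretMatching_next_cost (s : (regretMatching ι).State) :
    ((regretMatching ι).next s).cost ≤ 10 * Fintype.card ι + 20 := by
  have h1 := sumOver_cost (f := fun a => (do let r ← s.1.read a; r.pos : Tick Word)) 2
    (elems ι) fun i => by simp
  have h2 (total : Word) := tabulate_cost
    (f := fun a => (do let r ← s.1.read a; let p ← r.pos; p.div total : Tick Word)) 3
    (elems ι) fun i => by simp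
  have h3 (u : Word) := tabulate_cost (f := fun _ => (pure u : Tick Word)) 0
    (elems ι) fun i => by simp
  simp only [length_elems] at h1 h2 h3
  simp only [regretMatching, Tick.cost_bind]
  split_ifs
  · have := h2 (sumOver (elems ι) fun a => (do let r ← s.1.read a; r.pos : Tick Word)).val
    simp only [Tick.cost_bind, Word.cost_isPos, Tick.cost_pure]
    omega
  · simp only [Tick.cost_bind, Word.cost_isPos, Tick.cost_pure, Word.cost_ofNat, Word.cost_div]
    have := h3 (((Word.ofNat 1).val.div (Word.ofNat (Fintype.card ι)).val).val)
    omega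

theorem regretMatching_observe_cost (s : (regretMatching ι).State) (u : Vec ι) :
    ((regretMatching ι).observe s u).cost ≤ 12 * Fintype.card ι + 4 := by
  have h1 := sumOver_cost
    (f := fun a => (do let ua ← u.read a; let xa ← Arr.read s.2 a; ua.mul xa : Tick Word)) 3
    (elems ι) fun i => le_rfl
  have h2 (v : Word) := tabulate_cost (f := fun a => (do
      let r ← Arr.read s.1 a
      let ua ← u.read a
      let d ← ua.sub v
      r.add d : Tick Word)) 4
    (elems ι) fun i => le_rfl
  simp only [length_elems] at h1 h2
  simp only [regretMatching, Tick.cost_bind, Tick.cost_pure]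
  have := h2 (sumOver (elems ι)
    fun a => (do let ua ← u.read a; let xa ← Arr.read s.2 a; ua.mul xa : Tick Word)).val
  omega

end regretMatching

/-! ## The forest of information sets -/

namespace InfoForest

variable {F : InfoForest}

theorem SeqLE.refl (s : F.Seq) : F.SeqLE s s := Relation.ReflTransGen.refl

theorem seqLE_some_iff {s : F.Seq} {t : F.SeqStar} :
    F.SeqLE s (some t) ↔ s = some t ∨ F.SeqLE s (F.par t.1) := by
  constructor
  · intro h
    rcases Relation.ReflTransGen.cases_tail h with h | ⟨u, hu, k, c, hk, rfl⟩
    · exact Or.inl h.symm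
    · cases hk
      exact Or.inr hu
  · rintro (rfl | h)
    · exact SeqLE.refl _
    · exact Relation.ReflTransGen.tail h ⟨t.1, t.2, rfl, rfl⟩

theorem not_seqLE_none (s : F.SeqStar) : ¬ F.SeqLE (some s) none := by
  intro h
  rcases Relation.ReflTransGen.cases_tail h with h | ⟨u, hu, k, c, hk, -⟩
  · cases h
  · cases hk

/-- Every path into `k` ends with the parent sequence of `k`, which gives the recursion used to
climb the forest one information set at a time. -/
theorem infoLT_iff {j k : F.J} :
    F.InfoLT j k ↔ ∃ t : F.SeqStar, F.par k = some t ∧ F.InfoLE j t.1 := by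
  constructor
  · rintro ⟨a, ha⟩
    cases hp : F.par k with
    | none => exact absurd (hp ▸ ha) (not_seqLE_none _)
    | some t =>
      refine ⟨t, rfl, ?_⟩
      rw [hp, seqLE_some_iff] at ha
      rcases ha with ha | ha
      · cases ha
        exact Or.inl rfl
      · exact Or.inr ⟨a, ha⟩
  · rintro ⟨t, ht, rfl | ⟨a, ha⟩⟩
    · exact ⟨t.2, ht ▸ SeqLE.refl _⟩
    · exact ⟨a, ht ▸ seqLE_some_iff.2 (Or.inr ha)⟩

theorem InfoLT.trans {j k l : F.J} (h : F.InfoLT j k) (h' : F.InfoLT k l) : F.InfoLT j l := by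
  obtain ⟨a, ha⟩ := h
  obtain ⟨b, hb⟩ := h'
  exact ⟨a, Relation.ReflTransGen.trans (seqLE_some_iff.2 (Or.inr ha)) hb⟩

theorem infoLT_of_par {k : F.J} {t : F.SeqStar} (h : F.par k = some t) : F.InfoLT t.1 k :=
  infoLT_iff.2 ⟨t, h, Or.inl rfl⟩

theorem InfoLE.trans_lt {j k l : F.J} (h : F.InfoLE j k) (h' : F.InfoLT k l) : F.InfoLT j l := by
  rcases h with rfl | h
  · exact h'
  · exact h.trans h'

/-- `InfoLT` is contained in the transitive closure of the parent relation, which is well-founded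
and so has no cycles. -/
theorem infoLT_irrefl (j : F.J) : ¬ F.InfoLT j j := by
  have key : ∀ k j, F.InfoLT j k →
      Relation.TransGen (fun j j' : F.J => ∃ a, F.par j' = some ⟨j, a⟩) j k := by
    intro k
    induction k using F.wf.induction with
    | _ k ih =>
      intro j h
      obtain ⟨⟨l, b⟩, hl, h⟩ := infoLT_iff.1 h
      rcases h with rfl | h
      · exact .single ⟨b, hl⟩
      · exact (ih l ⟨b, hl⟩ j h).tail ⟨b, hl⟩
  exact fun h => F.wf.transGen.irrefl.irrefl j (key j j h)

theorem InfoLE.refl (j : F.J) : F.InfoLE j j := Or.inl rfl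

/-- Counterfactual values are defined from the descendants upwards. A strict order on a finite set
is well-founded in this direction as well. -/
theorem wf_infoLT_swap : WellFounded fun k k' : F.J => F.InfoLT k' k :=
  haveI : IsTrans F.J fun k k' : F.J => F.InfoLT k' k := ⟨fun _ _ _ h h' => h'.trans h⟩
  haveI : Std.Irrefl fun k k' : F.J => F.InfoLT k' k := ⟨infoLT_irrefl⟩
  Finite.wellFounded_of_trans_of_irrefl _

@[simp] theorem seqGE_none (j : F.J) : ¬ F.SeqGE none j := by
  rintro ⟨_, _, h, _⟩
  cases h

@[simp] theorem seqGE_some {t : F.SeqStar} {j : F.J} : F.SeqGE (some t) j ↔ F.InfoLE j t.1 :=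
  ⟨by rintro ⟨k, a, h, h'⟩; cases h; exact h', fun h => SeqGE.of_le h t.2⟩

@[simp] theorem seqGE_par {j k : F.J} : F.SeqGE (F.par k) j ↔ F.InfoLT j k := by
  refine ⟨fun h => ?_, SeqGE.of_lt⟩
  obtain ⟨l, a, h, h'⟩ := h
  exact infoLT_iff.2 ⟨_, h, h'⟩

/-- At most one action at each information set is played on the way to a sequence. -/
theorem seqLE_action_unique {k : F.J} {a a' : F.A k} {s : F.Seq} (h : F.SeqLE (some ⟨k, a⟩) s)
    (h' : F.SeqLE (some ⟨k, a'⟩) s) : a = a' := by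
  induction h with
  | refl =>
    rcases seqLE_some_iff.1 h' with h' | h'
    · cases h'
      rfl
    · exact absurd ⟨a', h'⟩ (infoLT_irrefl k)
  | @tail u v hu huv ih =>
    obtain ⟨l, c, rfl, rfl⟩ := huv
    rcases seqLE_some_iff.1 h' with h' | h'
    · cases h'
      exact absurd ⟨a, hu⟩ (infoLT_irrefl k)
    · exact ih h'

/-! ## Trigger deviations -/

section devMap

open Classical in
-- Row `r` can be nonzero only in the columns `r` and `some s`, so the product collapses to two
-- terms. Continuations are written as restrictions of functions on all sequences, which avoids the
-- subtype `SeqAt`; by `exists_extension` nothing is lost.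
theorem devMap_apply (s : F.SeqStar) (z : F.Seq → ℝ) (x : F.Seq → ℝ) (r : F.Seq) :
    F.devMap s (fun r => z r.1) x r
      = (if F.SeqLE (some s) r then 0 else x r)
        + if F.SeqGE r s.1 then z r * x (some s) else 0 := by
  have h : ∀ c, F.devMatrix s (fun r => z r.1) r c * x c
      = (if r = c then (if F.SeqLE (some s) r then 0 else x r) else 0)
        + if some s = c then (if F.SeqGE r s.1 then z r * x (some s) else 0) else 0 := by
    intro c
    unfold devMatrix
    by_cases h1 : r = c <;> by_cases h2 : some s = c
    · subst h1 h2
      simp [SeqLE.refl]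
    · subst h1
      simp [h2, Ne.symm h2]
    · subst h2
      simp [h1]
    · simp [h1, h2, Ne.symm h2]
  simp only [devMap, Matrix.mulVecLin_apply, Matrix.mulVec, dotProduct, h,
    Finset.sum_add_distrib, Finset.sum_ite_eq, Finset.mem_univ, if_true]

/-- The conditions for (the restriction to the subtree of `j` of) a vector to be a sequence-form
strategy for the subtree of `j`. -/
structure IsSubStrategy (j : F.J) (z : F.Seq → ℝ) : Prop where
  nonneg : ∀ s, F.SeqGE s j → 0 ≤ z s
  root : ∑ a, z (some ⟨j, a⟩) = 1
  flow : ∀ k, F.InfoLT j k → z (F.par k) = ∑ a, z (some ⟨k, a⟩)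

theorem isSubStrategy_iff {j : F.J} {z : F.Seq → ℝ} :
    F.IsSubStrategy j z ↔ (fun r : F.SeqAt j => z r.1) ∈ F.subPolytope j :=
  ⟨fun h => ⟨fun s => h.nonneg s.1 s.2, h.root, h.flow⟩,
    fun h => ⟨fun s hs => h.1 ⟨s, hs⟩, h.2.1, h.2.2⟩⟩

theorem exists_extension {j : F.J} (y : F.SeqAt j → ℝ) :
    ∃ z : F.Seq → ℝ, y = fun r => z r.1 := by
  classical
  exact ⟨fun r => if h : F.SeqGE r j then y ⟨r, h⟩ else 0, by ext r; simp [r.2]⟩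

/-- The deviation removes the mass of the trigger `s` and everything after it, and lets the mass
`x[s]` flow from `s.1` according to `z`. At `s.1` the loss and the gain both equal `x[s]`, as `z`
has total mass 1 there. At any other `k` the actions precede or follow the trigger exactly as their
parent does, and both parts satisfy the flow equation separately. -/
theorem devMap_mem_polytope {s : F.SeqStar} {z : F.Seq → ℝ} (hz : F.IsSubStrategy s.1 z)
    {x : F.Seq → ℝ} (hx : x ∈ F.polytope) : F.devMap s (fun r => z r.1) x ∈ F.polytope := by
  classical
  obtain ⟨h1, h2, h3⟩ := hx
  refine ⟨fun r => ?_, ?_, fun k => ?_⟩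
  · rw [devMap_apply]
    refine add_nonneg ?_ ?_
    · split_ifs
      · exact le_rfl
      · exact h1 r
    · split_ifs with h
      · exact mul_nonneg (hz.nonneg r h) (h1 _)
      · exact le_rfl
  · rw [devMap_apply]
    simp [not_seqLE_none, h2]
  · simp only [devMap_apply, seqGE_par, seqGE_some, Finset.sum_add_distrib]
    by_cases hk : s.1 = k
    · obtain ⟨j, a⟩ := s
      subst hk
      have h4 : ¬ F.SeqLE (some ⟨j, a⟩) (F.par j) := fun h => infoLT_irrefl j ⟨a, h⟩
      have h5 : ∀ b : F.A j,
          (if F.SeqLE (some ⟨j, a⟩) (some ⟨j, b⟩) then 0 else x (some ⟨j, b⟩))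
            = x (some ⟨j, b⟩) - if a = b then x (some ⟨j, b⟩) else 0 := by
        intro b
        simp only [seqLE_some_iff, h4, or_false]
        by_cases hb : a = b
        · simp [hb]
        · simp [hb]
      simp only [h5, h4, infoLT_irrefl, InfoLE.refl, if_true, if_false, Finset.sum_sub_distrib,
        Finset.sum_ite_eq, Finset.mem_univ, ← Finset.sum_mul]
      rw [hz.root, h3 j]
      ring
    · have h5 : ∀ b : F.A k, F.SeqLE (some s) (some ⟨k, b⟩) ↔ F.SeqLE (some s) (F.par k) := by
        intro b
        rw [seqLE_some_iff]
        refine or_iff_right ?_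
        intro h
        cases h
        exact hk rfl
      have h6 : F.InfoLE s.1 k ↔ F.InfoLT s.1 k := or_iff_right hk
      simp only [h5, h6]
      congr 1
      · split_ifs
        · simp
        · exact h3 k
      · split_ifs with h
        · rw [hz.flow k h, Finset.sum_mul]
        · simp

theorem exists_devMap_of_mem_triggerDeviations {φ : (F.Seq → ℝ) →ₗ[ℝ] (F.Seq → ℝ)}
    (hφ : φ ∈ F.triggerDeviations) :
    ∃ (s : F.SeqStar) (z : F.Seq → ℝ), F.IsSubStrategy s.1 z ∧ φ = F.devMap s fun r => z r.1 := by
  obtain ⟨s, y, hy, rfl⟩ := hφ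
  obtain ⟨z, rfl⟩ := exists_extension y
  exact ⟨s, z, isSubStrategy_iff.2 hy.1, rfl⟩

theorem convex_polytope : Convex ℝ F.polytope := by
  rintro x ⟨hx1, hx2, hx3⟩ y ⟨hy1, hy2, hy3⟩ a b ha hb hab
  refine ⟨fun s => ?_, ?_, fun j => ?_⟩
  · simp only [Pi.add_apply, Pi.smul_apply, smul_eq_mul]
    exact add_nonneg (mul_nonneg ha (hx1 s)) (mul_nonneg hb (hy1 s))
  · simp [hx2, hy2, hab]
  · simp [hx3, hy3, Finset.sum_add_distrib, Finset.mul_sum]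

/-- For fixed `x` the map `φ ↦ φ x` is linear, so the deviations that send `x` into the convex set
`Q` form a convex set. -/
theorem mapsTo_polytope {φ : (F.Seq → ℝ) →ₗ[ℝ] (F.Seq → ℝ)}
    (hφ : φ ∈ convexHull ℝ F.triggerDeviations) : Set.MapsTo φ F.polytope F.polytope := by
  intro x hx
  have hc : Convex ℝ {φ : (F.Seq → ℝ) →ₗ[ℝ] (F.Seq → ℝ) | φ x ∈ F.polytope} :=
    convex_polytope.linear_preimage (LinearMap.applyₗ x)
  refine convexHull_min (fun φ hφ => ?_) hc hφ
  obtain ⟨s, z, hz, rfl⟩ := exists_devMap_of_mem_triggerDeviations hφ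
  exact devMap_mem_polytope hz hx

/-- A pure continuation is determined by a Boolean function. Finiteness is what makes the maximal
regret attained. -/
theorem finite_triggerDeviations : F.triggerDeviations.Finite := by
  have : F.triggerDeviations ⊆ Set.range fun p : (Σ s : F.SeqStar, F.SeqAt s.1 → Bool) =>
      F.devMap p.1 fun r => if p.2 r then 1 else 0 := by
    classical
    rintro _ ⟨s, y, hy, rfl⟩
    refine ⟨⟨s, fun r => decide (y r = 1)⟩, ?_⟩
    refine congrArg (F.devMap s) (funext fun r => ?_)
    rcases hy.2 r with h | h <;> simp [h]
  exact (Set.finite_range _).subset this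

end devMap

/-! ## Behavioral strategies -/

section realization

open Classical in
/-- The sequence form of a behavioral strategy in the subtree of `j`. -/
def realization (b : ∀ k, F.A k → ℝ) (j : F.J) (s : F.Seq) : ℝ :=
  ∏ t : F.SeqStar, if F.SeqLE (some t) s ∧ F.InfoLE j t.1 then b t.1 t.2 else 1

variable {b : ∀ k, F.A k → ℝ} {j : F.J}

open Classical in
theorem realization_some (b : ∀ k, F.A k → ℝ) (j : F.J) (t : F.SeqStar) :
    F.realization b j (some t)
      = (if F.InfoLE j t.1 then b t.1 t.2 else 1) * F.realization b j (F.par t.1) := by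
  have : (if F.InfoLE j t.1 then b t.1 t.2 else 1)
      = ∏ t' : F.SeqStar, if t' = t then (if F.InfoLE j t'.1 then b t'.1 t'.2 else 1) else 1 := by
    rw [Finset.prod_ite_eq']
    simp
  rw [this, realization, realization, ← Finset.prod_mul_distrib]
  refine Finset.prod_congr rfl fun t' _ => ?_
  rw [seqLE_some_iff]
  by_cases h : t' = t
  · subst h
    have : ¬ F.SeqLE (some t') (F.par t'.1) := fun h => infoLT_irrefl t'.1 ⟨t'.2, h⟩
    simp [this]
  · simp [h]

theorem realization_par_self (b : ∀ k, F.A k → ℝ) (j : F.J) :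
    F.realization b j (F.par j) = 1 := by
  refine Finset.prod_eq_one fun t _ => if_neg ?_
  rintro ⟨h1, h2⟩
  exact infoLT_irrefl j (h2.trans_lt ⟨t.2, h1⟩)

theorem realization_of_le {k : F.J} (h : F.InfoLE j k) (a : F.A k) :
    F.realization b j (some ⟨k, a⟩) = b k a * F.realization b j (F.par k) := by
  rw [realization_some]
  simp [h]

theorem realization_nonneg (hb : ∀ k a, 0 ≤ b k a) (s : F.Seq) : 0 ≤ F.realization b j s :=
  Finset.prod_nonneg fun t _ => by
    split_ifs
    · exact hb _ _
    · exact zero_le_one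

theorem isSubStrategy_realization (hb : ∀ k a, 0 ≤ b k a) (hs : ∀ k, ∑ a, b k a = 1) :
    F.IsSubStrategy j (F.realization b j) where
  nonneg s _ := realization_nonneg hb s
  root := by
    simp only [realization_of_le (InfoLE.refl j), realization_par_self, mul_one, hs]
  flow k hk := by
    simp only [realization_of_le (Or.inr hk), ← Finset.sum_mul, hs, one_mul]

/-- The pure behavioral strategy that plays `π k` at `k`. -/
def pureBehavior (π : ∀ k, F.A k) (k : F.J) (a : F.A k) : ℝ := if a = π k then 1 else 0

theorem pureBehavior_nonneg (π : ∀ k, F.A k) (k : F.J) (a : F.A k) : 0 ≤ F.pureBehavior π k a := by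
  unfold pureBehavior
  split_ifs <;> norm_num

theorem sum_pureBehavior (π : ∀ k, F.A k) (k : F.J) : ∑ a, F.pureBehavior π k a = 1 := by
  simp [pureBehavior]

theorem realization_pureBehavior_mem (π : ∀ k, F.A k) (j : F.J) :
    (fun r : F.SeqAt j => F.realization (F.pureBehavior π) j r.1) ∈ F.subPure j := by
  refine ⟨isSubStrategy_iff.1
    (isSubStrategy_realization (pureBehavior_nonneg π) (sum_pureBehavior π)), fun s => ?_⟩
  unfold realization
  refine Finset.prod_induction _ (fun x : ℝ => x = 0 ∨ x = 1) ?_ (Or.inr rfl) fun t _ => ?_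
  · rintro x y (rfl | rfl) (rfl | rfl) <;> simp
  · unfold pureBehavior
    split_ifs <;> simp

/-- Kuhn's theorem: a behavioral strategy is a mixture of pure strategies. -/
theorem realization_eq_sum (hs : ∀ k, ∑ a, b k a = 1) (j : F.J) (s : F.Seq) :
    F.realization b j s
      = ∑ π : ∀ k, F.A k, (∏ k, b k (π k)) * F.realization (F.pureBehavior π) j s := by
  classical
  -- The product is grouped by information set; `c k` is the factor that `k` contributes.
  let c : ∀ k, (F.A k → ℝ) → ℝ := fun k β =>
    ∏ a, if F.SeqLE (some ⟨k, a⟩) s ∧ F.InfoLE j k then β a else 1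
  have hc : ∀ b : ∀ k, F.A k → ℝ, F.realization b j s = ∏ k, c k (b k) := fun b => by
    rw [realization, Fintype.prod_sigma]
  -- At most one action at `k` leads to `s`, so the factor is a single probability or 1. Either way
  -- it is the average of its values at the deterministic choices; expanding the product of these
  -- sums gives the sum over all `π`.
  have hl : ∀ k, c k (b k) = ∑ a, b k a * c k (fun a' => if a' = a then 1 else 0) := by
    intro k
    by_cases h : ∃ a, F.SeqLE (some ⟨k, a⟩) s ∧ F.InfoLE j k
    · obtain ⟨a, ha, hj⟩ := h
      have : ∀ β : F.A k → ℝ, c k β = β a := by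
        intro β
        refine (Finset.prod_eq_single a (fun a' _ hne => if_neg ?_) (by simp)).trans (if_pos ⟨ha, hj⟩)
        exact fun h => hne (seqLE_action_unique h.1 ha)
      simp [this]
    · have : ∀ β : F.A k → ℝ, c k β = 1 := fun β =>
        Finset.prod_eq_one fun a _ => if_neg fun h' => h ⟨a, h'⟩
      simp [this, hs]
  rw [hc, Finset.prod_congr rfl fun k _ => hl k, Finset.prod_univ_sum, Fintype.piFinset_univ]
  refine Finset.sum_congr rfl fun π _ => ?_
  rw [hc, Finset.prod_mul_distrib]
  rfl

/-- The deviation is affine in its continuation, and the Kuhn weights `∏ k, b k (π k)` sum to 1, so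
the decomposition into pure strategies carries over to deviations. -/
theorem devMap_realization_mem_convexHull (hb : ∀ k a, 0 ≤ b k a) (hs : ∀ k, ∑ a, b k a = 1)
    (s : F.SeqStar) : F.devMap s (fun r => F.realization b s.1 r.1) ∈
      convexHull ℝ F.triggerDeviations := by
  classical
  have hw : ∑ π : ∀ k, F.A k, ∏ k, b k (π k) = 1 := by
    have := Finset.prod_univ_sum (fun k : F.J => (Finset.univ : Finset (F.A k))) b
    rw [Fintype.piFinset_univ] at this
    rw [← this]
    exact Finset.prod_eq_one fun k _ => hs k
  have : F.devMap s (fun r => F.realization b s.1 r.1)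
      = ∑ π : ∀ k, F.A k, (∏ k, b k (π k)) •
        F.devMap s (fun r => F.realization (F.pureBehavior π) s.1 r.1) := by
    refine LinearMap.ext fun x => funext fun r => ?_
    simp only [LinearMap.sum_apply, LinearMap.smul_apply, Finset.sum_apply, Pi.smul_apply,
      smul_eq_mul, devMap_apply, mul_add, Finset.sum_add_distrib, ← Finset.sum_mul, hw, one_mul]
    congr 1
    split_ifs
    · rw [realization_eq_sum hs, Finset.sum_mul]
      exact Finset.sum_congr rfl fun π _ => mul_assoc _ _ _
    · simp
  rw [this]
  exact (convex_convexHull ℝ _).sum_mem (fun π _ => Finset.prod_nonneg fun k _ => hb k _) hw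
    fun π _ => subset_convexHull ℝ _ ⟨s, _, realization_pureBehavior_mem π s.1, rfl⟩

theorem nonempty_triggerDeviations [Nonempty F.J] : F.triggerDeviations.Nonempty := by
  obtain ⟨k⟩ := ‹Nonempty F.J›
  exact ⟨_, ⟨k, Classical.arbitrary _⟩, _,
    realization_pureBehavior_mem (fun _ => Classical.arbitrary _) k, rfl⟩

end realization

end InfoForest

/-! ## Counterfactual regrets -/

namespace InfoForest

variable {F : InfoForest}

open Classical in
/-- The counterfactual value of `k`: the expected value of the utility `g`, collected in the subtree
of `k`, under the behavioral strategy `b`. -/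
def cfValue (b : ∀ k, F.A k → ℝ) (g : F.SeqStar → ℝ) : F.J → ℝ :=
  F.wf_infoLT_swap.fix fun k V => ∑ a, b k a * (g ⟨k, a⟩ +
    ∑ k', if h : F.par k' = some ⟨k, a⟩ then V k' (infoLT_of_par h) else 0)

open Classical in
/-- The counterfactual utility of the action `a` at `k`. -/
def cfUtility (b : ∀ k, F.A k → ℝ) (g : F.SeqStar → ℝ) (k : F.J) (a : F.A k) : ℝ :=
  g ⟨k, a⟩ + ∑ k', if F.par k' = some ⟨k, a⟩ then F.cfValue b g k' else 0

theorem cfValue_eq (b : ∀ k, F.A k → ℝ) (g : F.SeqStar → ℝ) (k : F.J) :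
    F.cfValue b g k = ∑ a, b k a * F.cfUtility b g k a := by
  classical
  rw [cfValue, WellFounded.fix_eq]
  simp only [cfUtility, cfValue, dite_eq_ite]

open Classical in
/-- The value of the utility `g` under a strategy `z` for the subtree of `j`. -/
def subValue (j : F.J) (g : F.SeqStar → ℝ) (z : F.Seq → ℝ) : ℝ :=
  ∑ t : F.SeqStar, if F.InfoLE j t.1 then g t * z (some t) else 0

variable {b : ∀ k, F.A k → ℝ} {g : F.SeqStar → ℝ} {j : F.J} {z : F.Seq → ℝ}

open Classical in
/-- The difference between the values of `z` and of `b` in terms of the counterfactual regrets. -/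
theorem sum_mul_cfUtility_sub (hz : F.IsSubStrategy j z) :
    ∑ k, (if F.InfoLE j k then
        ∑ a, z (some ⟨k, a⟩) * (F.cfUtility b g k a - F.cfValue b g k) else 0)
      = F.subValue j g z - F.cfValue b g j := by
  -- The contribution of `k` is its immediate utility plus the values of its children, minus the
  -- mass at `k` times its own value. That mass is 1 at `j` and `z (F.par k)` below.
  have h1 : ∀ k, (if F.InfoLE j k then
        ∑ a, z (some ⟨k, a⟩) * (F.cfUtility b g k a - F.cfValue b g k) else 0)
      = ∑ a, (if F.InfoLE j k then g ⟨k, a⟩ * z (some ⟨k, a⟩) else 0)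
        + ∑ a, ∑ k', (if F.InfoLE j k ∧ F.par k' = some ⟨k, a⟩ then
            z (F.par k') * F.cfValue b g k' else 0)
        - ((if j = k then F.cfValue b g k else 0)
          + if F.InfoLT j k then z (F.par k) * F.cfValue b g k else 0) := by
    intro k
    by_cases hk : F.InfoLE j k
    · have h2 : (∑ a, z (some ⟨k, a⟩)) * F.cfValue b g k
          = (if j = k then F.cfValue b g k else 0)
          + if F.InfoLT j k then z (F.par k) * F.cfValue b g k else 0 := by
        rcases hk with rfl | hk
        · simp [hz.root, infoLT_irrefl]
        · have : j ≠ k := by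
            rintro rfl
            exact infoLT_irrefl j hk
          simp [hk, this, hz.flow k hk]
      rw [← h2]
      simp only [hk, if_true, true_and, Finset.sum_mul, ← Finset.sum_add_distrib,
        ← Finset.sum_sub_distrib]
      refine Finset.sum_congr rfl fun a _ => ?_
      have h3 : ∑ k', (if F.par k' = some ⟨k, a⟩ then z (F.par k') * F.cfValue b g k' else 0)
          = z (some ⟨k, a⟩) * ∑ k', if F.par k' = some ⟨k, a⟩ then F.cfValue b g k' else 0 := by
        rw [Finset.mul_sum]
        refine Finset.sum_congr rfl fun k' _ => ?_
        split_ifs with h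
        · rw [h]
        · simp
      rw [h3, cfUtility]
      ring
    · have h2 : j ≠ k := fun h => hk (Or.inl h)
      have h3 : ¬ F.InfoLT j k := fun h => hk (Or.inr h)
      simp [hk, h2, h3]
  -- Each `k'` strictly below `j` is the child of exactly one sequence in the subtree. After this
  -- reindexing the children's values cancel the subtracted values, and only the value of `j` is
  -- left.
  have h4 : ∑ k, ∑ a, ∑ k', (if F.InfoLE j k ∧ F.par k' = some ⟨k, a⟩ then
            z (F.par k') * F.cfValue b g k' else 0)
      = ∑ k', if F.InfoLT j k' then z (F.par k') * F.cfValue b g k' else 0 := by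
    rw [← Fintype.sum_sigma' fun (k : F.J) (a : F.A k) =>
      ∑ k', (if F.InfoLE j k ∧ F.par k' = some ⟨k, a⟩ then
            z (F.par k') * F.cfValue b g k' else 0), Finset.sum_comm]
    refine Finset.sum_congr rfl fun k' _ => ?_
    rw [infoLT_iff]
    cases hp : F.par k' with
    | none => simp
    | some t =>
      rw [Finset.sum_eq_single t]
      · simp
      · rintro t' _ hne
        refine if_neg ?_
        rintro ⟨_, h⟩
        exact hne (Option.some.inj h).symm
      · simp
  simp only [h1, Finset.sum_sub_distrib, Finset.sum_add_distrib, h4]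
  rw [subValue, Fintype.sum_sigma]
  simp only [Finset.sum_ite_eq, Finset.mem_univ, if_true]
  ring

theorem sum_mul_cfUtility_sub_cfValue (hs : ∀ k, ∑ a, b k a = 1) (k : F.J) :
    ∑ a, b k a * (F.cfUtility b g k a - F.cfValue b g k) = 0 := by
  simp_rw [mul_sub, Finset.sum_sub_distrib, ← Finset.sum_mul, hs, one_mul]
  rw [cfValue_eq, sub_self]

/-- The decomposition into counterfactual regrets is applied to the sequence form of `b` itself,
where the local regrets average to zero at every `k`. -/
theorem cfValue_eq_subValue (hb : ∀ k a, 0 ≤ b k a) (hs : ∀ k, ∑ a, b k a = 1) :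
    F.cfValue b g j = F.subValue j g (F.realization b j) := by
  classical
  have := sum_mul_cfUtility_sub (b := b) (g := g) (isSubStrategy_realization (j := j) hb hs)
  rw [Finset.sum_eq_zero] at this
  · linarith
  · intro k _
    split_ifs with hk
    · have h := sum_mul_cfUtility_sub_cfValue (g := g) hs k
      simp_rw [realization_of_le hk, mul_comm (b k _), mul_assoc, ← Finset.mul_sum, h, mul_zero]
    · rfl

open Classical in
/-- The behavioral strategy that plays to reach `k`, and then the action `a`, and is like `b`
elsewhere. -/
def steer (b : ∀ k, F.A k → ℝ) (k : F.J) (a : F.A k) (l : F.J) (c : F.A l) : ℝ :=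
  if h : ∃ c', F.SeqLE (some ⟨l, c'⟩) (some ⟨k, a⟩) then (if c = h.choose then 1 else 0) else b l c

theorem steer_nonneg (hb : ∀ k a, 0 ≤ b k a) (k : F.J) (a : F.A k) (l : F.J) (c : F.A l) :
    0 ≤ F.steer b k a l c := by
  unfold steer
  split_ifs
  · exact zero_le_one
  · exact le_rfl
  · exact hb _ _

theorem sum_steer (hs : ∀ k, ∑ a, b k a = 1) (k : F.J) (a : F.A k) (l : F.J) :
    ∑ c, F.steer b k a l c = 1 := by
  unfold steer
  split_ifs
  · simp
  · exact hs l

open Classical in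
theorem steer_of_le {k : F.J} {a : F.A k} {l : F.J} {c : F.A l}
    (h : F.SeqLE (some ⟨l, c⟩) (some ⟨k, a⟩)) (c' : F.A l) :
    F.steer b k a l c' = if c' = c then 1 else 0 := by
  have h' : ∃ c', F.SeqLE (some ⟨l, c'⟩) (some ⟨k, a⟩) := ⟨c, h⟩
  rw [steer, dif_pos h', seqLE_action_unique h'.choose_spec h]

theorem realization_steer {k : F.J} {a : F.A k} {s : F.Seq} (h : F.SeqLE s (some ⟨k, a⟩)) :
    F.realization (F.steer b k a) j s = 1 := by
  classical
  refine Finset.prod_eq_one fun t _ => ?_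
  split_ifs with ht
  · rw [steer_of_le (Relation.ReflTransGen.trans ht.1 h), if_pos rfl]
  · rfl

/-- Two strategies that steer to `k`, then play `a` or `a'`, and otherwise follow `b`, differ in
value exactly by the difference of the two counterfactual utilities. Thus the range `D` of the
global utility bounds that of each local one, with no factor for the depth. -/
theorem cfUtility_sub_le (hb : ∀ k a, 0 ≤ b k a) (hs : ∀ k, ∑ a, b k a = 1) {D : ℝ}
    (hD : ∀ z z', F.IsSubStrategy j z → F.IsSubStrategy j z' →
      F.subValue j g z - F.subValue j g z' ≤ D) {k : F.J} (hk : F.InfoLE j k) (a a' : F.A k) :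
    F.cfUtility b g k a - F.cfUtility b g k a' ≤ D := by
  classical
  have hz := isSubStrategy_realization (j := j) (steer_nonneg hb k a) (sum_steer hs k a)
  have hz' := isSubStrategy_realization (j := j) (steer_nonneg hb k a') (sum_steer hs k a')
  refine le_trans (le_of_eq ?_) (hD _ _ hz hz')
  have h1 := sum_mul_cfUtility_sub (b := b) (g := g) hz
  have h2 := sum_mul_cfUtility_sub (b := b) (g := g) hz'
  have h3 := congrArg₂ (· - ·) h1 h2
  simp only [← Finset.sum_sub_distrib] at h3
  -- Only `k` contributes to the difference of the two decompositions.
  rw [Finset.sum_eq_single k] at h3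
  · simp only [hk, if_true, realization_of_le hk, steer_of_le (SeqLE.refl _),
      realization_steer (seqLE_some_iff.2 (Or.inr (SeqLE.refl _)))] at h3
    simp only [mul_one, ite_mul, one_mul, zero_mul, Finset.sum_ite_eq', Finset.mem_univ,
      if_true] at h3
    linarith
  · intro l _ hl
    by_cases hj : F.InfoLE j l
    · simp only [hj, if_true, realization_of_le hj]
      have h4 : ∀ (a : F.A k) c, F.SeqLE (some ⟨l, c⟩) (some ⟨k, a⟩)
          ↔ F.SeqLE (some ⟨l, c⟩) (F.par k) := by
        intro a c
        rw [seqLE_some_iff]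
        refine or_iff_right fun h => ?_
        cases h
        exact hl rfl
      -- Above `k` the two strategies play the same action and reach `l` with weight 1. Off the path
      -- both play `b`, whose average local regret is zero, so different reach weights do no harm.
      by_cases h : ∃ c, F.SeqLE (some ⟨l, c⟩) (F.par k)
      · obtain ⟨c, hc⟩ := h
        have h5 : ∀ a : F.A k, F.SeqLE (F.par l) (some ⟨k, a⟩) := fun a =>
          Relation.ReflTransGen.trans (seqLE_some_iff.2 (Or.inr (SeqLE.refl _))) ((h4 a c).2 hc)
        simp only [steer_of_le ((h4 _ c).2 hc), realization_steer (h5 _), sub_self]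
      · have h5 : ∀ (a : F.A k) c, F.steer b k a l c = b l c := fun a c =>
          dif_neg fun ⟨c', hc'⟩ => h ⟨c', (h4 a c').1 hc'⟩
        have h6 := sum_mul_cfUtility_sub_cfValue (g := g) hs l
        simp_rw [h5, mul_comm (b l _), mul_assoc, ← Finset.mul_sum, h6, mul_zero, sub_self]
    · simp [hj]
  · simp

/-- The mass at `k` is that of a single action at the preceding information set, so it does not
increase along a path from `j`. -/
theorem IsSubStrategy.sum_le_one (hz : F.IsSubStrategy j z) {k : F.J} (hk : F.InfoLE j k) :
    ∑ a, z (some ⟨k, a⟩) ≤ 1 := by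
  induction k using F.wf.induction with
  | _ k ih =>
    rcases hk with rfl | hk
    · exact hz.root.le
    · obtain ⟨⟨l, c⟩, hl, hj⟩ := infoLT_iff.1 hk
      rw [← hz.flow k hk, hl]
      refine le_trans ?_ (ih l ⟨c, hl⟩ hj)
      exact Finset.single_le_sum (f := fun c => z (some ⟨l, c⟩))
        (fun a _ => hz.nonneg _ (SeqGE.of_le hj a)) (Finset.mem_univ c)

/-- The regret bound of CFR in the subtree of `j`. -/
theorem cfr_regret_le {ρ : ℕ → ∀ k, F.A k → ℝ} {g : ℕ → F.SeqStar → ℝ}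
    (h0 : ∀ k, F.InfoLE j k → ∀ a, ρ 0 k a = 0)
    (hs : ∀ t k, F.InfoLE j k → ∀ a, ρ (t + 1) k a = ρ t k a
      + (F.cfUtility (fun l => regretMatchingStrategy (ρ t l)) (g t) k a
        - F.cfValue (fun l => regretMatchingStrategy (ρ t l)) (g t) k))
    {T : ℕ} {D : ℝ} (hD0 : 0 ≤ D)
    (hD : ∀ t < T, ∀ z z', F.IsSubStrategy j z → F.IsSubStrategy j z' →
      F.subValue j (g t) z - F.subValue j (g t) z' ≤ D) (hz : F.IsSubStrategy j z) :
    ∑ t ∈ Finset.range T, (F.subValue j (g t) z - F.subValue j (g t)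
        (F.realization (fun l => regretMatchingStrategy (ρ t l)) j))
      ≤ D * (Fintype.card F.SeqStar) * √T := by
  classical
  set b : ℕ → ∀ k, F.A k → ℝ := fun t l => regretMatchingStrategy (ρ t l)
  have hb : ∀ t k a, 0 ≤ b t k a := fun t k a => regretMatchingStrategy_nonneg _ _
  have hb1 : ∀ t k, ∑ a, b t k a = 1 := fun t k => sum_regretMatchingStrategy _
  have hρ : ∀ k, F.InfoLE j k → ∀ a,
      ∑ t ∈ Finset.range T, (F.cfUtility (b t) (g t) k a - F.cfValue (b t) (g t) k) = ρ T k a := by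
    intro k hk a
    generalize T = T
    induction T with
    | zero => simp [h0 k hk]
    | succ T ih => rw [Finset.sum_range_succ, ih, hs T k hk]
  have hle : ∀ k, F.InfoLE j k → ∀ a, ρ T k a ≤ D * √(Fintype.card (F.A k)) * √T := by
    intro k hk a
    refine regretMatching_regret_le (ρ := fun t => ρ t k)
      (u := fun t => F.cfUtility (b t) (g t) k) (h0 k hk) (fun t a => ?_) (fun t ht a a' => ?_) a
    · rw [hs t k hk, cfValue_eq]
      simp only [mul_comm, b]
    · exact cfUtility_sub_le (hb t) (hb1 t) (hD t ht) hk a a'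
  calc _ = ∑ t ∈ Finset.range T, ∑ k, (if F.InfoLE j k then
        ∑ a, z (some ⟨k, a⟩) * (F.cfUtility (b t) (g t) k a - F.cfValue (b t) (g t) k) else 0) := by
        refine Finset.sum_congr rfl fun t _ => ?_
        rw [sum_mul_cfUtility_sub hz, cfValue_eq_subValue (hb t) (hb1 t)]
    _ = ∑ k, if F.InfoLE j k then ∑ a, z (some ⟨k, a⟩) * ρ T k a else 0 := by
        rw [Finset.sum_comm]
        refine Finset.sum_congr rfl fun k _ => ?_
        split_ifs with hk
        · rw [Finset.sum_comm]
          refine Finset.sum_congr rfl fun a _ => ?_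
          rw [← Finset.mul_sum, hρ k hk]
        · simp
    -- The weights of `z` at `k` are nonnegative with sum at most 1, so the bound on single regrets
    -- carries over to their weighted sum.
    _ ≤ ∑ k, D * Fintype.card (F.A k) * √T := by
        refine Finset.sum_le_sum fun k _ => ?_
        split_ifs with hk
        · calc _ ≤ ∑ a, z (some ⟨k, a⟩) * (D * √(Fintype.card (F.A k)) * √T) :=
                Finset.sum_le_sum fun a _ => mul_le_mul_of_nonneg_left (hle k hk a)
                  (hz.nonneg _ (SeqGE.of_le hk a))
            _ ≤ 1 * (D * √(Fintype.card (F.A k)) * √T) := by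
                rw [← Finset.sum_mul]
                exact mul_le_mul_of_nonneg_right (hz.sum_le_one hk) (by positivity)
            _ ≤ D * Fintype.card (F.A k) * √T := by
                rw [one_mul]
                -- Replacing `√|A(k)|` by `|A(k)|` lets the local bounds add up to the number of
                -- nonempty sequences.
                have : √(Fintype.card (F.A k) : ℝ) ≤ Fintype.card (F.A k) := by
                  have : (1 : ℝ) ≤ Fintype.card (F.A k) := by exact_mod_cast Fintype.card_pos
                  exact Real.sqrt_le_iff.2 ⟨by positivity, by nlinarith⟩
                gcongr
        · positivity
    _ = _ := by
        rw [← Finset.sum_mul, ← Finset.mul_sum, Fintype.card_sigma]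
        push_cast
        rfl

end InfoForest

/-- A loop that writes the entries with indices in the range of `e`. -/
theorem forEach_update {ι κ : Type} [Fintype ι] [DecidableEq κ] {e : ι → κ}
    (he : Function.Injective e) (w : ι → ℝ) {f : ι → Vec κ → Tick (Vec κ)}
    (hf : ∀ i x, (f i x).val.toFn = Function.update x.toFn (e i) (w i)) (x : Vec κ) :
    (∀ i, (forEach (elems ι) x f).val.toFn (e i) = w i) ∧
      ∀ m, (∀ i, m ≠ e i) → (forEach (elems ι) x f).val.toFn m = x.toFn m := by
  have := forEach_val (fun l (y : Vec κ) => (∀ i ∈ l, y.toFn (e i) = w i) ∧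
    ∀ m, (∀ i, m ≠ e i) → y.toFn m = x.toFn m) (f := f) (l := elems ι) (x := x) (by simp) ?_
  · exact ⟨fun i => this.1 i (mem_elems i), this.2⟩
  · rintro l₁ k l₂ y _ ⟨h1, h2⟩
    refine ⟨fun i hi => ?_, fun m hm => ?_⟩
    · rw [hf]
      by_cases h : i = k
      · simp [h]
      · rw [Function.update_of_ne (he.ne h)]
        refine h1 i ?_
        simpa [h] using hi
    · rw [hf, Function.update_of_ne (hm k), h2 m hm]

/-- A loop that replaces every object in an array. -/
theorem forEach_replace {ι : Type} [Fintype ι] {β : ι → Type} [DecidableEq ι]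
    (w : ∀ i, β i → β i) {f : ι → Arr β → Tick (Arr β)}
    (hf : ∀ i x, (f i x).val.get = Function.update x.get i (w i (x.get i))) (x : Arr β) (i : ι) :
    (forEach (elems ι) x f).val.get i = w i (x.get i) := by
  have := forEach_val (fun l (y : Arr β) => ∀ i, (i ∈ l → y.get i = w i (x.get i)) ∧
    (i ∉ l → y.get i = x.get i)) (f := f) (l := elems ι) (x := x) (by simp) ?_
  · exact (this i).1 (mem_elems i)
  · intro l₁ k l₂ y hl h i
    have hk : k ∉ l₁ := by
      have := nodup_elems (ι := ι)
      rw [hl, List.nodup_append] at this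
      exact fun hk => this.2.2 k hk k (by simp) rfl
    rw [hf]
    by_cases hi : i = k
    · subst hi
      simp [(h i).2 hk]
    · simpa [hi] using h i

namespace InfoForest

variable {F : InfoForest}

/-! ## Counterfactual regret minimization -/

theorem card_J_le : Fintype.card F.J ≤ Fintype.card F.SeqStar :=
  Fintype.card_le_of_surjective Sigma.fst fun k => ⟨⟨k, Classical.arbitrary _⟩, rfl⟩

theorem sum_card_A : ∑ k, Fintype.card (F.A k) = Fintype.card F.SeqStar :=
  Fintype.card_sigma.symm

namespace TopDownOrder

variable (ord : F.TopDownOrder)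

theorem mem_subtree {j k : F.J} : k ∈ ord.subtree j ↔ F.InfoLE j k := by
  simp [subtree, ord.complete]

theorem nodup_subtree (j : F.J) : (ord.subtree j).Nodup := ord.nodup.filter _

theorem pairwise_subtree (j : F.J) : (ord.subtree j).Pairwise fun k k' => ¬ F.InfoLT k' k :=
  ord.topDown.filter _

variable {ord}

/-- In a top-down list, the predecessors of an element come first. -/
theorem mem_of_infoLT {l l₁ l₂ : List F.J} {k k' : F.J}
    (hp : l.Pairwise fun k k' => ¬ F.InfoLT k' k) (hl : l = l₁ ++ k :: l₂) (hm : k' ∈ l)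
    (h : F.InfoLT k' k) : k' ∈ l₁ := by
  subst hl
  rw [List.pairwise_append, List.pairwise_cons] at hp
  simp only [List.mem_append, List.mem_cons] at hm
  rcases hm with hm | rfl | hm
  · exact hm
  · exact absurd h (infoLT_irrefl _)
  · exact absurd h (hp.2.1.1 k' hm)

end TopDownOrder

theorem not_mem_of_nodup {ι : Type} {l l₁ l₂ : List ι} {k : ι} (hl : l = l₁ ++ k :: l₂)
    (h : l.Nodup) : k ∉ l₁ := by
  subst hl
  rw [List.nodup_append] at h
  exact fun hk => h.2.2 k hk k (by simp) rfl

/-- At `j` the program answers 1, in accordance with `realization_par_self`. For any other `k ⪰ j`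
the parent sequence is nonempty and lies in the subtree, so the branch for the empty sequence is
never taken. -/
theorem inflow_val {b : ∀ k, F.A k → ℝ} {j k : F.J} {q : Vec F.SeqStar}
    (hk : F.InfoLE j k)
    (hq : ∀ t, F.par k = some t → F.InfoLE j t.1 → q.toFn t = F.realization b j (some t)) :
    (F.inflow j k q).val.val = F.realization b j (F.par k) := by
  simp only [inflow, Tick.val_bind, val_sameIndex]
  split_ifs with h
  · subst h
    simp [realization_par_self]
  · obtain ⟨t, ht, hj⟩ := infoLT_iff.1 (hk.resolve_left h)
    have := hq t ht hj
    rw [ht] at *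
    simpa [Vec.val_get] using this

theorem inflow_cost (j k : F.J) (q : Vec F.SeqStar) : (F.inflow j k q).cost ≤ 2 := by
  simp only [inflow, Tick.cost_bind, cost_sameIndex]
  split_ifs
  · simp
  · cases F.par k <;> simp

section cfr

variable (ord : F.TopDownOrder) (j : F.J)

/-- The cumulative regrets in a state of CFR. -/
def cfrRegrets (s : (cfr ord j).State) (k : F.J) (a : F.A k) : ℝ :=
  Vec.toFn (Arr.get s.1 k).1 a

/-- The behavioral strategy that CFR plays in a state. -/
def cfrBehavior (s : (cfr ord j).State) (k : F.J) : F.A k → ℝ :=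
  regretMatchingStrategy (cfrRegrets ord j s k)

/-- The traversal is top-down, so the mass of the parent sequence is known when `k` is visited. The
invariant also records that unvisited local states are untouched, which makes the strategy at `k` a
function of the initial state. -/
theorem cfr_next_spec (s : (cfr ord j).State) :
    ((∀ k, F.InfoLE j k →
        (Arr.get ((cfr ord j).next s).val.2.1 k).1 = (Arr.get s.1 k).1 ∧
        Vec.toFn (Arr.get ((cfr ord j).next s).val.2.1 k).2 = cfrBehavior ord j s k ∧
        Vec.toFn (Arr.get ((cfr ord j).next s).val.2.2 k) = cfrBehavior ord j s k) ∧
      ∀ t : F.SeqStar, F.InfoLE j t.1 → Vec.toFn ((cfr ord j).next s).val.1 t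
        = F.realization (cfrBehavior ord j s) j (some t)) ∧
    ((cfr ord j).next s).cost ≤ 60 * Fintype.card F.SeqStar + 2 := by
  have h := forEach_spec (l := ord.subtree j) (x := (s, (Vec.zeros F.SeqStar).val))
    (f := fun k acc => do
      let st ← acc.1.1.read k
      let o ← (regretMatching (F.A k)).next st
      let sts ← acc.1.1.write k o.2
      let bs ← acc.1.2.write k o.1
      let mass ← F.inflow j k acc.2
      let q ← forEach (elems (F.A k)) acc.2 fun a q => do
        let b ← o.1.read a
        let m ← mass.mul b
        q.write ⟨k, a⟩ m
      pure ((sts, bs), q))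
    (fun l y => (∀ k ∈ l,
        (Arr.get y.1.1 k).1 = (Arr.get s.1 k).1 ∧
        Vec.toFn (Arr.get y.1.1 k).2 = cfrBehavior ord j s k ∧
        Vec.toFn (Arr.get y.1.2 k) = cfrBehavior ord j s k) ∧
      (∀ k ∉ l, Arr.get y.1.1 k = Arr.get s.1 k) ∧
      ∀ t : F.SeqStar, t.1 ∈ l → Vec.toFn y.2 t
        = F.realization (cfrBehavior ord j s) j (some t))
    -- Additive constants are absorbed because `|A(k)| ≥ 1`.
    (fun k => 50 * Fintype.card (F.A k)) (by simp) ?_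
  · obtain ⟨⟨h1, -, h2⟩, h3⟩ := h
    refine ⟨⟨fun k hk => h1 k (ord.mem_subtree.2 hk), fun t ht => h2 t (ord.mem_subtree.2 ht)⟩, ?_⟩
    have h4 := sum_map_le_of_nodup (ord.nodup_subtree j) fun k => 50 * Fintype.card (F.A k) + 1
    rw [Finset.sum_add_distrib, ← Finset.mul_sum, sum_card_A, Finset.sum_const,
      Finset.card_univ, smul_eq_mul, mul_one] at h4
    have h5 := card_J_le (F := F)
    change (Fintype.card F.SeqStar + 1) + (_ + 0) ≤ _
    omega
  · rintro l₁ k l₂ y hl ⟨h1, h2, h3⟩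
    have hk : k ∉ l₁ := not_mem_of_nodup hl (ord.nodup_subtree j)
    have hj : F.InfoLE j k := ord.mem_subtree.1 (by simp [hl])
    have hy : Arr.get y.1.1 k = Arr.get s.1 k := h2 k hk
    have hb : Vec.toFn ((regretMatching (F.A k)).next (Arr.get y.1.1 k)).val.1
        = cfrBehavior ord j s k := by
      rw [regretMatching_next_strategy, hy]
      rfl
    have hm : (F.inflow j k y.2).val.val
        = F.realization (cfrBehavior ord j s) j (F.par k) :=
      inflow_val hj fun t ht htj => h3 t (TopDownOrder.mem_of_infoLT (ord.pairwise_subtree j) hl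
        (ord.mem_subtree.2 htj) (infoLT_of_par ht))
    constructor
    · have hq := forEach_update (ι := F.A k) (e := fun a => (⟨k, a⟩ : F.SeqStar))
        (w := fun a => F.realization (cfrBehavior ord j s) j (some ⟨k, a⟩))
        (f := fun a q => do
          let b ← ((regretMatching (F.A k)).next (Arr.get y.1.1 k)).val.1.read a
          let m ← (F.inflow j k y.2).val.mul b
          q.write ⟨k, a⟩ m) sigma_mk_injective (fun a x => by
            simp only [Tick.val_bind, Vec.toFn_write, Word.val_mul, hm, Arr.val_read, Vec.val_get,
              hb, realization_of_le hj]
            rw [mul_comm]) y.2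
      simp only [Tick.val_bind, Tick.val_pure, Arr.get_write, Arr.val_read]
      refine ⟨fun k' hk' => ?_, fun k' hk' => ?_, fun t ht => ?_⟩
      · by_cases h : k' = k
        · subst h
          simp only [Function.update_self, regretMatching_next_regret, regretMatching_next_last]
          exact ⟨by rw [hy], hb, hb⟩
        · simp only [Function.update_of_ne h]
          exact h1 k' (by simpa [h] using hk')
      · have h : k' ≠ k := by
          rintro rfl
          simp at hk'
        rw [Function.update_of_ne h]
        exact h2 k' fun h => hk' (by simp [h])
      · by_cases h : t.1 = k
        · obtain ⟨k', a⟩ := t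
          obtain rfl : k' = k := h
          exact hq.1 a
        · refine (hq.2 t fun a ha => h (by rw [ha])).trans (h3 t (by simpa [h] using ht))
    · have c1 := regretMatching_next_cost (Arr.get y.1.1 k)
      have c2 := inflow_cost j k y.2
      have c3 := forEach_cost (l := elems (F.A k)) (f := fun a (q : Vec F.SeqStar) => do
          let b ← ((regretMatching (F.A k)).next (Arr.get y.1.1 k)).val.1.read a
          let m ← (F.inflow j k y.2).val.mul b
          q.write ⟨k, a⟩ m) (fun _ => 3) y.2 (fun _ _ => le_rfl)
      simp only [List.map_const', List.sum_replicate, smul_eq_mul, length_elems] at c3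
      have c4 : 1 ≤ Fintype.card (F.A k) := Fintype.card_pos
      simp only [Tick.cost_bind, Tick.cost_pure, Arr.cost_write, Arr.cost_read, Arr.val_read] at *
      omega

/-- An information set has at most one parent sequence, so it is counted at most once. -/
theorem sum_length_children_le :
    ∑ k, ∑ a : F.A k, (elemsWith fun k' => F.par k' = some ⟨k, a⟩).length
      ≤ Fintype.card F.SeqStar := by
  classical
  refine le_trans ?_ card_J_le
  rw [← Fintype.sum_sigma' fun (k : F.J) (a : F.A k) =>
    (elemsWith fun k' => F.par k' = some ⟨k, a⟩).length]
  simp only [length_elemsWith, Finset.card_filter]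
  rw [Finset.sum_comm, Fintype.card_eq_sum_ones]
  refine Finset.sum_le_sum fun k' _ => ?_
  cases F.par k' with
  | none => simp
  | some t =>
    refine (Finset.sum_eq_single t (fun x _ hx => if_neg fun h => hx (Option.some.inj h).symm)
      (by simp)).trans_le ?_
    simp

/-- In the reversed order the counterfactual values of all children of `k` are available when `k` is
visited. The hypothesis asks for `b` twice because the last output is kept both inside the local
regret matcher and in the second array. -/
theorem cfr_observe_spec (s : (cfr ord j).State) (g : Vec F.SeqStar) {b : ∀ k, F.A k → ℝ}
    (hb : ∀ k, F.InfoLE j k →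
      Vec.toFn (Arr.get s.1 k).2 = b k ∧ Vec.toFn (Arr.get s.2 k) = b k) :
    ∀ k, F.InfoLE j k → ∀ a, cfrRegrets ord j ((cfr ord j).observe s g).val k a
      = cfrRegrets ord j s k a + (F.cfUtility b g.toFn k a - F.cfValue b g.toFn k) := by
  classical
  have h := forEach_val (l := (ord.subtree j).reverse) (x := (s.1, (Vec.zeros F.J).val))
    (f := fun k acc => do
      let b ← s.2.read k
      let u ← tabulate (elems (F.A k)) fun a => do
        let w ← g.read ⟨k, a⟩
        let c ← sumOver (elemsWith fun k' => F.par k' = some ⟨k, a⟩) fun k' => acc.2.read k'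
        w.add c
      let value ← sumOver (elems (F.A k)) fun a => do
        let ba ← b.read a
        let ua ← u.read a
        ba.mul ua
      let v ← acc.2.write k value
      let st ← acc.1.read k
      let st' ← (regretMatching (F.A k)).observe st u
      let sts ← acc.1.write k st'
      pure (sts, v))
    (fun l y => (∀ k ∈ l, Vec.toFn y.2 k = F.cfValue b g.toFn k) ∧
      (∀ k ∈ l, ∀ a, Vec.toFn (Arr.get y.1 k).1 a = Vec.toFn (Arr.get s.1 k).1 a
        + (F.cfUtility b g.toFn k a - F.cfValue b g.toFn k)) ∧
      ∀ k ∉ l, Arr.get y.1 k = Arr.get s.1 k) (by simp) ?_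
  · exact fun k hk => h.2.1 k (by simpa [ord.mem_subtree] using hk)
  · rintro l₁ k l₂ y hl ⟨h1, h2, h3⟩
    have hk : k ∉ l₁ := not_mem_of_nodup hl (List.nodup_reverse.2 (ord.nodup_subtree j))
    have hj : F.InfoLE j k := ord.mem_subtree.1 (List.mem_reverse.1 (by simp [hl]))
    have hy : Arr.get y.1 k = Arr.get s.1 k := h3 k hk
    have hc : ∀ a k', F.par k' = some ⟨k, a⟩ → k' ∈ l₁ := by
      intro a k' hk'
      have hp := List.pairwise_reverse.2 (ord.pairwise_subtree j)
      have hm : k' ∈ (ord.subtree j).reverse := List.mem_reverse.2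
        (ord.mem_subtree.2 (Or.inr (hj.trans_lt (infoLT_of_par hk'))))
      rw [hl] at hp hm
      rw [List.pairwise_append, List.pairwise_cons] at hp
      simp only [List.mem_append, List.mem_cons] at hm
      rcases hm with hm | rfl | hm
      · exact hm
      · exact absurd (infoLT_of_par hk') (infoLT_irrefl _)
      · exact absurd (infoLT_of_par hk') (hp.2.1.1 k' hm)
    have hu : Vec.toFn (tabulate (elems (F.A k)) fun a => do
        let w ← g.read ⟨k, a⟩
        let c ← sumOver (elemsWith fun k' => F.par k' = some ⟨k, a⟩) fun k' => y.2.read k'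
        w.add c).val = F.cfUtility b g.toFn k := by
      ext a
      simp only [tabulate_val, mem_elems, if_true, Tick.val_bind, Word.val_add, sumOver_val,
        Arr.val_read, Vec.val_get, sum_map_elemsWith, cfUtility]
      congr 1
      refine Finset.sum_congr rfl fun k' _ => ?_
      split_ifs with hk'
      · exact h1 k' (hc a k' hk')
      · rfl
    simp only [Tick.val_bind, Tick.val_pure, Arr.get_write, Arr.val_read, Vec.toFn_write]
    have hv : (sumOver (elems (F.A k)) fun a => do
        let ba ← (Arr.get s.2 k).read a
        let ua ← (tabulate (elems (F.A k)) fun a => do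
          let w ← g.read ⟨k, a⟩
          let c ← sumOver (elemsWith fun k' => F.par k' = some ⟨k, a⟩) fun k' => y.2.read k'
          w.add c).val.read a
        ba.mul ua).val.val = F.cfValue b g.toFn k := by
      simp only [sumOver_val, sum_map_elems, Tick.val_bind, Word.val_mul, Arr.val_read,
        Vec.val_get, hu, (hb k hj).2, cfValue_eq]
    refine ⟨fun k' hk' => ?_, fun k' hk' a => ?_, fun k' hk' => ?_⟩
    · by_cases h : k' = k
      · subst h
        rw [Function.update_self]
        exact hv
      · rw [Function.update_of_ne h]
        exact h1 k' (by simpa [h] using hk')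
    · by_cases h : k' = k
      · subst h
        rw [Function.update_self, regretMatching_observe, hu, hy, (hb k' hj).1, cfValue_eq]
        simp only [mul_comm]
      · rw [Function.update_of_ne h]
        exact h2 k' (by simpa [h] using hk') a
    · have h : k' ≠ k := by
        rintro rfl
        simp at hk'
      rw [Function.update_of_ne h]
      exact h3 k' fun h => hk' (by simp [h])

/-- The work at `k` is proportional to its number of actions plus its number of children. Both
totals are at most `|Σ_*|`, so one backward pass is linear. -/
theorem cfr_observe_cost (s : (cfr ord j).State) (g : Vec F.SeqStar) :
    ((cfr ord j).observe s g).cost ≤ 60 * Fintype.card F.SeqStar + 2 := by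
  have h := forEach_cost (l := (ord.subtree j).reverse)
    (f := fun k (acc : Arr (fun k : F.J => (regretMatching (F.A k)).State) × Vec F.J) => (do
      let b ← Arr.read s.2 k
      let u ← tabulate (elems (F.A k)) fun a => do
        let w ← g.read ⟨k, a⟩
        let c ← sumOver (elemsWith fun k' => F.par k' = some ⟨k, a⟩) fun k' => acc.2.read k'
        w.add c
      let value ← sumOver (elems (F.A k)) fun a => do
        let ba ← b.read a
        let ua ← u.read a
        ba.mul ua
      let v ← acc.2.write k value
      let st ← acc.1.read k
      let st' ← (regretMatching (F.A k)).observe st u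
      let sts ← acc.1.write k st'
      pure (sts, v) : Tick (Arr (fun k : F.J => (regretMatching (F.A k)).State) × Vec F.J)))
    (fun k => 40 * Fintype.card (F.A k)
      + 3 * ∑ a : F.A k, (elemsWith fun k' => F.par k' = some ⟨k, a⟩).length)
    (s.1, (Vec.zeros F.J).val) ?_
  · have h4 := sum_map_le_of_nodup (List.nodup_reverse.2 (ord.nodup_subtree j))
      fun k => 40 * Fintype.card (F.A k)
      + 3 * ∑ a : F.A k, (elemsWith fun k' => F.par k' = some ⟨k, a⟩).length + 1
    rw [Finset.sum_add_distrib, Finset.sum_add_distrib, ← Finset.mul_sum, ← Finset.mul_sum,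
      sum_card_A, Finset.sum_const, Finset.card_univ, smul_eq_mul, mul_one] at h4
    have h5 := card_J_le (F := F)
    have h6 := sum_length_children_le (F := F)
    change (Fintype.card F.J + 1) + (_ + 0) ≤ _
    omega
  · intro k y
    simp only [Tick.cost_bind, Tick.cost_pure, Arr.cost_write, Arr.cost_read, Arr.val_read]
    have c1 := tabulate_cost_le_sum (f := fun a => (do
        let w ← g.read ⟨k, a⟩
        let c ← sumOver (elemsWith fun k' => F.par k' = some ⟨k, a⟩) fun k' => y.2.read k'
        w.add c : Tick Word))
      (fun a => 3 * (elemsWith fun k' => F.par k' = some ⟨k, a⟩).length + 4) (elems (F.A k)) (by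
        intro a
        have := sumOver_cost (f := fun k' => y.2.read k') 1
          (elemsWith fun k' => F.par k' = some ⟨k, a⟩) fun _ => le_rfl
        simp only [Tick.cost_bind, Arr.cost_read, Word.cost_add]
        omega)
    rw [sum_map_elems, Finset.sum_add_distrib, Finset.sum_add_distrib, ← Finset.mul_sum] at c1
    simp only [Finset.sum_const, Finset.card_univ, smul_eq_mul] at c1
    generalize hu : (tabulate (elems (F.A k)) fun a => (do
        let w ← g.read ⟨k, a⟩
        let c ← sumOver (elemsWith fun k' => F.par k' = some ⟨k, a⟩) fun k' => y.2.read k'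
        w.add c : Tick Word)) = u at *
    have c2 := sumOver_cost (f := fun a => (do
        let ba ← (Arr.get s.2 k).read a
        let ua ← u.val.read a
        ba.mul ua : Tick Word)) 3 (elems (F.A k)) (fun _ => le_rfl)
    rw [length_elems] at c2
    have c3 := regretMatching_observe_cost (Arr.get y.1 k) u.val
    have c4 : 1 ≤ Fintype.card (F.A k) := Fintype.card_pos
    omega

end cfr

/-! ### Utilities of triggers and values of deviations -/

theorem length_seqsFrom_le (j : F.J) : (F.seqsFrom j).length ≤ Fintype.card F.SeqStar :=
  length_elemsWith_le _

theorem triggerAlg_observe_cost {s : F.SeqStar} {R : OnlineAlg (Vec F.SeqStar) (Vec F.SeqStar)}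
    {c : ℕ} (st : R.State) (hR : ∀ g, (R.observe st g).cost ≤ c) (Λ : Vec (F.Seq × F.Seq)) :
    ((triggerAlg s R).observe st Λ).cost ≤ 4 * Fintype.card F.SeqStar + 2 + c := by
  have h1 := tabulate_cost (f := fun r => Λ.read (some r, some s)) 1 (F.seqsFrom s.1)
    fun _ => le_rfl
  have h2 := length_seqsFrom_le s.1
  have h3 := hR (tabulate (F.seqsFrom s.1) fun r => Λ.read (some r, some s)).val
  exact (Nat.add_le_add h1 h3).trans (by omega)

open Classical in
theorem evalDeviation_val (Λ : Vec (F.Seq × F.Seq)) (s : F.SeqStar) (q : Vec F.SeqStar) :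
    (evalDeviation Λ s q).val.val
      = (∑ c : F.Seq, if ¬ F.SeqLE (some s) c then Λ.toFn (c, c) else 0)
        + ∑ r : F.SeqStar, if F.InfoLE s.1 r.1 then Λ.toFn (some r, some s) * q.toFn r else 0 := by
  simp only [evalDeviation, seqsFrom, Tick.val_bind, Word.val_add, sumOver_val, Arr.val_read,
    Word.val_mul, Vec.val_get, sum_map_elemsWith]

theorem evalDeviation_cost (Λ : Vec (F.Seq × F.Seq)) (s : F.SeqStar) (q : Vec F.SeqStar) :
    (evalDeviation Λ s q).cost ≤ 8 * Fintype.card F.Seq + 5 := by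
  have h1 := sumOver_cost (f := fun c => Λ.read (c, c)) 1
    (elemsWith fun c : F.Seq => ¬ F.SeqLE (some s) c) fun _ => le_rfl
  have h2 := length_elemsWith_le fun c : F.Seq => ¬ F.SeqLE (some s) c
  have h3 := sumOver_cost (f := fun r => (do
      let l ← Λ.read (some r, some s)
      let y ← q.read r
      l.mul y : Tick Word)) 3 (F.seqsFrom s.1) fun _ => le_rfl
  have h4 := length_seqsFrom_le s.1
  have h5 : Fintype.card F.Seq = Fintype.card F.SeqStar + 1 := Fintype.card_option
  simp only [evalDeviation, Tick.cost_bind, Word.cost_add] at *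
  omega

/-! ## Regret minimization for the convex hull -/

section hullAlg

variable {RΔ : OnlineAlg (Vec F.SeqStar) (Vec F.SeqStar)}
  {R : F.SeqStar → OnlineAlg (Vec (F.Seq × F.Seq)) (Vec F.SeqStar)}

theorem hullAlg_next_spec (st : (hullAlg RΔ R).State) :
    ((hullAlg RΔ R).next st).val.1.1 = (RΔ.next st.1.1).val.1 ∧
    ((hullAlg RΔ R).next st).val.2.1.1 = (RΔ.next st.1.1).val.2 ∧
    ((hullAlg RΔ R).next st).val.2.2 = ((hullAlg RΔ R).next st).val.1.2 ∧
    ∀ s, Arr.get ((hullAlg RΔ R).next st).val.1.2 s = ((R s).next (Arr.get st.1.2 s)).val.1 ∧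
      Arr.get ((hullAlg RΔ R).next st).val.2.1.2 s = ((R s).next (Arr.get st.1.2 s)).val.2 := by
  refine ⟨rfl, rfl, rfl, ?_⟩
  have := forEach_val (l := elems F.SeqStar) (x := (st.1.2, st.2))
    (f := fun s acc => do
      let sub ← acc.1.read s
      let p ← (R s).next sub
      let subs ← acc.1.write s p.2
      let qs ← acc.2.write s p.1
      pure (subs, qs))
    (fun l y => (∀ s ∈ l, Arr.get y.2 s = ((R s).next (Arr.get st.1.2 s)).val.1 ∧
      Arr.get y.1 s = ((R s).next (Arr.get st.1.2 s)).val.2) ∧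
      ∀ s ∉ l, Arr.get y.1 s = Arr.get st.1.2 s) (by simp) ?_
  · exact fun s => this.1 s (mem_elems s)
  · rintro l₁ k l₂ y hl ⟨h1, h2⟩
    have hk : k ∉ l₁ := not_mem_of_nodup hl nodup_elems
    simp only [Tick.val_bind, Tick.val_pure, Arr.get_write, Arr.val_read]
    refine ⟨fun s hs => ?_, fun s hs => ?_⟩
    · by_cases h : s = k
      · subst h
        simp [h2 s hk]
      · simp only [Function.update_of_ne h]
        exact h1 s (by simpa [h] using hs)
    · have h : s ≠ k := by
        rintro rfl
        simp at hs
      rw [Function.update_of_ne h]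
      exact h2 s fun h => hs (by simp [h])

theorem hullAlg_next_cost {c c' : ℕ} (st : (hullAlg RΔ R).State)
    (hΔ : ∀ x, (RΔ.next x).cost ≤ c) (hR : ∀ s x, ((R s).next x).cost ≤ c') :
    ((hullAlg RΔ R).next st).cost ≤ c + Fintype.card F.SeqStar * (c' + 4) + 1 := by
  have := forEach_cost (l := elems F.SeqStar)
    (f := fun s (acc : Arr (fun s => (R s).State) × Arr fun _ : F.SeqStar => Vec F.SeqStar) => (do
      let sub ← acc.1.read s
      let p ← (R s).next sub
      let subs ← acc.1.write s p.2
      let qs ← acc.2.write s p.1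
      pure (subs, qs) : Tick (Arr (fun s => (R s).State) × Arr fun _ : F.SeqStar => Vec F.SeqStar)))
    (fun _ => c' + 3) (st.1.2, st.2) (fun s y => by
      have := hR s (y.1.get s)
      simp only [Tick.cost_bind, Tick.cost_pure, Arr.cost_write, Arr.cost_read, Arr.val_read]
      omega)
  simp only [List.map_const', List.sum_replicate, smul_eq_mul, length_elems] at this
  have h2 := hΔ st.1.1
  change _ + (_ + 0) ≤ _
  exact (Nat.add_le_add h2 this).trans (le_of_eq (by ring))

theorem hullAlg_observe_spec (st : (hullAlg RΔ R).State) (Λ : Vec (F.Seq × F.Seq)) :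
    (∃ u : Vec F.SeqStar, (∀ s, u.toFn s = (evalDeviation Λ s (Arr.get st.2 s)).val.val) ∧
      ((hullAlg RΔ R).observe st Λ).val.1.1 = (RΔ.observe st.1.1 u).val) ∧
    ∀ s, Arr.get ((hullAlg RΔ R).observe st Λ).val.1.2 s
      = ((R s).observe (Arr.get st.1.2 s) Λ).val := by
  refine ⟨⟨_, fun s => ?_, rfl⟩, fun s => ?_⟩
  · rw [tabulate_val, if_pos (mem_elems s)]
    rfl
  · exact forEach_replace (w := fun s x => ((R s).observe x Λ).val)
      (f := fun s acc => do
        let sub ← acc.read s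
        let sub' ← (R s).observe sub Λ
        acc.write s sub') (fun s x => rfl) st.1.2 s

theorem hullAlg_observe_cost {c c' : ℕ} (st : (hullAlg RΔ R).State) (Λ : Vec (F.Seq × F.Seq))
    (hΔ : ∀ x u, (RΔ.observe x u).cost ≤ c) (hR : ∀ s x, ((R s).observe x Λ).cost ≤ c') :
    ((hullAlg RΔ R).observe st Λ).cost
      ≤ c + Fintype.card F.SeqStar * (c' + 8 * Fintype.card F.Seq + 12) + 3 := by
  have h1 := forEach_cost (l := elems F.SeqStar)
    (f := fun s (acc : Arr fun s => (R s).State) => (do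
        let sub ← acc.read s
        let sub' ← (R s).observe sub Λ
        acc.write s sub' : Tick (Arr fun s => (R s).State)))
    (fun _ => c' + 2) st.1.2 (fun s y => by
      have := hR s (y.get s)
      simp only [Tick.cost_bind, Arr.cost_write, Arr.cost_read, Arr.val_read]
      omega)
  have h2 := tabulate_cost (f := fun s => (do
      let q ← st.2.read s
      evalDeviation Λ s q : Tick Word)) (8 * Fintype.card F.Seq + 6) (elems F.SeqStar) (fun s => by
      have := evalDeviation_cost Λ s (Arr.get st.2 s)
      simp only [Tick.cost_bind, Arr.cost_read, Arr.val_read]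
      omega)
  have h3 := hΔ st.1.1 (tabulate (elems F.SeqStar) fun s => (do
      let q ← st.2.read s
      evalDeviation Λ s q : Tick Word)).val
  simp only [List.map_const', List.sum_replicate, smul_eq_mul, length_elems] at h1 h2
  change _ + (_ + (_ + 0)) ≤ _
  refine (Nat.add_le_add h1 (Nat.add_le_add h2 h3)).trans (le_of_eq (by ring))

end hullAlg

end InfoForest

/-! ## Fixed points of mixed deviations -/

namespace InfoForest

variable {F : InfoForest}

namespace MixedDeviation

/-- The continuation strategy for the trigger `s`. -/
def continuation (φ : F.MixedDeviation) (s : F.SeqStar) (r : F.Seq) : ℝ :=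
  r.elim 0 (φ.2.get s).toFn

/-- The weights form a probability vector, and the continuations are strategies. -/
structure IsProper (φ : F.MixedDeviation) : Prop where
  nonneg : ∀ s, 0 ≤ φ.1.toFn s
  sum_eq_one : ∑ s, φ.1.toFn s = 1
  continuation : ∀ s, F.IsSubStrategy s.1 (φ.continuation s)

variable {φ : F.MixedDeviation}

theorem toMap_eq (φ : F.MixedDeviation) :
    φ.toMap = ∑ s : F.SeqStar, φ.1.toFn s • F.devMap s fun r => φ.continuation s r.1 := by
  refine Finset.sum_congr rfl fun s _ => congrArg _ (congrArg _ (funext fun r => ?_))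
  unfold continuation
  cases r.1 <;> rfl

open Classical in
-- The identity part of `φ_s` survives at `r` unless `s ⪯ r`; as the weights sum to 1, the total
-- surviving weight is one minus the weight of the triggers `⪯ r`.
theorem toMap_apply (hφ : φ.IsProper) (x : F.Seq → ℝ) (r : F.Seq) :
    φ.toMap x r = (∑ s, if F.SeqGE r s.1 then
        φ.1.toFn s * φ.continuation s r * x (some s) else 0)
      + (1 - ∑ s, if F.SeqLE (some s) r then φ.1.toFn s else 0) * x r := by
  have h1 : (1 : ℝ) - ∑ s, (if F.SeqLE (some s) r then φ.1.toFn s else 0)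
      = ∑ s, if F.SeqLE (some s) r then 0 else φ.1.toFn s := by
    rw [← hφ.sum_eq_one, ← Finset.sum_sub_distrib]
    refine Finset.sum_congr rfl fun s _ => ?_
    split_ifs <;> simp
  rw [h1, toMap_eq]
  simp only [LinearMap.sum_apply, LinearMap.smul_apply, Finset.sum_apply, Pi.smul_apply,
    smul_eq_mul, devMap_apply, Finset.sum_mul, ← Finset.sum_add_distrib]
  refine Finset.sum_congr rfl fun s _ => ?_
  split_ifs <;> ring

theorem toMap_none (hφ : φ.IsProper) (x : F.Seq → ℝ) : φ.toMap x none = x none := by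
  classical
  rw [toMap_apply hφ]
  simp [not_seqLE_none]

/-- The image at `t` depends only on entries at `t.1` and its ancestors. This lets fixed point
equations already established survive the later writes. -/
theorem toMap_congr (hφ : φ.IsProper) {x x' : F.Seq → ℝ} {t : F.SeqStar}
    (h : ∀ s : F.SeqStar, F.InfoLE s.1 t.1 → x (some s) = x' (some s)) :
    φ.toMap x (some t) = φ.toMap x' (some t) := by
  classical
  rw [toMap_apply hφ, toMap_apply hφ, h t (InfoLE.refl _)]
  congr 1
  refine Finset.sum_congr rfl fun s _ => ?_
  split_ifs with hs
  · rw [h s (seqGE_some.1 hs)]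
  · rfl

open Classical in
/-- The mass that deviations triggered strictly above `k` send to the action `a` at `k`. -/
def upperInflow (φ : F.MixedDeviation) (x : F.Seq → ℝ) (k : F.J) (a : F.A k) : ℝ :=
  ∑ s, if F.SeqGE (F.par k) s.1 then φ.1.toFn s * (φ.2.get s).toFn ⟨k, a⟩ * x (some s) else 0

open Classical in
/-- The probability that no deviation is triggered on the path to a sequence. -/
def untriggered (φ : F.MixedDeviation) (r : F.Seq) : ℝ :=
  1 - ∑ s, if F.SeqLE (some s) r then φ.1.toFn s else 0

/-- The matrix `W` of the extension of a partial fixed point. -/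
def extensionMatrix (φ : F.MixedDeviation) (x : F.Seq → ℝ) (k : F.J) (a c : F.A k) : ℝ :=
  φ.upperInflow x k a + (φ.1.toFn ⟨k, c⟩ * (φ.2.get ⟨k, c⟩).toFn ⟨k, a⟩
    + if a = c then φ.untriggered (some ⟨k, c⟩) else 0) * x (F.par k)

theorem untriggered_nonneg (hφ : φ.IsProper) (r : F.Seq) : 0 ≤ φ.untriggered r := by
  classical
  rw [untriggered, sub_nonneg, ← hφ.sum_eq_one]
  refine Finset.sum_le_sum fun s _ => ?_
  split_ifs
  · exact le_rfl
  · exact hφ.nonneg s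

/-- Only `t` itself precedes `t` without preceding its parent. -/
theorem untriggered_some (φ : F.MixedDeviation) (t : F.SeqStar) :
    φ.untriggered (some t) = φ.untriggered (F.par t.1) - φ.1.toFn t := by
  classical
  have : φ.1.toFn t = ∑ s, if s = t then φ.1.toFn s else 0 := by simp
  rw [untriggered, untriggered, this, sub_sub, ← Finset.sum_add_distrib]
  congr 1
  refine Finset.sum_congr rfl fun s _ => ?_
  rw [seqLE_some_iff]
  by_cases h : s = t
  · subst h
    have : ¬ F.SeqLE (some s) (F.par s.1) := fun h => infoLT_irrefl s.1 ⟨s.2, h⟩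
    simp [this]
  · simp [h]

theorem upperInflow_congr {x x' : F.Seq → ℝ} {k : F.J}
    (h : ∀ s : F.SeqStar, F.InfoLT s.1 k → x (some s) = x' (some s)) (a : F.A k) :
    φ.upperInflow x k a = φ.upperInflow x' k a := by
  refine Finset.sum_congr rfl fun s _ => ?_
  split_ifs with hs
  · rw [h s (seqGE_par.1 hs)]
  · rfl

/-- The triggers whose continuations reach `(k, a)` lie strictly above `k` or at `k`. The split
separates the part known from the trunk from the part linear in the unknown values at `k`. -/
theorem toMap_some (hφ : φ.IsProper) (x : F.Seq → ℝ) (k : F.J) (a : F.A k) :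
    φ.toMap x (some ⟨k, a⟩) = φ.upperInflow x k a
      + (∑ c, φ.1.toFn ⟨k, c⟩ * (φ.2.get ⟨k, c⟩).toFn ⟨k, a⟩ * x (some ⟨k, c⟩))
      + φ.untriggered (some ⟨k, a⟩) * x (some ⟨k, a⟩) := by
  classical
  rw [toMap_apply hφ, ← untriggered]
  congr 1
  have h1 : ∑ c, φ.1.toFn ⟨k, c⟩ * (φ.2.get ⟨k, c⟩).toFn ⟨k, a⟩ * x (some ⟨k, c⟩)
      = ∑ s : F.SeqStar, if s.1 = k then
        φ.1.toFn s * (φ.2.get s).toFn ⟨k, a⟩ * x (some s) else 0 := by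
    rw [Fintype.sum_sigma, Finset.sum_eq_single k]
    · simp
    · intro l _ hl
      simp [hl]
    · simp
  rw [h1, upperInflow, ← Finset.sum_add_distrib]
  refine Finset.sum_congr rfl fun s _ => ?_
  rw [seqGE_par, seqGE_some]
  by_cases hs : s.1 = k
  · have h2 : ¬ F.InfoLT s.1 k := hs ▸ infoLT_irrefl _
    rw [if_pos (show F.InfoLE s.1 k from Or.inl hs), if_neg h2, if_pos hs, zero_add]
    rfl
  · have h2 : F.InfoLE s.1 k ↔ F.InfoLT s.1 k := or_iff_right hs
    simp only [h2, if_neg hs, add_zero]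
    rfl

variable {x : F.Seq → ℝ} {k : F.J}

theorem upperInflow_nonneg (hφ : φ.IsProper) (hx : ∀ s, 0 ≤ x s) (a : F.A k) :
    0 ≤ φ.upperInflow x k a := by
  refine Finset.sum_nonneg fun s _ => ?_
  split_ifs with hs
  · exact mul_nonneg (mul_nonneg (hφ.nonneg s) ((hφ.continuation s).nonneg (some ⟨k, a⟩)
      (SeqGE.of_le (Or.inr (seqGE_par.1 hs)) a))) (hx _)
  · exact le_rfl

/-- Each continuation passes its mass at the parent sequence on to the actions at `k`. The fixed
point equation at the parent says how much mass arrives there through triggered deviations: all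
except the untriggered share. -/
theorem sum_upperInflow (hφ : φ.IsProper) (hp : φ.toMap x (F.par k) = x (F.par k)) :
    ∑ a, φ.upperInflow x k a = (1 - φ.untriggered (F.par k)) * x (F.par k) := by
  classical
  rw [toMap_apply hφ, ← untriggered] at hp
  have : ∑ a, φ.upperInflow x k a = ∑ s, if F.SeqGE (F.par k) s.1 then
      φ.1.toFn s * φ.continuation s (F.par k) * x (some s) else 0 := by
    simp only [upperInflow]
    rw [Finset.sum_comm]
    refine Finset.sum_congr rfl fun s _ => ?_
    split_ifs with hs
    · rw [(hφ.continuation s).flow k (seqGE_par.1 hs), Finset.mul_sum, Finset.sum_mul]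
      rfl
    · simp
  rw [this]
  linarith

/-- With `u` for `untriggered` and `x_p` for the parent's mass, column `c` of `W` sums to `(1 -
u(σ_p)) x_p + (λ(k, c) + u(k, c)) x_p`, and the second bracket is `u(σ_p)`. -/
theorem isColStochastic_extensionMatrix (hφ : φ.IsProper) (hx : ∀ s, 0 ≤ x s)
    (hp : φ.toMap x (F.par k) = x (F.par k)) (h0 : x (F.par k) ≠ 0) :
    IsColStochastic fun a c => φ.extensionMatrix x k a c / x (F.par k) := by
  refine ⟨fun a c => div_nonneg (add_nonneg (upperInflow_nonneg hφ hx a)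
    (mul_nonneg (add_nonneg (mul_nonneg (hφ.nonneg _) ?_) ?_) (hx _))) (hx _), fun c => ?_⟩
  · exact (hφ.continuation ⟨k, c⟩).nonneg (some ⟨k, a⟩) (SeqGE.of_le (InfoLE.refl k) a)
  · split_ifs
    · exact untriggered_nonneg hφ _
    · exact le_rfl
  · have h1 : ∑ a, (φ.2.get ⟨k, c⟩).toFn ⟨k, a⟩ = 1 := (hφ.continuation ⟨k, c⟩).root
    rw [← Finset.sum_div, div_eq_one_iff_eq h0]
    simp only [extensionMatrix, Finset.sum_add_distrib, ← Finset.sum_mul, ← Finset.mul_sum, h1,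
      Finset.sum_ite_eq', Finset.mem_univ, if_true, sum_upperInflow hφ hp, untriggered_some]
    ring

/-- The values that `extend` assigns to the actions at `k` extend the fixed point. -/
theorem toMap_extension (hφ : φ.IsProper) (hx : ∀ s, 0 ≤ x s)
    (hp : φ.toMap x (F.par k) = x (F.par k)) {b : F.A k → ℝ} (hb1 : ∑ a, b a = 1)
    (hb : x (F.par k) ≠ 0 →
      Matrix.mulVec (fun a c => φ.extensionMatrix x k a c / x (F.par k)) b = b)
    {x' : F.Seq → ℝ} (hx' : ∀ a, x' (some ⟨k, a⟩) = x (F.par k) * b a)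
    (hlt : ∀ s : F.SeqStar, F.InfoLT s.1 k → x' (some s) = x (some s)) (a : F.A k) :
    φ.toMap x' (some ⟨k, a⟩) = x' (some ⟨k, a⟩) := by
  rw [toMap_some hφ, upperInflow_congr hlt]
  simp only [hx']
  -- If no mass reaches `k`, the inflows from above are nonnegative with sum zero, so each of them
  -- vanishes and zero is a solution.
  by_cases h0 : x (F.par k) = 0
  · have h1 : φ.upperInflow x k a ≤ ∑ a, φ.upperInflow x k a :=
      Finset.single_le_sum (f := fun a => φ.upperInflow x k a)
        (fun a _ => upperInflow_nonneg hφ hx a) (Finset.mem_univ a)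
    rw [sum_upperInflow hφ hp, h0, mul_zero] at h1
    simp [h0, le_antisymm h1 (upperInflow_nonneg hφ hx a)]
  · have h1 := congrFun (hb h0) a
    simp only [Matrix.mulVec, dotProduct, div_mul_eq_mul_div, ← Finset.sum_div] at h1
    rw [div_eq_iff h0] at h1
    rw [mul_comm] at h1
    refine Eq.trans ?_ h1
    -- The inflow from above is constant along each row of `W`, so `∑ b = 1` turns its contribution
    -- to `W b` into the inflow itself.
    simp only [extensionMatrix, add_mul, ite_mul, zero_mul, Finset.sum_add_distrib,
      ← Finset.mul_sum, hb1, Finset.sum_ite_eq, Finset.mem_univ, if_true, mul_one]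
    rw [add_assoc]
    refine congrArg₂ (· + ·) rfl
      (congrArg₂ (· + ·) (Finset.sum_congr rfl fun c _ => ?_) ?_) <;> ring

end MixedDeviation

/-! ### The extension program: values and running time -/

section extend

variable (φ : F.MixedDeviation) (k : F.J) (x : Vec F.Seq)

/-- The program for `MixedDeviation.upperInflow`. -/
def upperInflowVec : Tick (Vec (F.A k)) :=
  tabulate (elems (F.A k)) fun a =>
    sumOver (elemsWith fun s : F.SeqStar => F.SeqGE (F.par k) s.1) fun s => do
      let l ← φ.1.read s
      let q ← φ.2.read s
      let y ← q.read ⟨k, a⟩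
      let z ← x.read (some s)
      let ly ← l.mul y
      ly.mul z

/-- The program for `MixedDeviation.untriggered`. -/
def untriggeredVec : Tick (Vec (F.A k)) :=
  tabulate (elems (F.A k)) fun a => do
    let one ← Word.ofNat 1
    let m ← sumOver (elemsWith fun s : F.SeqStar => F.SeqLE (some s) (some ⟨k, a⟩)) fun s =>
      φ.1.read s
    one.sub m

/-- The program for `MixedDeviation.extensionMatrix`. -/
def extensionMatrixVec (xp : Word) (r d : Vec (F.A k)) : Tick (Vec (F.A k × F.A k)) :=
  tabulate (elems (F.A k × F.A k)) fun p => do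
    let l ← φ.1.read ⟨k, p.2⟩
    let q ← φ.2.read ⟨k, p.2⟩
    let y ← q.read ⟨k, p.1⟩
    let ly ← l.mul y
    let diagonal ← sameIndex p.1 p.2
    let e ← if diagonal then do
        let da ← d.read p.2
        ly.add da
      else pure ly
    let ex ← e.mul xp
    let ra ← r.read p.1
    ra.add ex

/-- The program that scales a matrix by the inverse of a number. -/
def divVec (W : Vec (F.A k × F.A k)) (xp : Word) : Tick (Vec (F.A k × F.A k)) :=
  tabulate (elems (F.A k × F.A k)) fun p => do
    let c ← W.read p
    c.div xp

/-- The program that scales a vector by a number. -/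
def mulVec (xp : Word) (b : Vec (F.A k)) : Tick (Vec (F.A k)) :=
  tabulate (elems (F.A k)) fun a => do
    let ba ← b.read a
    xp.mul ba

/-- The program that stores the values of the actions at `k`. -/
def storeActions (w : Vec (F.A k)) : Tick (Vec F.Seq) :=
  forEach (elems (F.A k)) x fun a x' => do
    let wa ← w.read a
    x'.write (some ⟨k, a⟩) wa

/-- Naming the stages allows their values and costs to be treated one at a time. -/
theorem extend_eq (O : FixedPointOracle) : extend O φ k x = (do
    let xp ← x.read (F.par k)
    let r ← upperInflowVec φ k x
    let d ← untriggeredVec φ k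
    let W ← extensionMatrixVec φ k xp r d
    let unreached ← xp.isZero
    if unreached then do
      let w ← Vec.zeros (F.A k)
      storeActions k x w
    else do
      let P ← divVec k W xp
      let b ← O.call (F.A k) P
      let w ← mulVec k xp b
      storeActions k x w) := rfl

variable {φ k x}

theorem storeActions_val (w : Vec (F.A k)) :
    (∀ a, (storeActions k x w).val.toFn (some ⟨k, a⟩) = w.toFn a) ∧
      ∀ m, (∀ a, m ≠ some ⟨k, a⟩) → (storeActions k x w).val.toFn m = x.toFn m :=
  forEach_update (e := fun a : F.A k => (some ⟨k, a⟩ : F.Seq))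
    ((Option.some_injective _).comp sigma_mk_injective) _
    (fun a y => by simp only [Tick.val_bind, Vec.toFn_write, Arr.val_read, Vec.val_get]) x

theorem extensionMatrixVec_val {xp : Word} (p : F.A k × F.A k)
    (hxp : xp.val = x.toFn (F.par k)) :
    (extensionMatrixVec φ k xp (upperInflowVec φ k x).val (untriggeredVec φ k).val).val.toFn p
      = φ.extensionMatrix x.toFn k p.1 p.2 := by
  classical
  have h1 : ∀ a, (upperInflowVec φ k x).val.toFn a = φ.upperInflow x.toFn k a := fun a => by
    simp only [upperInflowVec, tabulate_val, mem_elems, if_true, sumOver_val, sum_map_elemsWith,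
      Tick.val_bind, Word.val_mul, Arr.val_read, Vec.val_get, MixedDeviation.upperInflow]
  have h2 : ∀ a, (untriggeredVec φ k).val.toFn a = φ.untriggered (some ⟨k, a⟩) := fun a => by
    simp only [untriggeredVec, tabulate_val, mem_elems, if_true, sumOver_val, sum_map_elemsWith,
      Tick.val_bind, Word.val_sub, Word.val_ofNat, Nat.cast_one, Arr.val_read, Vec.val_get,
      MixedDeviation.untriggered]
  simp only [extensionMatrixVec, tabulate_val, mem_elems, if_true, Tick.val_bind, val_sameIndex,
    MixedDeviation.extensionMatrix]
  split_ifs with h <;> simp [Vec.val_get, h1, h2, hxp]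

theorem extend_val (O : FixedPointOracle) (φ : F.MixedDeviation) (k : F.J) (x : Vec F.Seq) :
    (∀ a, (extend O φ k x).val.toFn (some ⟨k, a⟩) = if x.toFn (F.par k) = 0 then 0 else
      x.toFn (F.par k) * O.solve (F.A k)
        (fun a c => φ.extensionMatrix x.toFn k a c / x.toFn (F.par k)) a) ∧
    ∀ m, (∀ a, m ≠ some ⟨k, a⟩) → (extend O φ k x).val.toFn m = x.toFn m := by
  rw [extend_eq]
  simp only [Tick.val_bind, Word.val_isZero, Arr.val_read, Vec.val_get]
  split_ifs with h
  · refine ⟨fun a => ?_, (storeActions_val _).2⟩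
    simp [Tick.val_bind, (storeActions_val _).1]
  · refine ⟨fun a => ?_, (storeActions_val _).2⟩
    simp only [Tick.val_bind, (storeActions_val _).1, mulVec, divVec, tabulate_val, mem_elems,
      if_true, Word.val_mul, Arr.val_read, Vec.val_get, FixedPointOracle.call, Vec.toFn_ofFn,
      Word.val_div, extensionMatrixVec_val (xp := x.get (F.par k)) _ rfl]

/-- The inflows and the untriggered weights need `|A(k)|` sums of at most `|Σ|` terms each; the
matrix has `|A(k)|² ≤ |A(k)| |Σ|` entries. The oracle is called only if the parent has mass, so its
time is assumed bounded only then. -/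
theorem extend_cost (O : FixedPointOracle) (φ : F.MixedDeviation) (k : F.J) (x : Vec F.Seq)
    {τ : ℕ} (hτ : x.toFn (F.par k) ≠ 0 → O.time (F.A k)
      (fun a c => φ.extensionMatrix x.toFn k a c / x.toFn (F.par k)) ≤ τ) :
    (extend O φ k x).cost ≤ 100 * (Fintype.card (F.A k) * Fintype.card F.Seq) + τ := by
  set m := Fintype.card (F.A k) with hm
  set S := Fintype.card F.Seq with hS
  have hN : Fintype.card F.SeqStar ≤ S := by
    rw [hS, Fintype.card_option]
    omega
  have hm1 : 1 ≤ m := Fintype.card_pos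
  have hmS : m ≤ S := by
    refine le_trans ?_ hN
    rw [← sum_card_A]
    exact Finset.single_le_sum (f := fun k => Fintype.card (F.A k)) (fun _ _ => Nat.zero_le _)
      (Finset.mem_univ k)
  have c1 : (upperInflowVec φ k x).cost ≤ m + (8 * S + 4) * m + 2 := by
    have := tabulate_cost (ι := F.A k) (f := fun a =>
      sumOver (elemsWith fun s : F.SeqStar => F.SeqGE (F.par k) s.1) fun s => do
        let l ← φ.1.read s
        let q ← φ.2.read s
        let y ← q.read ⟨k, a⟩
        let z ← x.read (some s)
        let ly ← l.mul y
        ly.mul z) (8 * S + 2) (elems (F.A k)) fun a => by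
          refine (sumOver_cost 6 _ fun _ => le_rfl).trans ?_
          have := length_elemsWith_le fun s : F.SeqStar => F.SeqGE (F.par k) s.1
          omega
    rwa [length_elems] at this
  have c2 : (untriggeredVec φ k).cost ≤ m + (3 * S + 6) * m + 2 := by
    have := tabulate_cost (ι := F.A k) (f := fun a => (do
      let one ← Word.ofNat 1
      let m ← sumOver (elemsWith fun s : F.SeqStar => F.SeqLE (some s) (some ⟨k, a⟩)) fun s =>
        φ.1.read s
      one.sub m : Tick Word)) (3 * S + 4) (elems (F.A k)) fun a => by
          have h1 := sumOver_cost (f := fun s => φ.1.read s) 1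
            (elemsWith fun s : F.SeqStar => F.SeqLE (some s) (some ⟨k, a⟩)) fun _ => le_rfl
          have h2 := length_elemsWith_le fun s : F.SeqStar => F.SeqLE (some s) (some ⟨k, a⟩)
          simp only [Tick.cost_bind, Word.cost_ofNat, Word.cost_sub]
          omega
    rwa [length_elems] at this
  have c3 : ∀ xp r d, (extensionMatrixVec φ k xp r d).cost ≤ m * m + 12 * (m * m) + 2 := by
    intro xp r d
    refine (tabulate_cost (ι := F.A k × F.A k) 10 _ fun p => ?_).trans ?_
    · simp only [Tick.cost_bind, Arr.cost_read, Word.cost_mul, cost_sameIndex]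
      split_ifs <;> simp
    · rw [length_elems, Fintype.card_prod]
  have c4 : ∀ W xp, (divVec k W xp).cost ≤ m * m + 4 * (m * m) + 2 := by
    intro W xp
    refine (tabulate_cost (ι := F.A k × F.A k) 2 _ fun p => le_rfl).trans ?_
    rw [length_elems, Fintype.card_prod]
  have c5 : ∀ xp b, (mulVec k xp b).cost ≤ m + 4 * m + 2 := by
    intro xp b
    refine (tabulate_cost (ι := F.A k) 2 _ fun p => le_rfl).trans ?_
    rw [length_elems]
  have c6 : ∀ w, (storeActions k x w).cost ≤ 3 * m + 1 := by
    intro w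
    have := forEach_cost (l := elems (F.A k)) (f := fun a (x' : Vec F.Seq) => (do
      let wa ← w.read a
      x'.write (some ⟨k, a⟩) wa : Tick (Vec F.Seq))) (fun _ => 2) x fun _ _ => le_rfl
    simp only [List.map_const', List.sum_replicate, smul_eq_mul, length_elems] at this
    rw [mul_comm] at this
    exact this
  have h1 : m * m ≤ m * S := Nat.mul_le_mul_left m hmS
  have h2 : m ≤ m * S := Nat.le_mul_of_pos_right m (hm1.trans hmS)
  have h3 : (8 * S + 4) * m = 8 * (m * S) + 4 * m := by ring
  have h4 : (3 * S + 6) * m = 3 * (m * S) + 6 * m := by ring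
  rw [h3] at c1
  rw [h4] at c2
  rw [extend_eq]
  simp only [Tick.cost_bind, Word.val_isZero, Word.cost_isZero, Arr.cost_read, Arr.val_read,
    Vec.val_get]
  have c3 := c3 (x.get (F.par k)) (upperInflowVec φ k x).val (untriggeredVec φ k).val
  have hW := fun p => extensionMatrixVec_val (φ := φ) (x := x) (xp := x.get (F.par k)) p rfl
  generalize (extensionMatrixVec φ k (x.get (F.par k)) (upperInflowVec φ k x).val
    (untriggeredVec φ k).val) = W at *
  split_ifs with h
  · have c6 := c6 (Vec.zeros (F.A k)).val
    simp only [Tick.cost_bind, Vec.cost_zeros]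
    omega
  · have c4 := c4 W.val (x.get (F.par k))
    -- The oracle receives exactly the matrix to which `hτ` refers.
    have hP : (O.call (F.A k) (divVec k W.val (x.get (F.par k))).val).cost ≤ τ + 1 := by
      refine Nat.add_le_add_right (le_trans (le_of_eq ?_) (hτ h)) 1
      congr 1
      ext a c
      simp only [divVec, tabulate_val, mem_elems, if_true, Tick.val_bind, Word.val_div,
        Arr.val_read, Vec.val_get, hW]
    simp only [Tick.cost_bind]
    generalize O.call (F.A k) (divVec k W.val (x.get (F.par k))).val = b at *
    have c5 := c5 (x.get (F.par k)) b.val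
    have c6 := c6 (mulVec k (x.get (F.par k)) b.val).val
    omega

end extend

/-- `fixedPoint` returns a sequence-form strategy that is fixed by the given deviation. -/
theorem fixedPoint_spec (O : FixedPointOracle) (ord : F.TopDownOrder) {φ : F.MixedDeviation}
    (hφ : φ.IsProper) {τ : F.J → ℕ}
    (hτ : ∀ k (M : Matrix (F.A k) (F.A k) ℝ), IsColStochastic M → O.time (F.A k) M ≤ τ k) :
    ((fixedPoint O ord φ).val.toFn ∈ F.polytope ∧
      φ.toMap (fixedPoint O ord φ).val.toFn = (fixedPoint O ord φ).val.toFn) ∧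
    (fixedPoint O ord φ).cost
      ≤ 102 * (Fintype.card F.SeqStar * Fintype.card F.Seq) + ∑ k, τ k
        + Fintype.card F.Seq + 5 := by
  classical
  have h := forEach_spec (l := ord.list)
    (x := (Arr.write (Vec.zeros F.Seq).val none (Word.ofNat 1).val).val)
    (f := fun k x => extend O φ k x)
    -- At visited information sets the vector satisfies both the flow equation and the fixed point
    -- equation; nonnegativity holds everywhere because unwritten entries are zero.
    (fun l x => x.toFn none = 1 ∧ (∀ s, 0 ≤ x.toFn s) ∧ ∀ k ∈ l,
      x.toFn (F.par k) = ∑ a, x.toFn (some ⟨k, a⟩) ∧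
      ∀ a, φ.toMap x.toFn (some ⟨k, a⟩) = x.toFn (some ⟨k, a⟩))
    (fun k => 100 * (Fintype.card (F.A k) * Fintype.card F.Seq) + τ k) ?_ ?_
  · obtain ⟨⟨h1, h2, h3⟩, h4⟩ := h
    refine ⟨⟨⟨h2, h1, fun k => (h3 k (ord.complete k)).1⟩, funext fun r => ?_⟩, ?_⟩
    · cases r with
      | none => exact MixedDeviation.toMap_none hφ _
      | some t => exact (h3 t.1 (ord.complete t.1)).2 t.2
    · have h5 := sum_map_le_of_nodup ord.nodup
        fun k => 100 * (Fintype.card (F.A k) * Fintype.card F.Seq) + τ k + 1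
      rw [Finset.sum_add_distrib, Finset.sum_add_distrib, ← Finset.mul_sum, ← Finset.sum_mul,
        sum_card_A, Finset.sum_const, Finset.card_univ, smul_eq_mul, mul_one] at h5
      have h6 : Fintype.card F.J ≤ Fintype.card F.SeqStar * Fintype.card F.Seq :=
        card_J_le.trans (Nat.le_mul_of_pos_right _ Fintype.card_pos)
      have h7 := h4.trans (Nat.add_le_add_right h5 1)
      exact (Nat.add_le_add_left (Nat.add_le_add_left (Nat.add_le_add_left h7 1) 1)
        (Fintype.card F.Seq + 1)).trans (by omega)
  · refine ⟨by simp, fun s => ?_, by simp⟩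
    cases s <;> simp
  · rintro l₁ k l₂ x hl ⟨h1, h2, h3⟩
    have hk : k ∉ l₁ := not_mem_of_nodup hl ord.nodup
    obtain ⟨v1, v2⟩ := extend_val O φ k x
    have hp : φ.toMap x.toFn (F.par k) = x.toFn (F.par k) := by
      cases hpar : F.par k with
      | none => exact MixedDeviation.toMap_none hφ _
      | some t =>
        exact (h3 t.1 (TopDownOrder.mem_of_infoLT ord.topDown hl (ord.complete _)
          (infoLT_of_par hpar))).2 t.2
    have hst := MixedDeviation.isColStochastic_extensionMatrix (k := k) hφ h2 hp
    have hne : ∀ t : F.SeqStar, t.1 ≠ k → ∀ a : F.A k, (some t : F.Seq) ≠ some ⟨k, a⟩ := by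
      rintro t ht a h
      cases h
      exact ht rfl
    have hlt : ∀ t : F.SeqStar, t.1 ≠ k →
        (extend O φ k x).val.toFn (some t) = x.toFn (some t) := fun t ht => v2 _ (hne t ht)
    have hpar : ∀ k', ¬ F.InfoLT k k' →
        (extend O φ k x).val.toFn (F.par k') = x.toFn (F.par k') := by
      intro k' hk'
      refine v2 _ fun a ha => hk' (infoLT_of_par ha)
    -- One description for both branches: the new values are the parent's mass times a distribution
    -- `b`. When that mass is zero any distribution fits, and the uniform one is taken.
    obtain ⟨b, hb0, hb1, hb2, hb3⟩ : ∃ b : F.A k → ℝ, (∀ a, 0 ≤ b a) ∧ ∑ a, b a = 1 ∧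
        (x.toFn (F.par k) ≠ 0 → Matrix.mulVec
          (fun a c => φ.extensionMatrix x.toFn k a c / x.toFn (F.par k)) b = b) ∧
        ∀ a, (extend O φ k x).val.toFn (some ⟨k, a⟩) = x.toFn (F.par k) * b a := by
      by_cases h0 : x.toFn (F.par k) = 0
      · refine ⟨fun _ => 1 / Fintype.card (F.A k), fun _ => by positivity, by simp,
          fun h => absurd h0 h, fun a => ?_⟩
        rw [v1, if_pos h0, h0, zero_mul]
      · have hs := O.mem_simplex (F.A k) _ (hst h0)
        refine ⟨_, hs.1, hs.2, fun _ => O.fixed (F.A k) _ (hst h0), fun a => ?_⟩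
        rw [v1, if_neg h0]
    refine ⟨⟨?_, fun s => ?_, fun k' hk' => ?_⟩, ?_⟩
    · rw [v2 _ (by simp), h1]
    · by_cases hs : ∃ a, s = some ⟨k, a⟩
      · obtain ⟨a, rfl⟩ := hs
        rw [hb3]
        exact mul_nonneg (h2 _) (hb0 a)
      · rw [v2 _ fun a ha => hs ⟨a, ha⟩]
        exact h2 s
    · by_cases hkk : k' = k
      · subst hkk
        refine ⟨?_, MixedDeviation.toMap_extension hφ h2 hp hb1 hb2 hb3 fun s hs => hlt s ?_⟩
        · simp only [hb3, ← Finset.mul_sum, hb1, mul_one]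
          exact hpar k' (infoLT_irrefl k')
        · intro h
          exact infoLT_irrefl k' (h ▸ hs)
      · have hk' : k' ∈ l₁ := by simpa [hkk] using hk'
        -- An earlier `k'` is not below `k`, so the new entries affect neither its flow equation nor
        -- its fixed point equation.
        have hkk' : ¬ F.InfoLT k k' := by
          intro h
          have := ord.topDown
          rw [hl, List.pairwise_append] at this
          exact this.2.2 k' hk' k (by simp) h
        obtain ⟨h4, h5⟩ := h3 k' hk'
        refine ⟨?_, fun a => ?_⟩
        · rw [hpar k' hkk', h4]
          exact Finset.sum_congr rfl fun a _ => (hlt ⟨k', a⟩ hkk).symm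
        · rw [hlt ⟨k', a⟩ hkk, ← h5 a]
          refine MixedDeviation.toMap_congr hφ fun s hs => hlt s ?_
          rintro rfl
          rcases hs with hs | hs
          · exact hkk hs.symm
          · exact hkk' hs
    · exact extend_cost O φ k x fun h0 => hτ k _ (hst h0)

/-! ### Reduction of deviation utilities to subtree utilities -/

theorem IsSubStrategy.congr {j : F.J} {z z' : F.Seq → ℝ} (hz : F.IsSubStrategy j z)
    (h : ∀ t : F.SeqStar, F.InfoLE j t.1 → z' (some t) = z (some t)) : F.IsSubStrategy j z' := by
  have h' : ∀ s, F.SeqGE s j → z' s = z s := by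
    rintro s ⟨k, a, rfl, hk⟩
    exact h _ hk
  refine ⟨fun s hs => h' s hs ▸ hz.nonneg s hs, ?_, fun k hk => ?_⟩
  · rw [← hz.root]
    exact Finset.sum_congr rfl fun a _ => h _ (InfoLE.refl j)
  · rw [h' _ (SeqGE.of_lt hk), hz.flow k hk]
    exact Finset.sum_congr rfl fun a _ => (h _ (Or.inr hk)).symm

theorem devMap_congr {s : F.SeqStar} {z z' : F.Seq → ℝ}
    (h : ∀ t : F.SeqStar, F.InfoLE s.1 t.1 → z (some t) = z' (some t)) :
    F.devMap s (fun r => z r.1) = F.devMap s fun r => z' r.1 := by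
  refine congrArg _ (funext ?_)
  rintro ⟨r, k, a, rfl, hk⟩
  exact h _ hk

theorem subValue_congr {j : F.J} {g : F.SeqStar → ℝ} {z z' : F.Seq → ℝ}
    (h : ∀ t : F.SeqStar, F.InfoLE j t.1 → z (some t) = z' (some t)) :
    F.subValue j g z = F.subValue j g z' := by
  refine Finset.sum_congr rfl fun t _ => ?_
  split_ifs with ht
  · rw [h t ht]
  · rfl

open Classical in
/-- The utility `y ↦ ℓ (φ_{s → y} q) - ℓ (φ_{s → 0} q)` of the continuation strategies for the
trigger `s`, where `ℓ` has the coefficients `l`. -/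
def triggerUtility (l q : F.Seq → ℝ) (s t : F.SeqStar) : ℝ :=
  if F.InfoLE s.1 t.1 then l (some t) * q (some s) else 0

open Classical in
-- The first sum is the value of the continuation zero and does not involve `z`. Hence differences
-- between continuations of the same trigger are differences of subtree values, the quantity that
-- CFR controls.
theorem sum_mul_devMap (l q z : F.Seq → ℝ) (s : F.SeqStar) :
    ∑ r, l r * F.devMap s (fun r => z r.1) q r
      = (∑ c : F.Seq, if ¬ F.SeqLE (some s) c then l c * q c else 0)
        + F.subValue s.1 (F.triggerUtility l q s) z := by
  simp only [devMap_apply, mul_add, Finset.sum_add_distrib]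
  congr 1
  · refine Finset.sum_congr rfl fun c _ => ?_
    by_cases h : F.SeqLE (some s) c <;> simp [h]
  · rw [Fintype.sum_option]
    simp only [seqGE_none, if_false, mul_zero, zero_add, seqGE_some, subValue, triggerUtility]
    refine Finset.sum_congr rfl fun t _ => ?_
    split_ifs <;> ring

section cfr

variable (ord : F.TopDownOrder) (j : F.J)

theorem cfrBehavior_nonneg (s : (cfr ord j).State) (k : F.J) (a : F.A k) :
    0 ≤ cfrBehavior ord j s k a := regretMatchingStrategy_nonneg _ _

theorem sum_cfrBehavior (s : (cfr ord j).State) (k : F.J) : ∑ a, cfrBehavior ord j s k a = 1 :=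
  sum_regretMatchingStrategy _

theorem cfr_step (s : (cfr ord j).State) (g : Vec F.SeqStar) {k : F.J} (hk : F.InfoLE j k)
    (a : F.A k) :
    cfrRegrets ord j ((cfr ord j).observe ((cfr ord j).next s).val.2 g).val k a
      = cfrRegrets ord j s k a + (F.cfUtility (cfrBehavior ord j s) g.toFn k a
        - F.cfValue (cfrBehavior ord j s) g.toFn k) := by
  have h := (cfr_next_spec ord j s).1.1
  rw [cfr_observe_spec ord j _ g (fun k hk => ⟨(h k hk).2.1, (h k hk).2.2⟩) k hk a]
  congr 1
  simp only [cfrRegrets, (h k hk).1]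

end cfr

/-! ## The complete algorithm -/

section mixedAlg

variable (O : FixedPointOracle) (ord : F.TopDownOrder)

/-- The cumulative regrets of the triggers in a state of the algorithm. -/
def triggerRegrets (S : (mixedAlg O ord).State) : F.SeqStar → ℝ := Vec.toFn S.1.1.1.1

/-- The state of the copy of CFR for a trigger. -/
def cfrState (S : (mixedAlg O ord).State) (s : F.SeqStar) : (cfr ord s.1).State :=
  Arr.get S.1.1.2 s

/-- The deviation of which the algorithm computes a fixed point. -/
def mixedDeviation (S : (mixedAlg O ord).State) : F.MixedDeviation :=
  ((deviationAlg ord).next S.1).val.1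

theorem mixedDeviation_weight (S : (mixedAlg O ord).State) :
    (mixedDeviation O ord S).1.toFn = regretMatchingStrategy (triggerRegrets O ord S) :=
  regretMatching_next_strategy S.1.1.1

theorem mixedDeviation_continuation (S : (mixedAlg O ord).State) (s t : F.SeqStar)
    (ht : F.InfoLE s.1 t.1) : (mixedDeviation O ord S).continuation s (some t)
      = F.realization (cfrBehavior ord s.1 (cfrState O ord S s)) s.1 (some t) := by
  have h := (hullAlg_next_spec (RΔ := regretMatching F.SeqStar)
    (R := fun s => triggerAlg s (cfr ord s.1)) S.1).2.2.2 s
  have h1 := (cfr_next_spec ord s.1 (cfrState O ord S s)).1.2 t ht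
  refine Eq.trans ?_ h1
  exact congrArg (fun v => Vec.toFn v t) h.1

theorem isProper_mixedDeviation [Nonempty F.J] (S : (mixedAlg O ord).State) :
    (mixedDeviation O ord S).IsProper := by
  have : Nonempty F.SeqStar :=
    ‹Nonempty F.J›.map fun k => ⟨k, Classical.arbitrary _⟩
  refine ⟨fun s => ?_, ?_, fun s => ?_⟩
  · rw [mixedDeviation_weight]
    exact regretMatchingStrategy_nonneg _ _
  · rw [mixedDeviation_weight]
    exact sum_regretMatchingStrategy _
  · exact (isSubStrategy_realization (cfrBehavior_nonneg ord s.1 _)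
      (sum_cfrBehavior ord s.1 _)).congr (mixedDeviation_continuation O ord S s)

/-- Each CFR output agrees on its subtree with the sequence form of a behavioral strategy, so each
component lies in the hull by Kuhn's theorem, and the weights average these components. -/
theorem mixedDeviation_toMap_mem [Nonempty F.J] (S : (mixedAlg O ord).State) :
    (mixedDeviation O ord S).toMap ∈ convexHull ℝ F.triggerDeviations := by
  have h := isProper_mixedDeviation O ord S
  rw [MixedDeviation.toMap_eq]
  refine (convex_convexHull ℝ _).sum_mem (fun s _ => h.nonneg s) h.sum_eq_one fun s _ => ?_
  rw [devMap_congr (mixedDeviation_continuation O ord S s)]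
  exact devMap_realization_mem_convexHull (cfrBehavior_nonneg ord s.1 _)
    (sum_cfrBehavior ord s.1 _) s

/-- The strategy that the algorithm plays in a state. -/
def mixedOutput (S : (mixedAlg O ord).State) : F.Seq → ℝ :=
  Vec.toFn ((mixedAlg O ord).next S).val.1

/-- The state after the next call of `next` and of `observe`. -/
def mixedStep (S : (mixedAlg O ord).State) (l : Vec F.Seq) : (mixedAlg O ord).State :=
  ((mixedAlg O ord).observe ((mixedAlg O ord).next S).val.2 l).val

/-- The program that computes the matrix of the functional `φ ↦ ℓ (φ q)`. -/
def functionalMatrix (l q : Vec F.Seq) : Tick (Vec (F.Seq × F.Seq)) :=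
  tabulate (elems (F.Seq × F.Seq)) fun p => do
    let a ← l.read p.1
    let b ← q.read p.2
    a.mul b

theorem functionalMatrix_val (l q : Vec F.Seq) (p : F.Seq × F.Seq) :
    (functionalMatrix l q).val.toFn p = l.toFn p.1 * q.toFn p.2 := by
  simp only [functionalMatrix, tabulate_val, mem_elems, if_true, Tick.val_bind, Word.val_mul,
    Arr.val_read, Vec.val_get]

/-- The utility of a trigger. -/
def mixedUtility (S : (mixedAlg O ord).State) (l : Vec F.Seq) (s : F.SeqStar) : ℝ :=
  ∑ r, l.toFn r * F.devMap s (fun r => (mixedDeviation O ord S).continuation s r.1)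
    (mixedOutput O ord S) r

theorem triggerRegrets_step (S : (mixedAlg O ord).State) (l : Vec F.Seq) (s : F.SeqStar) :
    triggerRegrets O ord (mixedStep O ord S l) s
      = triggerRegrets O ord S s + (mixedUtility O ord S l s
        - ∑ s', mixedUtility O ord S l s' * regretMatchingStrategy (triggerRegrets O ord S) s') := by
  classical
  obtain ⟨n1, n2, n3, -⟩ := hullAlg_next_spec (RΔ := regretMatching F.SeqStar)
    (R := fun s => triggerAlg s (cfr ord s.1)) S.1
  obtain ⟨⟨u, hu, ho⟩, -⟩ := hullAlg_observe_spec (RΔ := regretMatching F.SeqStar)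
    (R := fun s => triggerAlg s (cfr ord s.1)) ((deviationAlg ord).next S.1).val.2
    (functionalMatrix l ((mixedAlg O ord).next S).val.1).val
  -- The value computed from the diagonal and the trigger column of the matrix is `ℓ (φ_s q)`, by
  -- `sum_mul_devMap`.
  have hU : u.toFn = mixedUtility O ord S l := by
    ext s
    rw [hu, evalDeviation_val, mixedUtility, sum_mul_devMap]
    simp only [functionalMatrix_val, subValue, triggerUtility]
    congr 1
    refine Finset.sum_congr rfl fun t _ => ?_
    split_ifs
    · rfl
    · rfl
  have hr := congrArg (fun st : (regretMatching F.SeqStar).State => Vec.toFn st.1 s) ho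
  refine Eq.trans hr ?_
  have h2 := regretMatching_observe (((deviationAlg ord).next S.1).val.2.1.1) u s
  refine Eq.trans h2 ?_
  have h3 : ((deviationAlg ord).next S.1).val.2.1.1
      = ((regretMatching F.SeqStar).next S.1.1.1).val.2 := n2
  rw [h3, regretMatching_next_regret, regretMatching_next_last, regretMatching_next_strategy, hU]
  rfl

theorem cfrRegrets_step (S : (mixedAlg O ord).State) (l : Vec F.Seq) (s : F.SeqStar) {k : F.J}
    (hk : F.InfoLE s.1 k) (a : F.A k) :
    cfrRegrets ord s.1 (cfrState O ord (mixedStep O ord S l) s) k a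
      = cfrRegrets ord s.1 (cfrState O ord S s) k a
        + (F.cfUtility (cfrBehavior ord s.1 (cfrState O ord S s))
            (F.triggerUtility l.toFn (mixedOutput O ord S) s) k a
          - F.cfValue (cfrBehavior ord s.1 (cfrState O ord S s))
            (F.triggerUtility l.toFn (mixedOutput O ord S) s) k) := by
  classical
  obtain ⟨-, -, -, n4⟩ := hullAlg_next_spec (RΔ := regretMatching F.SeqStar)
    (R := fun s => triggerAlg s (cfr ord s.1)) S.1
  obtain ⟨-, ho⟩ := hullAlg_observe_spec (RΔ := regretMatching F.SeqStar)
    (R := fun s => triggerAlg s (cfr ord s.1)) ((deviationAlg ord).next S.1).val.2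
    (functionalMatrix l ((mixedAlg O ord).next S).val.1).val
  set Λ := (functionalMatrix l ((mixedAlg O ord).next S).val.1).val with hΛ
  set g := (tabulate (F.seqsFrom s.1) fun r => Λ.read (some r, some s)).val with hg
  have h1 : cfrState O ord (mixedStep O ord S l) s
      = ((cfr ord s.1).observe ((cfr ord s.1).next (cfrState O ord S s)).val.2 g).val :=
    (ho s).trans (congrArg (fun st => ((cfr ord s.1).observe st g).val) (n4 s).2)
  have h2 : g.toFn = F.triggerUtility l.toFn (mixedOutput O ord S) s := by
    ext t
    rw [hg, tabulate_val, triggerUtility]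
    simp only [seqsFrom, mem_elemsWith, Arr.val_read, Vec.val_get, hΛ, functionalMatrix_val]
    rfl
  rw [h1, cfr_step ord s.1 _ g hk a, h2]

/-- With `N = |Σ_*|`: `10 N + 20` steps for the simplex, `60 N + 2` for each of the `N` copies of
CFR and 4 to handle it, and the end of the loop. -/
theorem mixedAlg_next_cost (S : (mixedAlg O ord).State) :
    ((mixedAlg O ord).next S).cost
      ≤ 60 * (Fintype.card F.SeqStar * Fintype.card F.SeqStar) + 16 * Fintype.card F.SeqStar + 21
        + (fixedPoint O ord (mixedDeviation O ord S)).cost := by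
  have h := hullAlg_next_cost (RΔ := regretMatching F.SeqStar)
    (R := fun s => triggerAlg s (cfr ord s.1)) S.1 regretMatching_next_cost
    (fun s x => (cfr_next_spec ord s.1 x).2)
  exact Nat.add_le_add (h.trans (le_of_eq (by ring))) le_rfl

/-- Forming the matrix takes quadratic time. Each of the `|Σ_*|` copies of CFR then reads only its
own column, and each deviation value only a diagonal and a column, in linear time. -/
theorem mixedAlg_observe_cost (S : (mixedAlg O ord).State) (l : Vec F.Seq) :
    ((mixedAlg O ord).observe S l).cost ≤ 120 * (Fintype.card F.Seq * Fintype.card F.Seq) := by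
  have h1 : (functionalMatrix l S.2).cost ≤ Fintype.card F.Seq * Fintype.card F.Seq
      + 5 * (Fintype.card F.Seq * Fintype.card F.Seq) + 2 := by
    refine (tabulate_cost (ι := F.Seq × F.Seq) 3 _ fun p => le_rfl).trans ?_
    rw [length_elems, Fintype.card_prod]
  have h2 := hullAlg_observe_cost (RΔ := regretMatching F.SeqStar)
    (R := fun s => triggerAlg s (cfr ord s.1)) S.1 (functionalMatrix l S.2).val
    regretMatching_observe_cost
    (fun s x => triggerAlg_observe_cost (R := cfr ord s.1) x (cfr_observe_cost ord s.1 x) _)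
  refine (Nat.add_le_add h1 h2).trans ?_
  rw [Fintype.card_option]
  nlinarith

/-- The state of the algorithm at time `t`. -/
def mixedState (ℓ : ℕ → (F.Seq → ℝ) →ₗ[ℝ] ℝ) (t : ℕ) : (mixedAlg O ord).State :=
  (mixedAlg O ord).stateAt (canonical ℓ) t

theorem mixedState_succ (ℓ : ℕ → (F.Seq → ℝ) →ₗ[ℝ] ℝ) (t : ℕ) :
    mixedState O ord ℓ (t + 1) = mixedStep O ord (mixedState O ord ℓ t) (canonical ℓ t) := rfl

theorem strategyAt_eq (ℓ : ℕ → (F.Seq → ℝ) →ₗ[ℝ] ℝ) (t : ℕ) :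
    strategyAt O ord ℓ t = mixedOutput O ord (mixedState O ord ℓ t) := rfl

theorem deviationAt_eq (ℓ : ℕ → (F.Seq → ℝ) →ₗ[ℝ] ℝ) (t : ℕ) :
    deviationAt O ord ℓ t = (mixedDeviation O ord (mixedState O ord ℓ t)).toMap := rfl

theorem mixedState_congr {ℓ ℓ' : ℕ → (F.Seq → ℝ) →ₗ[ℝ] ℝ} {t : ℕ} (h : ∀ s < t, ℓ s = ℓ' s) :
    mixedState O ord ℓ t = mixedState O ord ℓ' t := by
  induction t with
  | zero => rfl
  | succ t ih =>
    rw [mixedState_succ, mixedState_succ, ih fun s hs => h s (hs.trans (Nat.lt_succ_self t)),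
      canonical, canonical, h t (Nat.lt_succ_self t)]

theorem apply_eq_sum_canonical (ℓ : ℕ → (F.Seq → ℝ) →ₗ[ℝ] ℝ) (t : ℕ) (x : F.Seq → ℝ) :
    ℓ t x = ∑ r, (canonical ℓ t).toFn r * x r := by
  rw [LinearMap.pi_apply_eq_sum_univ (ℓ t) x]
  refine Finset.sum_congr rfl fun r _ => ?_
  rw [smul_eq_mul, mul_comm, canonical, Vec.toFn_ofFn]
  congr 2
  ext r'
  simp [Pi.single_apply, eq_comm]

section

variable [Nonempty F.J] (ℓ : ℕ → (F.Seq → ℝ) →ₗ[ℝ] ℝ) (t : ℕ)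

theorem strategyAt_spec {τ : F.J → ℕ}
    (hτ : ∀ k (M : Matrix (F.A k) (F.A k) ℝ), IsColStochastic M → O.time (F.A k) M ≤ τ k) :
    strategyAt O ord ℓ t ∈ F.polytope ∧
      deviationAt O ord ℓ t (strategyAt O ord ℓ t) = strategyAt O ord ℓ t :=
  (fixedPoint_spec O ord (isProper_mixedDeviation O ord _) hτ).1

end

end mixedAlg

theorem triggerRegrets_zero (O : FixedPointOracle) (ord : F.TopDownOrder)
    (ℓ : ℕ → (F.Seq → ℝ) →ₗ[ℝ] ℝ) (s : F.SeqStar) :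
    triggerRegrets O ord (mixedState O ord ℓ 0) s = 0 := rfl

theorem cfrRegrets_zero (O : FixedPointOracle) (ord : F.TopDownOrder)
    (ℓ : ℕ → (F.Seq → ℝ) →ₗ[ℝ] ℝ) (s : F.SeqStar) (k : F.J) (a : F.A k) :
    cfrRegrets ord s.1 (cfrState O ord (mixedState O ord ℓ 0) s) k a = 0 := rfl

theorem triggerRegrets_succ (O : FixedPointOracle) (ord : F.TopDownOrder)
    (ℓ : ℕ → (F.Seq → ℝ) →ₗ[ℝ] ℝ) (t : ℕ) (s : F.SeqStar) :
    triggerRegrets O ord (mixedState O ord ℓ (t + 1)) s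
      = triggerRegrets O ord (mixedState O ord ℓ t) s
        + (mixedUtility O ord (mixedState O ord ℓ t) (canonical ℓ t) s
          - ∑ s', mixedUtility O ord (mixedState O ord ℓ t) (canonical ℓ t) s' *
            regretMatchingStrategy (triggerRegrets O ord (mixedState O ord ℓ t)) s') := by
  rw [mixedState_succ, triggerRegrets_step]

/-- The regret of the copy of CFR for the trigger `s`. -/
theorem sum_subValue_sub_le {O : FixedPointOracle} {ord : F.TopDownOrder}
    {ℓ : ℕ → (F.Seq → ℝ) →ₗ[ℝ] ℝ} {T : ℕ} {D : ℝ} (hD0 : 0 ≤ D) {s : F.SeqStar}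
    (hD : ∀ t < T, ∀ z z', F.IsSubStrategy s.1 z → F.IsSubStrategy s.1 z' →
      F.subValue s.1 (F.triggerUtility (canonical ℓ t).toFn (strategyAt O ord ℓ t) s) z
        - F.subValue s.1 (F.triggerUtility (canonical ℓ t).toFn (strategyAt O ord ℓ t) s) z' ≤ D)
    {z : F.Seq → ℝ} (hz : F.IsSubStrategy s.1 z) :
    ∑ t ∈ Finset.range T,
      (F.subValue s.1 (F.triggerUtility (canonical ℓ t).toFn (strategyAt O ord ℓ t) s) z
        - F.subValue s.1 (F.triggerUtility (canonical ℓ t).toFn (strategyAt O ord ℓ t) s)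
          ((mixedDeviation O ord (mixedState O ord ℓ t)).continuation s))
      ≤ D * Fintype.card F.SeqStar * √(T : ℝ) := by
  refine le_trans (le_of_eq (Finset.sum_congr rfl fun t _ => ?_)) (cfr_regret_le (j := s.1)
    (ρ := fun t => cfrRegrets ord s.1 (cfrState O ord (mixedState O ord ℓ t) s))
    (g := fun t => F.triggerUtility (canonical ℓ t).toFn (strategyAt O ord ℓ t) s)
    (fun k _ a => cfrRegrets_zero O ord ℓ s k a) (fun t k hk a => ?_) hD0 hD hz)
  · rw [subValue_congr (mixedDeviation_continuation O ord (mixedState O ord ℓ t) s)]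
    rfl
  · rw [mixedState_succ, cfrRegrets_step O ord _ _ s hk]
    rfl

/-! ### The regret bound -/

section regret

variable [Nonempty F.J] {O : FixedPointOracle} {ord : F.TopDownOrder}
  {ℓ : ℕ → (F.Seq → ℝ) →ₗ[ℝ] ℝ} {T : ℕ} {D : ℝ}

/-- The regret with respect to a trigger deviation. -/
theorem sum_devMap_sub_le (hq : ∀ t, strategyAt O ord ℓ t ∈ F.polytope)
    (hfix : ∀ t, deviationAt O ord ℓ t (strategyAt O ord ℓ t) = strategyAt O ord ℓ t)
    (hD : ∀ t < T, ∀ q ∈ F.polytope, ∀ q' ∈ F.polytope, ℓ t q - ℓ t q' ≤ D)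
    {s : F.SeqStar} {z : F.Seq → ℝ} (hz : F.IsSubStrategy s.1 z) :
    ∑ t ∈ Finset.range T, (ℓ t (F.devMap s (fun r => z r.1) (strategyAt O ord ℓ t))
      - ℓ t (strategyAt O ord ℓ t)) ≤ 2 * D * (Fintype.card F.Seq : ℝ) * √(T : ℝ) := by
  rcases Nat.eq_zero_or_pos T with rfl | hT
  · simp
  have hD0 : 0 ≤ D := by simpa using hD 0 hT _ (hq 0) _ (hq 0)
  have : Nonempty F.SeqStar := ⟨s⟩
  set S := mixedState O ord ℓ
  set q := strategyAt O ord ℓ with hqdef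
  set U : ℕ → F.SeqStar → ℝ := fun t => mixedUtility O ord (S t) (canonical ℓ t) with hUdef
  set ρ : ℕ → F.SeqStar → ℝ := fun t => triggerRegrets O ord (S t) with hρdef
  set g : ℕ → F.SeqStar → ℝ := fun t => F.triggerUtility (canonical ℓ t).toFn (q t) s with hgdef
  have hprop := fun t => isProper_mixedDeviation O ord (S t)
  have hU : ∀ t s, U t s
      = ℓ t (F.devMap s (fun r => (mixedDeviation O ord (S t)).continuation s r.1) (q t)) :=
    fun t s => (apply_eq_sum_canonical ℓ t _).symm
  -- `c t` is the value of the deviation with zero continuation; it cancels in every comparison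
  -- below.
  obtain ⟨c, hval⟩ : ∃ c : ℕ → ℝ, ∀ t (z : F.Seq → ℝ),
      ℓ t (F.devMap s (fun r => z r.1) (q t)) = c t + F.subValue s.1 (g t) z := by
    classical
    exact ⟨_, fun t z => by rw [apply_eq_sum_canonical, sum_mul_devMap]⟩
  -- The fixed point property enters here: the utility of `q t` is that of its image under the mixed
  -- deviation, which is the utility earned by the simplex player.
  have hloss : ∀ t, ℓ t (q t) = ∑ s', U t s' * regretMatchingStrategy (ρ t) s' := by
    intro t
    conv_lhs => rw [← hfix t, deviationAt_eq, MixedDeviation.toMap_eq]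
    simp only [LinearMap.sum_apply, LinearMap.smul_apply, map_sum, map_smul, smul_eq_mul, hU]
    refine Finset.sum_congr rfl fun s' _ => ?_
    rw [mul_comm, mixedDeviation_weight]
  have hρ0 : ∀ a, ρ 0 a = 0 := triggerRegrets_zero O ord ℓ
  have hρs : ∀ t a, ρ (t + 1) a
      = ρ t a + (U t a - ∑ b, U t b * regretMatchingStrategy (ρ t) b) :=
    triggerRegrets_succ O ord ℓ
  have htop : ρ T s ≤ D * √(Fintype.card F.SeqStar) * √T := by
    refine regretMatching_regret_le (ρ := ρ) (u := U) hρ0 hρs (fun t ht a b => ?_) s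
    rw [hU, hU]
    exact hD t ht _ (devMap_mem_polytope ((hprop t).continuation a) (hq t)) _
      (devMap_mem_polytope ((hprop t).continuation b) (hq t))
  have hsum : ∑ t ∈ Finset.range T, (U t s - ℓ t (q t)) = ρ T s := by
    have : ∀ T, ∑ t ∈ Finset.range T, (U t s - ℓ t (q t)) = ρ T s := by
      intro T
      induction T with
      | zero => rw [Finset.sum_range_zero, hρ0]
      | succ T ih =>
        rw [Finset.sum_range_succ, ih, hloss, hρs]
    exact this T
  have hcfr := sum_subValue_sub_le (O := O) (ord := ord) (ℓ := ℓ) (T := T) hD0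
    (fun t ht z z' hz hz' => by
      have := hD t ht _ (devMap_mem_polytope hz (hq t)) _ (devMap_mem_polytope hz' (hq t))
      rw [hval t z, hval t z'] at this
      linarith) hz
  -- Inserting the deviation with trigger `s` and the continuation played by CFR separates the
  -- regret of CFR from that of the simplex player.
  have hsplit : ∀ t, ℓ t (F.devMap s (fun r => z r.1) (q t)) - ℓ t (q t)
      = (F.subValue s.1 (g t) z
          - F.subValue s.1 (g t) ((mixedDeviation O ord (S t)).continuation s))
        + (U t s - ℓ t (q t)) := by
    intro t
    rw [hU, hval t z, hval t ((mixedDeviation O ord (S t)).continuation s)]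
    ring
  rw [Finset.sum_congr rfl fun t _ => hsplit t, Finset.sum_add_distrib, hsum]
  -- Both `|Σ_*|`, from CFR, and `√|Σ_*|`, from the simplex, are at most `|Σ|`, which yields the
  -- factor 2.
  refine (add_le_add hcfr htop).trans ?_
  have h1 : (1 : ℝ) ≤ Fintype.card F.SeqStar := by exact_mod_cast Fintype.card_pos
  have h2 : √(Fintype.card F.SeqStar : ℝ) ≤ Fintype.card F.SeqStar :=
    Real.sqrt_le_iff.2 ⟨by positivity, by nlinarith⟩
  have h3 : (Fintype.card F.SeqStar : ℝ) ≤ Fintype.card F.Seq := by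
    rw [Fintype.card_option]
    exact_mod_cast Nat.le_succ _
  have h4 : D * Fintype.card F.SeqStar * √(T : ℝ) ≤ D * Fintype.card F.Seq * √(T : ℝ) := by
    gcongr
  have h5 : D * √(Fintype.card F.SeqStar : ℝ) * √(T : ℝ) ≤ D * Fintype.card F.Seq * √(T : ℝ) := by
    gcongr
    exact h2.trans h3
  linarith

/-- The regret is affine in `φ`, so a bound on it defines a half-space. -/
theorem le_of_mem_convexHull {E : Type*} [AddCommGroup E] [Module ℝ E] {Φ : Set (E →ₗ[ℝ] E)}
    {ℓ : ℕ → E →ₗ[ℝ] ℝ} {x : ℕ → E} {T : ℕ} {c : ℝ}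
    (h : ∀ φ ∈ Φ, ∑ t ∈ Finset.range T, (ℓ t (φ (x t)) - ℓ t (x t)) ≤ c)
    {φ : E →ₗ[ℝ] E} (hφ : φ ∈ convexHull ℝ Φ) :
    ∑ t ∈ Finset.range T, (ℓ t (φ (x t)) - ℓ t (x t)) ≤ c := by
  have hc : Convex ℝ
      {φ : E →ₗ[ℝ] E | ∑ t ∈ Finset.range T, (ℓ t (φ (x t)) - ℓ t (x t)) ≤ c} := by
    have : {φ : E →ₗ[ℝ] E | ∑ t ∈ Finset.range T, (ℓ t (φ (x t)) - ℓ t (x t)) ≤ c}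
        = {φ | (∑ t ∈ Finset.range T, (ℓ t).comp (LinearMap.applyₗ (x t))) φ
          ≤ c + ∑ t ∈ Finset.range T, ℓ t (x t)} := by
      ext φ
      simp [Finset.sum_sub_distrib, LinearMap.sum_apply]
    rw [this]
    exact convex_halfSpace_le (LinearMap.isLinear _) _
  exact convexHull_min h hc hφ

/-- The regret relative to the convex hull of the trigger deviations is attained. -/
theorem isGreatest_phiRegret (x : ℕ → F.Seq → ℝ) :
    IsGreatest ((fun φ : (F.Seq → ℝ) →ₗ[ℝ] (F.Seq → ℝ) =>
        ∑ t ∈ Finset.range T, (ℓ t (φ (x t)) - ℓ t (x t))) '' convexHull ℝ F.triggerDeviations)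
      (phiRegret (convexHull ℝ F.triggerDeviations) ℓ x T) := by
  -- A maximizer over the finitely many trigger deviations also maximizes over their convex hull.
  obtain ⟨φ, hφ, hmax⟩ := finite_triggerDeviations.exists_maximalFor
    (fun φ : (F.Seq → ℝ) →ₗ[ℝ] (F.Seq → ℝ) =>
      ∑ t ∈ Finset.range T, (ℓ t (φ (x t)) - ℓ t (x t))) _ (nonempty_triggerDeviations (F := F))
  have hg : IsGreatest ((fun φ : (F.Seq → ℝ) →ₗ[ℝ] (F.Seq → ℝ) =>
        ∑ t ∈ Finset.range T, (ℓ t (φ (x t)) - ℓ t (x t))) '' convexHull ℝ F.triggerDeviations)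
      (∑ t ∈ Finset.range T, (ℓ t (φ (x t)) - ℓ t (x t))) := by
    refine ⟨⟨φ, subset_convexHull ℝ _ hφ, rfl⟩, ?_⟩
    rintro _ ⟨ψ, hψ, rfl⟩
    refine le_of_mem_convexHull (fun ψ hψ => ?_) hψ
    rcases le_total (∑ t ∈ Finset.range T, (ℓ t (ψ (x t)) - ℓ t (x t)))
      (∑ t ∈ Finset.range T, (ℓ t (φ (x t)) - ℓ t (x t))) with h | h
    · exact h
    · exact hmax hψ h
  rw [phiRegret, hg.csSup_eq]
  exact hg

theorem phiRegret_le (hq : ∀ t, strategyAt O ord ℓ t ∈ F.polytope)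
    (hfix : ∀ t, deviationAt O ord ℓ t (strategyAt O ord ℓ t) = strategyAt O ord ℓ t)
    (hD : ∀ t < T, ∀ q ∈ F.polytope, ∀ q' ∈ F.polytope, ℓ t q - ℓ t q' ≤ D) :
    phiRegret (convexHull ℝ F.triggerDeviations) ℓ (strategyAt O ord ℓ) T
      ≤ 2 * D * (Fintype.card F.Seq : ℝ) * √(T : ℝ) := by
  obtain ⟨φ, hφ, h⟩ := (isGreatest_phiRegret (T := T) (ℓ := ℓ) (strategyAt O ord ℓ)).1
  rw [← h]
  refine le_of_mem_convexHull (fun ψ hψ => ?_) hφ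
  obtain ⟨s, z, hz, rfl⟩ := exists_devMap_of_mem_triggerDeviations hψ
  exact sum_devMap_sub_le hq hfix hD hz

theorem isPhiRegretMinimizer_strategyAt
    (hq : ∀ ℓ t, strategyAt O ord ℓ t ∈ F.polytope)
    (hfix : ∀ ℓ t, deviationAt O ord ℓ t (strategyAt O ord ℓ t) = strategyAt O ord ℓ t) :
    IsPhiRegretMinimizer F.polytope (convexHull ℝ F.triggerDeviations) (strategyAt O ord) where
  mapsTo φ hφ := mapsTo_polytope hφ
  online ℓ ℓ' t h := by
    rw [strategyAt_eq, strategyAt_eq, mixedState_congr O ord h]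
  mem := hq
  attained ℓ T := isGreatest_phiRegret _
  sublinear := by
    rintro ℓ ⟨D, hD⟩ ε hε
    have hlim : Tendsto (fun T : ℕ => √(T : ℝ)) atTop atTop :=
      Real.tendsto_sqrt_atTop.comp tendsto_natCast_atTop_atTop
    -- From `2 D |Σ| / ε ≤ √T` on, the bound `2 D |Σ| √T` is at most `ε T`.
    filter_upwards [hlim.eventually_ge_atTop (2 * D * (Fintype.card F.Seq : ℝ) / ε)] with T hT
    refine (phiRegret_le (hq ℓ) (hfix ℓ) fun t _ => hD t).trans ?_
    rw [div_le_iff₀ hε] at hT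
    calc _ ≤ (√(T : ℝ) * ε) * √(T : ℝ) := mul_le_mul_of_nonneg_right hT (Real.sqrt_nonneg _)
      _ = ε * T := by
        rw [mul_right_comm, Real.mul_self_sqrt (Nat.cast_nonneg T), mul_comm]

end regret

end InfoForest

end

/-! ### The main theorem -/

theorem mainTheorem5 (K : ℝ≥0) :
    ∃ C : ℝ≥0, ∀ (n : ℕ) (G : ExtensiveGame n) (hG : G.PerfectRecall) (i : Fin n)
      (_ : Nonempty (G.InfoSet i)) (ord : (G.forest hG i).TopDownOrder)
      (FP : ℕ → ℝ≥0) (O : FixedPointOracle) (_ : O.RunsIn K FP),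
      IsPhiRegretMinimizer (G.forest hG i).polytope
        (convexHull ℝ (G.forest hG i).triggerDeviations) (InfoForest.strategyAt O ord) ∧
      ∀ ℓ : ℕ → ((G.forest hG i).Seq → ℝ) →ₗ[ℝ] ℝ,
        (∀ t, InfoForest.deviationAt O ord ℓ t ∈ convexHull ℝ (G.forest hG i).triggerDeviations ∧
          InfoForest.deviationAt O ord ℓ t (InfoForest.strategyAt O ord ℓ t) =
            InfoForest.strategyAt O ord ℓ t) ∧
        (∀ (T : ℕ) (D : ℝ),
          (∀ t < T, ∀ q ∈ (G.forest hG i).polytope, ∀ q' ∈ (G.forest hG i).polytope,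
            ℓ t q - ℓ t q' ≤ D) →
          phiRegret (convexHull ℝ (G.forest hG i).triggerDeviations) ℓ
              (InfoForest.strategyAt O ord ℓ) T ≤
            2 * D * (Fintype.card (G.forest hG i).Seq : ℝ) * √(T : ℝ)) ∧
        (∀ t, ((InfoForest.mixedAlg O ord).observeTime (InfoForest.canonical ℓ) t : ℝ≥0) ≤
          C * (Fintype.card (G.forest hG i).Seq : ℝ≥0) ^ 2) ∧
        (∀ t, ((InfoForest.mixedAlg O ord).nextTime (InfoForest.canonical ℓ) t : ℝ≥0) ≤
          C * ((Fintype.card (G.forest hG i).Seq : ℝ≥0) ^ 2 +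
            ∑ j, FP (Fintype.card ((G.forest hG i).A j)))) := by

  -- `300` covers the quadratic work of either operation, and `K` the oracle calls.
  refine ⟨300 + K, fun n G hG i hJ ord FP O hO => ?_⟩
  have : Nonempty (G.forest hG i).J := hJ
  -- Step counts are natural numbers, so the bound on the oracle may be rounded down.
  have hτ : ∀ k (M : Matrix ((G.forest hG i).A k) ((G.forest hG i).A k) ℝ), IsColStochastic M →
      O.time ((G.forest hG i).A k) M ≤ ⌊K * FP (Fintype.card ((G.forest hG i).A k))⌋₊ :=
    fun k M hM => Nat.le_floor (hO _ M hM)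
  -- From here on only the forest matters; the game has served to construct it.
  generalize G.forest hG i = F at *
  have hspec := fun ℓ t => InfoForest.strategyAt_spec O ord ℓ t hτ
  refine ⟨InfoForest.isPhiRegretMinimizer_strategyAt (fun ℓ t => (hspec ℓ t).1)
    fun ℓ t => (hspec ℓ t).2, fun ℓ => ⟨fun t => ⟨?_, (hspec ℓ t).2⟩, fun T D hD => ?_,
    fun t => ?_, fun t => ?_⟩⟩
  · exact InfoForest.mixedDeviation_toMap_mem O ord _
  · exact InfoForest.phiRegret_le (fun t => (hspec ℓ t).1) (fun t => (hspec ℓ t).2) hD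
  · have h : (InfoForest.mixedAlg O ord).observeTime (InfoForest.canonical ℓ) t
        ≤ 120 * (Fintype.card F.Seq * Fintype.card F.Seq) :=
      InfoForest.mixedAlg_observe_cost O ord _ _
    calc ((InfoForest.mixedAlg O ord).observeTime (InfoForest.canonical ℓ) t : ℝ≥0)
        ≤ 120 * (Fintype.card F.Seq : ℝ≥0) ^ 2 := by
          rw [sq]
          exact_mod_cast h
      _ ≤ _ := by
          gcongr
          exact le_add_right (by norm_num)
  · have h1 := InfoForest.mixedAlg_next_cost O ord (InfoForest.mixedState O ord ℓ t)
    have h2 := (InfoForest.fixedPoint_spec O ord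
      (InfoForest.isProper_mixedDeviation O ord (InfoForest.mixedState O ord ℓ t)) hτ).2
    have h3 : (InfoForest.mixedAlg O ord).nextTime (InfoForest.canonical ℓ) t
        ≤ 300 * (Fintype.card F.Seq * Fintype.card F.Seq)
          + ∑ k, ⌊K * FP (Fintype.card (F.A k))⌋₊ := by
      refine h1.trans ((Nat.add_le_add_left h2 _).trans ?_)
      rw [Fintype.card_option]
      generalize Fintype.card F.SeqStar = N
      nlinarith
    have h4 : ((∑ k, ⌊K * FP (Fintype.card (F.A k))⌋₊ : ℕ) : ℝ≥0)
        ≤ K * ∑ k, FP (Fintype.card (F.A k)) := by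
      rw [Nat.cast_sum, Finset.mul_sum]
      exact Finset.sum_le_sum fun k _ => Nat.floor_le zero_le
    calc ((InfoForest.mixedAlg O ord).nextTime (InfoForest.canonical ℓ) t : ℝ≥0)
        ≤ 300 * (Fintype.card F.Seq : ℝ≥0) ^ 2
          + ((∑ k, ⌊K * FP (Fintype.card (F.A k))⌋₊ : ℕ) : ℝ≥0) := by
          rw [sq]
          exact_mod_cast h3
      _ ≤ (300 + K) * (Fintype.card F.Seq : ℝ≥0) ^ 2
          + (300 + K) * ∑ k, FP (Fintype.card (F.A k)) := by
          refine add_le_add ?_ (h4.trans ?_)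
          · gcongr
            exact le_add_right le_rfl
          · gcongr
            exact le_add_left le_rfl
      _ = _ := by ring
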